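/- Let $\mathbb S^1=\mathbb R/\mathbb Z$ with Lebesgue measure. A map $T:\mathbb S^1\to\mathbb S^1$ is piecewise $C^2$ if there are finitely many points $0=d_0<d_1<\dots<d_n=1$ such that each restriction $T|_{(d_i,d_{i+1})}$ extends to a $C^2$ function on $[d_i,d_{i+1}]$; its expanding constant is the infimum of $|T'|$ over these closed intervals (one-sided derivatives at the endpoints). $T$ is piecewise expanding if it is piecewise $C^2$ and, for some $k\ge1$, the iterate $T^k$ is piecewise $C^2$ with expanding constant larger than $1$. A turning point is a point where $T$ is not differentiable; it is periodic if some chain of at least one step of $T$ leads from it back to itself, where at a discontinuity both one-sided limits of $T$ count as images. Let $\rho\ge0$ be a probability density of bounded variation supported in $[-1,1]$, let $\rho_\delta(x)=\frac1\delta\rho(x/\delta)$ for $\delta>0$ and let $\rho_0$ be the Dirac mass at $0$. Let $L_\delta\mu=\rho_\delta*T_*\mu$ (convolution on $\mathbb S^1$). A stationary measure of $L_\delta$ is a probability measure $\mu$ with $L_\delta\mu=\mu$; its density, if it has one, is a stationary density. (1) Let $T$ be piecewise expanding without periodic turning points. For every $\delta\in(0,1]$, every stationary measure of $L_\delta$ has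 a Lipschitz density. Suppose moreover that $T$ has a unique invariant probability density $h_0$. Then for every $\bar\delta\in(0,1)$ there is $C\ge0$ such that for all $\delta\in[0,\bar\delta)$ and every stationary density $h_\delta$ of $L_\delta$, $$\|h_0-h_\delta\|_{L^1}\le C\,\delta\,|\log\delta|$$ (the right-hand side being $0$ for $\delta=0$). (2) The map $T(x)=x+\frac12$ on $[0,\frac12]$, $T(x)=2(1-x)$ on $(\frac12,1)$ (mod $1$) is piecewise expanding, the points $0$ and $\frac12$ are periodic turning points of it, and the function $h_0$ equal to $\frac23$ on $[0,\frac12]$ and $\frac43$ on $(\frac12,1)$ is an invariant density of $T$ which does not agree almost everywhere with any continuous function. For every $\rho$ as above there is $C'>0$ such that for all $\delta\in[0,1]$ and every stationary density $h_\delta$ of $L_\delta$ for this map, $$\|h_0-h_\delta\|_{L^1}\ge C'\delta .$$ -/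

import Mathlib

open MeasureTheory Set Filter Topology

noncomputable section

namespace PiecewiseNoise

/-- `T` is piecewise `C²` on the circle `ℝ/ℤ`, with expanding constant at least `Λ`: there are
points `0 = d 0 < d 1 < ⋯ < d n = 1` such that on each open arc `(d i, d (i+1))` the map `T` is
given by (the class mod `1` of) a function `g` which is `C²` on the closed interval
`[d i, d (i+1)]`, and `Λ ≤ |g'|` on this closed interval (one-sided derivatives at the ends). -/
def IsPiecewiseC2With (T : UnitAddCircle → UnitAddCircle) (Λ : ℝ) : Prop :=
  ∃ (n : ℕ) (d : ℕ → ℝ), d 0 = 0 ∧ d n = 1 ∧ (∀ i < n, d i < d (i + 1)) ∧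
    ∀ i < n, ∃ g : ℝ → ℝ, ContDiffOn ℝ 2 g (Icc (d i) (d (i + 1))) ∧
      (∀ x ∈ Ioo (d i) (d (i + 1)), T (x : UnitAddCircle) = ((g x : ℝ) : UnitAddCircle)) ∧
      ∀ x ∈ Icc (d i) (d (i + 1)), Λ ≤ |derivWithin g (Icc (d i) (d (i + 1))) x|

/-- `T` is piecewise `C²` (no condition on the size of the derivative). -/
def IsPiecewiseC2 (T : UnitAddCircle → UnitAddCircle) : Prop :=
  IsPiecewiseC2With T 0

/-- `T` is piecewise expanding: it is piecewise `C²` and some iterate `T^k`, `k > 0`, has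
expanding constant larger than `1`. -/
def IsPiecewiseExpanding (T : UnitAddCircle → UnitAddCircle) : Prop :=
  IsPiecewiseC2 T ∧ ∃ k : ℕ, 0 < k ∧ ∃ Λ : ℝ, 1 < Λ ∧ IsPiecewiseC2With T^[k] Λ

/-- Differentiability of a circle map at a point, in the coordinate of the universal cover: near
`x` the map is given by a real function which is differentiable there. -/
def CircleDifferentiableAt (T : UnitAddCircle → UnitAddCircle) (x : UnitAddCircle) : Prop :=
  ∃ (t : ℝ) (g : ℝ → ℝ), (t : UnitAddCircle) = x ∧ DifferentiableAt ℝ g t ∧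
    ∀ᶠ s : ℝ in 𝓝 t, T (s : UnitAddCircle) = ((g s : ℝ) : UnitAddCircle)

/-- A turning point is a point where the derivative of the map is not defined. -/
def IsTurningPoint (T : UnitAddCircle → UnitAddCircle) (c : UnitAddCircle) : Prop :=
  ¬ CircleDifferentiableAt T c

/-- `y` is a limit value of `T` at `x`. For a piecewise `C²` map these are the one-sided limits
`T(x-)` and `T(x+)`; where `T` is continuous the only limit value is `T x`. -/
def IsLimitValue (T : UnitAddCircle → UnitAddCircle) (x y : UnitAddCircle) : Prop :=
  MapClusterPt y (𝓝[≠] x) T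

/-- A periodic turning point: a turning point which is mapped to itself by a finite, non-zero
number of steps of `T`, where at a discontinuity both one-sided limits count as images. For
continuous `T` this says that `T^n c = c` for some `n ≥ 1`. -/
def IsPeriodicTurningPoint (T : UnitAddCircle → UnitAddCircle) (c : UnitAddCircle) : Prop :=
  IsTurningPoint T c ∧ Relation.TransGen (IsLimitValue T) c c

/-- A noise kernel: a probability density of bounded variation on `[-1,1]`, extended by `0`. -/
structure IsNoiseKernel (ρ : ℝ → ℝ) : Prop where
  nonneg : ∀ z, 0 ≤ ρ z
  support : ∀ z, z ∉ Icc (-1 : ℝ) 1 → ρ z = 0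
  boundedVariation : BoundedVariationOn ρ (Icc (-1 : ℝ) 1)
  integral_eq_one : ∫ z, ρ z = 1

/-- The rescaled kernel `ρ_δ(x) = δ⁻¹ ρ(x/δ)`. -/
def rescaledKernel (ρ : ℝ → ℝ) (δ x : ℝ) : ℝ := 1 / δ * ρ (x / δ)

/-- The law on the circle of the noise of amplitude `δ`: the measure with density `ρ_δ`, taken
mod `1`, if `δ ≠ 0`, and the Dirac mass at `0` if `δ = 0`. -/
def noiseLaw (ρ : ℝ → ℝ) (δ : ℝ) : Measure UnitAddCircle :=
  if δ = 0 then Measure.dirac 0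
  else (volume.withDensity fun x : ℝ => ENNReal.ofReal (rescaledKernel ρ δ x)).map
    fun x : ℝ => (x : UnitAddCircle)

/-- The annealed transfer operator `L_δ = ρ_δ ∗ L_T` on measures, `L_T` being the pushforward. -/
def annealedTransfer (T : UnitAddCircle → UnitAddCircle) (ρ : ℝ → ℝ) (δ : ℝ)
    (μ : Measure UnitAddCircle) : Measure UnitAddCircle :=
  (noiseLaw ρ δ).conv (μ.map T)

/-- The measure `h dx` on the circle. -/
def densityMeasure (h : UnitAddCircle → ℝ) : Measure UnitAddCircle :=
  volume.withDensity fun x => ENNReal.ofReal (h x)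

/-- `h` is a probability density on the circle (with respect to Lebesgue measure). -/
structure IsProbabilityDensity (h : UnitAddCircle → ℝ) : Prop where
  integrable : Integrable h
  nonneg : ∀ᵐ x, 0 ≤ h x
  integral_eq_one : ∫ x, h x = 1

/-- `h` is an invariant probability density of `T`. -/
def IsInvariantDensity (T : UnitAddCircle → UnitAddCircle) (h : UnitAddCircle → ℝ) : Prop :=
  IsProbabilityDensity h ∧ (densityMeasure h).map T = densityMeasure h

/-- `h` is a stationary probability density of the system with noise of amplitude `δ`. -/
def IsStationaryDensity (T : UnitAddCircle → UnitAddCircle) (ρ : ℝ → ℝ) (δ : ℝ)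
    (h : UnitAddCircle → ℝ) : Prop :=
  IsProbabilityDensity h ∧ annealedTransfer T ρ δ (densityMeasure h) = densityMeasure h

/-- The map `x + 1/2` on `[0,1/2]`, `2(1-x)` on `[1/2,1)`, on the circle. -/
def exampleMap : UnitAddCircle → UnitAddCircle :=
  AddCircle.liftIco 1 0 fun x : ℝ =>
    if x ≤ 1 / 2 then ((x + 1 / 2 : ℝ) : UnitAddCircle) else ((2 * (1 - x) : ℝ) : UnitAddCircle)

/-- The density `2/3` on `[0,1/2]`, `4/3` on `(1/2,1)`, on the circle. -/
def exampleDensity : UnitAddCircle → ℝ :=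
  AddCircle.liftIco 1 0 fun x : ℝ => if x ≤ 1 / 2 then (2 / 3 : ℝ) else 4 / 3

end PiecewiseNoise

end

open PiecewiseNoise

namespace PiecewiseNoise

noncomputable section

/-! ### The circle -/

instance : IsProbabilityMeasure (volume : Measure UnitAddCircle) :=
  ⟨UnitAddCircle.measure_univ⟩

theorem norm_coe_le_abs (t : ℝ) : ‖(t : UnitAddCircle)‖ ≤ |t| := by
  rw [UnitAddCircle.norm_eq]
  simpa using round_le t 0

theorem exists_real_add_eq (x y : UnitAddCircle) : ∃ t : ℝ, x + t = y ∧ |t| = dist x y := by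
  have h : ∃ t ∈ Ico (-(1 / 2) : ℝ) (-(1 / 2) + 1), (t : UnitAddCircle) = y - x := by
    have := AddCircle.coe_image_Ico_eq (1 : ℝ) (-(1 / 2))
    have h1 : y - x ∈ ((↑) : ℝ → UnitAddCircle) '' Ico (-(1 / 2) : ℝ) (-(1 / 2) + 1) := by
      rw [this]; trivial
    exact h1
  obtain ⟨t, ht, h⟩ := h
  refine ⟨t, by rw [h]; abel, ?_⟩
  rw [dist_comm, dist_eq_norm, ← h, (AddCircle.norm_coe_eq_abs_iff (1 : ℝ) one_ne_zero).2]
  rw [abs_le, abs_one]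
  constructor <;> linarith [ht.1, ht.2]

theorem volume_countable_eq_zero {S : Set UnitAddCircle} (hS : S.Countable) : volume S = 0 := by
  have : NullSingletonClass (volume : Measure UnitAddCircle) := ⟨fun x => by
    have := AddCircle.volume_closedBall (T := 1) (x := x) 0
    simpa using this⟩
  exact hS.measure_zero _

theorem coe_eq_coe_iff {x y : ℝ} : (x : UnitAddCircle) = y ↔ ∃ m : ℤ, y = x + m := by
  rw [eq_comm, ← sub_eq_zero, ← AddCircle.coe_sub, AddCircle.coe_eq_zero_iff]
  refine exists_congr fun m => ?_
  simp only [zsmul_eq_mul, mul_one]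
  constructor <;> intro h <;> linarith

theorem coe_add_int (x : ℝ) (m : ℤ) : ((x + m : ℝ) : UnitAddCircle) = x :=
  (coe_eq_coe_iff.2 ⟨m, rfl⟩).symm

theorem countable_coe_preimage {S : Set UnitAddCircle} (hS : S.Countable) :
    {x : ℝ | (x : UnitAddCircle) ∈ S}.Countable := by
  have : {x : ℝ | (x : UnitAddCircle) ∈ S} = ⋃ y ∈ S, {x : ℝ | (x : UnitAddCircle) = y} := by
    ext; simp
  rw [this]
  refine hS.biUnion fun y _ => ?_
  obtain ⟨z, rfl⟩ := QuotientAddGroup.mk_surjective y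
  refine (countable_range fun m : ℤ => z + m).mono ?_
  intro x hx
  obtain ⟨m, hm⟩ := coe_eq_coe_iff.1 (Eq.symm hx)
  exact ⟨m, hm.symm⟩

theorem exists_mem_Ico_of_partition {n : ℕ} {d : ℕ → ℝ} {y : ℝ} (h0 : d 0 ≤ y) (hn : y < d n) :
    ∃ a < n, y ∈ Ico (d a) (d (a + 1)) := by
  induction n with
  | zero => exact absurd (h0.trans_lt hn) (lt_irrefl _)
  | succ m ih =>
    by_cases h : y < d m
    · obtain ⟨a, ha, hy⟩ := ih h
      exact ⟨a, ha.trans (Nat.lt_succ_self m), hy⟩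
    · exact ⟨m, Nat.lt_succ_self m, not_lt.1 h, hn⟩

theorem partition_mono {n : ℕ} {d : ℕ → ℝ} (hd : ∀ i < n, d i < d (i + 1)) {i j : ℕ} (hij : i ≤ j)
    (hj : j ≤ n) : d i ≤ d j := by
  induction j, hij using Nat.le_induction with
  | base => exact le_rfl
  | succ j _ ih => exact (ih (by omega)).trans (hd j (by omega)).le

/-! ### Test pairs and variation -/

/-- `Φ` is a continuous function on the circle, with bounded derivative `φ` off a countable set. -/
structure TestPair (Φ φ : UnitAddCircle → ℝ) : Prop where
  cont : Continuous Φ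
  meas : Measurable φ
  bdd : ∃ C, ∀ x, |φ x| ≤ C
  hasDeriv : ∃ S : Set UnitAddCircle, S.Countable ∧
    ∀ x ∉ S, HasDerivAt (fun t : ℝ => Φ (x + t)) (φ x) 0

/-- The variation of `f`, weighted by `W`, is at most `K`. -/
def VarLE (W : UnitAddCircle → ℝ) (f : UnitAddCircle → ℝ) (K : ℝ) : Prop :=
  ∀ Φ φ, TestPair Φ φ → (∀ x, |Φ x| ≤ W x) → ∫ x, f x * φ x ≤ K

theorem exists_testPair_of_pieces {n : ℕ} {d : ℕ → ℝ} (h0 : d 0 = 0) (hn : d n = 1)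
    (hd : ∀ i < n, d i < d (i + 1)) (Ψ ψ : ℕ → ℝ → ℝ) {S : Set ℝ} (hS : S.Countable) {C : ℝ}
    (hcont : ∀ a < n, ContinuousOn (Ψ a) (Icc (d a) (d (a + 1))))
    (hmatch : ∀ a, a + 1 < n → Ψ a (d (a + 1)) = Ψ (a + 1) (d (a + 1)))
    (hend : Ψ (n - 1) 1 = Ψ 0 0)
    (hder : ∀ a < n, ∀ x ∈ Ioo (d a) (d (a + 1)), x ∉ S → HasDerivAt (Ψ a) (ψ a x) x)
    (hbd : ∀ a < n, ∀ x ∈ Ioo (d a) (d (a + 1)), x ∉ S → |ψ a x| ≤ C) :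
    ∃ Φ φ, TestPair Φ φ ∧ (∀ a < n, ∀ x ∈ Icc (d a) (d (a + 1)), Φ x = Ψ a x) ∧
      ∃ S' : Set UnitAddCircle, S'.Countable ∧
        ∀ a < n, ∀ x ∈ Ioo (d a) (d (a + 1)), (x : UnitAddCircle) ∉ S' → φ x = ψ a x := by
  have hnpos : 0 < n := by
    rcases Nat.eq_zero_or_pos n with rfl | h
    · rw [h0] at hn; norm_num at hn
    · exact h
  have hF : ∀ m, 1 ≤ m → m ≤ n →
      ∃ F : ℝ → ℝ, ∀ a < m, ∀ x ∈ Icc (d a) (d (a + 1)), F x = Ψ a x := by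
    intro m hm
    induction m, hm using Nat.le_induction with
    | base => exact fun _ => ⟨Ψ 0, fun a ha x _ => by rw [Nat.lt_one_iff.1 ha]⟩
    | succ m hm ih =>
      intro hmn
      obtain ⟨F, hF⟩ := ih (by omega)
      refine ⟨fun x => if x ≤ d m then F x else Ψ m x, fun a ha x hx => ?_⟩
      rcases Nat.lt_succ_iff_lt_or_eq.1 ha with h | rfl
      · have : x ≤ d m := hx.2.trans (partition_mono hd (by omega) (by omega))
        simp only [this, if_true]
        exact hF a h x hx
      · by_cases hxm : x ≤ d a
        · have hxe : x = d a := le_antisymm hxm hx.1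
          obtain ⟨b, rfl⟩ : ∃ b, a = b + 1 := ⟨a - 1, by omega⟩
          simp only [hxm, if_true]
          rw [hF b (by omega) x ⟨hxe ▸ (hd b (by omega)).le, hxm⟩, hxe]
          exact hmatch b (by omega)
        · simp only [hxm, if_false]
  obtain ⟨F, hF⟩ := hF n hnpos le_rfl
  have hFc : ∀ m ≤ n, ContinuousOn F (Icc (d 0) (d m)) := by
    intro m
    induction m with
    | zero => intro _; simp
    | succ m ih =>
      intro hm
      have h1 : Icc (d 0) (d (m + 1)) = Icc (d 0) (d m) ∪ Icc (d m) (d (m + 1)) :=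
        (Icc_union_Icc_eq_Icc (partition_mono hd (Nat.zero_le _) (by omega))
          (hd m (by omega)).le).symm
      rw [h1]
      exact (ih (by omega)).union_of_isClosed
        ((hcont m (by omega)).congr (hF m (by omega))) isClosed_Icc isClosed_Icc
  have hFcont := hFc n le_rfl
  rw [h0, hn] at hFcont
  have hF0 : F 0 = Ψ 0 0 := by
    rw [← h0]; exact hF 0 hnpos _ ⟨le_rfl, (hd 0 hnpos).le⟩
  have hF1 : F 1 = Ψ (n - 1) 1 := by
    have h1 : n - 1 + 1 = n := by omega
    have := hF (n - 1) (by omega) 1 ⟨by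
      rw [← hn]; exact partition_mono hd (by omega) le_rfl, by rw [h1, hn]⟩
    exact this
  set Φ : UnitAddCircle → ℝ := AddCircle.liftIco 1 0 F with hΦ
  have hΦc : Continuous Φ := AddCircle.liftIco_zero_continuous (by rw [hF0, hF1, hend]) hFcont
  have hΦF : ∀ x ∈ Icc (0 : ℝ) 1, Φ x = F x := by
    intro x hx
    rcases hx.2.lt_or_eq with h | h
    · exact AddCircle.liftIco_zero_coe_apply ⟨hx.1, h⟩
    · have : (x : UnitAddCircle) = ((0 : ℝ) : UnitAddCircle) := by
        rw [h]; simp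
      rw [this, h, hF1, hend, ← hF0]
      exact AddCircle.liftIco_zero_coe_apply ⟨le_rfl, one_pos⟩
  have hsub : ∀ a < n, Icc (d a) (d (a + 1)) ⊆ Icc 0 1 := by
    intro a ha
    rw [← h0, ← hn]
    exact Icc_subset_Icc (partition_mono hd (Nat.zero_le _) ha.le) (partition_mono hd ha le_rfl)
  set S' : Set UnitAddCircle := (fun x : ℝ => (x : UnitAddCircle)) '' (S ∪ range d) with hS'
  have hS'c : S'.Countable := (hS.union (countable_range d)).image _
  have key : ∀ a < n, ∀ x ∈ Ioo (d a) (d (a + 1)), x ∉ S →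
      HasDerivAt (fun t : ℝ => Φ (x + t)) (ψ a x) 0 := by
    intro a ha x hx hxS
    have h1 := hder a ha x hx hxS
    have h2 : HasDerivAt (fun t : ℝ => Ψ a (x + t)) (ψ a x) 0 := by
      have := HasDerivAt.comp_const_add x 0 (by simpa using h1)
      exact this
    refine h2.congr_of_eventuallyEq ?_
    have h3 : ∀ᶠ t : ℝ in 𝓝 0, x + t ∈ Ioo (d a) (d (a + 1)) := by
      have : ContinuousAt (fun t : ℝ => x + t) 0 := by fun_prop
      exact this.eventually (isOpen_Ioo.mem_nhds (by simpa using hx))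
    filter_upwards [h3] with t ht
    rw [← AddCircle.coe_add, hΦF _ (hsub a ha (Ioo_subset_Icc_self ht)),
      hF a ha _ (Ioo_subset_Icc_self ht)]
  set φ : UnitAddCircle → ℝ := S'ᶜ.indicator fun x => deriv (fun t : ℝ => Φ (x + t)) 0 with hφ
  have hφψ : ∀ a < n, ∀ x ∈ Ioo (d a) (d (a + 1)), (x : UnitAddCircle) ∉ S' → φ x = ψ a x := by
    intro a ha x hx hxS
    rw [hφ, indicator_of_mem (by exact hxS)]
    exact (key a ha x hx fun h => hxS ⟨x, Or.inl h, rfl⟩).deriv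
  have hrep : ∀ x ∉ S', ∃ a < n, ∃ y ∈ Ioo (d a) (d (a + 1)), y ∉ S ∧ (y : UnitAddCircle) = x := by
    intro x hx
    obtain ⟨y, hy, rfl⟩ := AddCircle.eq_coe_Ico x
    obtain ⟨a, ha, hya⟩ := exists_mem_Ico_of_partition (d := d) (n := n) (y := y)
      (by rw [h0]; exact hy.1) (by rw [hn]; exact hy.2)
    refine ⟨a, ha, y, ⟨lt_of_le_of_ne hya.1 fun h => hx ⟨y, Or.inr ⟨a, h⟩, rfl⟩, hya.2⟩,
      fun h => hx ⟨y, Or.inl h, rfl⟩, rfl⟩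
  refine ⟨Φ, φ, ⟨hΦc, ?_, ⟨max C 0, ?_⟩, S', hS'c, ?_⟩, ?_, S', hS'c, hφψ⟩
  · refine Measurable.indicator ?_ hS'c.measurableSet.compl
    have hc : Continuous (Function.uncurry fun (x : UnitAddCircle) (t : ℝ) => Φ (x + t)) := by
      apply hΦc.comp
      exact continuous_fst.add ((AddCircle.continuous_mk' (1 : ℝ)).comp continuous_snd)
    exact (measurable_deriv_with_param hc).comp (measurable_id.prodMk measurable_const)
  · intro x
    by_cases hx : x ∈ S'
    · rw [hφ, indicator_of_notMem (by simpa using hx)]; simp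
    · obtain ⟨a, ha, y, hy, hyS, rfl⟩ := hrep x hx
      rw [hφψ a ha y hy hx]
      exact (hbd a ha y hy hyS).trans (le_max_left _ _)
  · intro x hx
    obtain ⟨a, ha, y, hy, hyS, rfl⟩ := hrep x hx
    rw [hφψ a ha y hy hx]
    exact key a ha y hy hyS
  · intro a ha x hx
    rw [hΦF x (hsub a ha hx), hF a ha x hx]

/-! ### Duality in `L¹` -/

theorem exists_abs_le_of_continuous {φ : UnitAddCircle → ℝ} (hφ : Continuous φ) :
    ∃ C, ∀ x, |φ x| ≤ C := by
  obtain ⟨C, hC⟩ := isCompact_univ.exists_bound_of_continuousOn hφ.continuousOn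
  exact ⟨C, fun x => hC x trivial⟩

theorem integrable_mul_of_abs_le {f φ : UnitAddCircle → ℝ} (hf : Integrable f)
    (hφ : Measurable φ) {C : ℝ} (hC : ∀ x, |φ x| ≤ C) : Integrable fun x => f x * φ x :=
  hf.mul_bdd (c := C) hφ.aestronglyMeasurable (Eventually.of_forall hC)

theorem integrable_of_abs_le {φ : UnitAddCircle → ℝ} (hφ : Measurable φ) {C : ℝ}
    (hC : ∀ x, |φ x| ≤ C) : Integrable φ :=
  (integrable_const C).mono' hφ.aestronglyMeasurable (Eventually.of_forall hC)

theorem integral_abs_le_of_forall_continuous {u : UnitAddCircle → ℝ} (hu : Integrable u) {K : ℝ}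
    (h : ∀ φ : UnitAddCircle → ℝ, Continuous φ → (∀ x, |φ x| ≤ 1) → ∫ x, u x * φ x ≤ K) :
    ∫ x, |u x| ≤ K := by
  have key : ∀ ε > 0, ∫ x, |u x| ≤ K + 3 * ε := by
    intro ε hε
    obtain ⟨v, -, hv, hvc, hvi⟩ := hu.exists_hasCompactSupport_integral_sub_le hε
    have hden : ∀ x, 0 < |v x| + ε := fun x => by positivity
    set φ : UnitAddCircle → ℝ := fun x => v x / (|v x| + ε) with hφ
    have hφc : Continuous φ := hvc.div (hvc.abs.add continuous_const) fun x => (hden x).ne'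
    have hφ1 : ∀ x, |φ x| ≤ 1 := fun x => by
      rw [hφ, abs_div, abs_of_pos (hden x), div_le_one (hden x)]
      linarith
    have hi : Integrable fun x => u x * φ x := integrable_mul_of_abs_le hu hφc.measurable hφ1
    have hle : ∀ x, |u x| ≤ u x * φ x + 2 * ‖u x - v x‖ + ε := by
      intro x
      have h1 : |u x| ≤ ‖u x - v x‖ + |v x| := by
        have := abs_add_le (u x - v x) (v x)
        simpa using this
      have h2 : |v x| ≤ v x * φ x + ε := by
        have : v x * φ x = |v x| ^ 2 / (|v x| + ε) := by
          rw [hφ, sq_abs]; ring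
        rw [this, ← sub_le_iff_le_add, le_div_iff₀ (hden x)]
        nlinarith [hε]
      have h3 : v x * φ x ≤ u x * φ x + ‖u x - v x‖ := by
        have : (v x - u x) * φ x ≤ ‖u x - v x‖ := by
          refine (le_abs_self _).trans ?_
          rw [abs_mul, abs_sub_comm, Real.norm_eq_abs]
          exact mul_le_of_le_one_right (abs_nonneg _) (hφ1 x)
        linarith
      linarith
    have hi2 : Integrable fun x => 2 * ‖u x - v x‖ := (hu.sub hvi).norm.const_mul 2
    calc ∫ x, |u x| ≤ ∫ x, (u x * φ x + 2 * ‖u x - v x‖ + ε) :=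
          integral_mono hu.abs ((hi.add hi2).add (integrable_const ε)) hle
      _ = (∫ x, u x * φ x) + 2 * (∫ x, ‖u x - v x‖) + ε := by
          rw [integral_add (f := fun x => u x * φ x + 2 * ‖u x - v x‖) (hi.add hi2)
            (integrable_const ε), integral_add hi hi2, integral_const_mul]
          simp
      _ ≤ K + 3 * ε := by
          have := h φ hφc hφ1
          linarith
  refine le_of_forall_pos_le_add fun ε hε => ?_
  have := key (ε / 3) (by positivity)
  linarith

/-! ### Calculus of test pairs -/

theorem TestPair.const_mul {Φ φ : UnitAddCircle → ℝ} (h : TestPair Φ φ) (c : ℝ) :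
    TestPair (fun x => c * Φ x) fun x => c * φ x where
  cont := h.cont.const_mul c
  meas := h.meas.const_mul c
  bdd := by
    obtain ⟨C, hC⟩ := h.bdd
    exact ⟨|c| * C, fun x => by rw [abs_mul]; exact mul_le_mul_of_nonneg_left (hC x) (abs_nonneg _)⟩
  hasDeriv := by
    obtain ⟨S, hS, hd⟩ := h.hasDeriv
    exact ⟨S, hS, fun x hx => (hd x hx).const_mul c⟩

theorem TestPair.shift_sub_eq {Φ φ : UnitAddCircle → ℝ} (h : TestPair Φ φ) (x : UnitAddCircle)
    (t : ℝ) : ∫ s in (0 : ℝ)..t, φ (x + s) = Φ (x + t) - Φ x := by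
  obtain ⟨S, hS, hd⟩ := h.hasDeriv
  obtain ⟨C, hC⟩ := h.bdd
  have hc : Measurable fun s : ℝ => x + (s : UnitAddCircle) :=
    (continuous_const.add (AddCircle.continuous_mk' (1 : ℝ))).measurable
  have := integral_eq_of_hasDerivAt_off_countable (a := 0) (b := t)
    (fun s : ℝ => Φ (x + s)) (fun s : ℝ => φ (x + s))
    (s := {s : ℝ | (s : UnitAddCircle) ∈ (fun y => x + y) ⁻¹' S})
    (countable_coe_preimage (hS.preimage (add_right_injective x))) ?_ ?_ ?_
  · simpa using this
  · exact (h.cont.comp (continuous_const.add (AddCircle.continuous_mk' (1 : ℝ)))).continuousOn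
  · intro s hs
    have h1 := hd (x + s) hs.2
    have h2 : HasDerivAt (fun r : ℝ => Φ (x + s + ((r - s : ℝ) : UnitAddCircle))) (φ (x + s)) s := by
      have := HasDerivAt.comp_sub_const (f := fun t : ℝ => Φ (x + s + t)) s s (by simpa using h1)
      simpa using this
    refine h2.congr_of_eventuallyEq (Eventually.of_forall fun r => ?_)
    simp only [AddCircle.coe_sub]
    congr 1; abel
  · refine (intervalIntegrable_const (c := C)).mono_fun'
      (h.meas.comp hc).aestronglyMeasurable (Eventually.of_forall fun s => hC _)

theorem TestPair.abs_shift_sub_le {Φ φ : UnitAddCircle → ℝ} (h : TestPair Φ φ) {C : ℝ}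
    (hC : ∀ x, |φ x| ≤ C) (x : UnitAddCircle) (t : ℝ) : |Φ (x + t) - Φ x| ≤ C * |t| := by
  rw [← h.shift_sub_eq]
  have := intervalIntegral.norm_integral_le_of_norm_le_const (a := 0) (b := t) (C := C)
    (f := fun s : ℝ => φ (x + s)) fun s _ => hC _
  simpa using this

theorem continuous_real_add {φ : UnitAddCircle → ℝ} (hφ : Continuous φ) (x : UnitAddCircle) :
    Continuous fun s : ℝ => φ (x + s) :=
  hφ.comp (continuous_const.add (AddCircle.continuous_mk' (1 : ℝ)))

theorem testPair_shift_integral {φ : UnitAddCircle → ℝ} (hφ : Continuous φ) (t : ℝ) :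
    TestPair (fun x => ∫ s in (0 : ℝ)..t, φ (x + s)) fun x => φ (x + t) - φ x := by
  have hφt : Continuous fun x : UnitAddCircle => φ (x + t) := hφ.comp (continuous_id.add continuous_const)
  have hsub := hφt.sub hφ
  refine ⟨?_, hsub.measurable, exists_abs_le_of_continuous hsub, ∅, countable_empty, fun x _ => ?_⟩
  · apply intervalIntegral.continuous_parametric_intervalIntegral_of_continuous'
    exact hφ.comp (continuous_fst.add ((AddCircle.continuous_mk' (1 : ℝ)).comp continuous_snd))
  · have hc := continuous_real_add hφ x
    have h1 : ∀ r : ℝ, ∫ s in (0 : ℝ)..t, φ (x + r + s) =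
        (∫ s in (0 : ℝ)..(t + r), φ (x + s)) - ∫ s in (0 : ℝ)..r, φ (x + s) := by
      intro r
      have : ∀ s : ℝ, φ (x + r + s) = (fun s : ℝ => φ (x + s)) (s + r) := fun s => by
        simp only [AddCircle.coe_add]; congr 1; abel
      simp_rw [this]
      rw [intervalIntegral.integral_comp_add_right (fun s : ℝ => φ (x + s)) r, zero_add, eq_sub_iff_add_eq,
        add_comm]
      exact intervalIntegral.integral_add_adjacent_intervals (hc.intervalIntegrable _ _)
        (hc.intervalIntegrable _ _)
    simp_rw [h1]
    have h2 : ∀ r : ℝ, HasDerivAt (fun u : ℝ => ∫ s in (0 : ℝ)..u, φ (x + s)) (φ (x + r)) r := fun r =>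
      hc.integral_hasStrictDerivAt 0 r |>.hasDerivAt
    have h3 := (HasDerivAt.comp_const_add t 0 (by simpa using h2 t)).fun_sub (h2 0)
    simpa using h3

/-! ### Functions of bounded variation -/

section VarLE

variable {W f g : UnitAddCircle → ℝ} {K K' : ℝ}

theorem VarLE.congr_ae (h : VarLE W f K) (hfg : f =ᵐ[volume] g) : VarLE W g K := by
  intro Φ φ hp hW
  rw [← integral_congr_ae (hfg.mono fun x hx => show f x * φ x = g x * φ x by rw [hx])]
  exact h Φ φ hp hW

theorem VarLE.mono (h : VarLE W f K) (hK : K ≤ K') : VarLE W f K' :=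
  fun Φ φ hp hW => (h Φ φ hp hW).trans hK

theorem TestPair.integrable_mul {Φ φ : UnitAddCircle → ℝ} (h : TestPair Φ φ) (hf : Integrable f) :
    Integrable fun x => f x * φ x := by
  obtain ⟨C, hC⟩ := h.bdd
  exact integrable_mul_of_abs_le hf h.meas hC

theorem VarLE.add (hf : VarLE W f K) (hg : VarLE W g K') (hfi : Integrable f) (hgi : Integrable g) :
    VarLE W (fun x => f x + g x) (K + K') := by
  intro Φ φ hp hW
  simp_rw [add_mul]
  rw [integral_add (hp.integrable_mul hfi) (hp.integrable_mul hgi)]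
  exact add_le_add (hf Φ φ hp hW) (hg Φ φ hp hW)

theorem VarLE.const_mul (hf : VarLE W f K) (c : ℝ) : VarLE W (fun x => c * f x) (|c| * K) := by
  intro Φ φ hp hW
  rcases abs_choice c with h | h
  · rw [h]
    simp_rw [mul_assoc]
    rw [integral_const_mul]
    exact mul_le_mul_of_nonneg_left (hf Φ φ hp hW) (h ▸ abs_nonneg c)
  · have h1 := hf _ _ (hp.const_mul (-1)) fun x => by simpa using hW x
    have h2 : ∫ x, c * f x * φ x = |c| * ∫ x, f x * (-1 * φ x) := by
      rw [h, ← integral_const_mul]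
      congr 1; ext x; ring
    rw [h2]
    exact mul_le_mul_of_nonneg_left h1 (abs_nonneg c)

theorem VarLE.scale {Φ φ : UnitAddCircle → ℝ} (h : VarLE W f K) (hp : TestPair Φ φ) {r : ℝ}
    (hr : 0 < r) (hΦ : ∀ x, |Φ x| ≤ r * W x) : ∫ x, f x * φ x ≤ r * K := by
  have h1 := h _ _ (hp.const_mul r⁻¹) fun x => by
    rw [abs_mul, abs_of_pos (inv_pos.2 hr), inv_mul_le_iff₀ hr]; exact hΦ x
  have h2 : ∫ x, f x * φ x = r * ∫ x, f x * (r⁻¹ * φ x) := by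
    rw [← integral_const_mul]
    congr 1; ext x; field_simp
  rw [h2]
  exact mul_le_mul_of_nonneg_left h1 hr.le

theorem VarLE.integral_shift_sub_le (h : VarLE W f K) (hW : ∀ x, 1 ≤ W x) {φ : UnitAddCircle → ℝ}
    (hφ : Continuous φ) (hφ1 : ∀ x, |φ x| ≤ 1) (t : ℝ) :
    ∫ x, f x * (φ (x + t) - φ x) ≤ |t| * K := by
  rcases eq_or_ne t 0 with rfl | ht
  · simp
  · refine h.scale (testPair_shift_integral hφ t) (abs_pos.2 ht) fun x => ?_
    have := intervalIntegral.norm_integral_le_of_norm_le_const (a := 0) (b := t) (C := 1)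
      (f := fun s : ℝ => φ (x + s)) fun s _ => hφ1 _
    have h2 : |t| * 1 ≤ |t| * W x := mul_le_mul_of_nonneg_left (hW x) (abs_nonneg t)
    rw [Real.norm_eq_abs, sub_zero, one_mul] at this
    linarith

theorem varLE_of_lipschitz {M : ℝ} (hWM : ∀ x, W x ≤ M) {k : NNReal} (hf : LipschitzWith k f) :
    VarLE W f (k * M) := by
  intro Φ φ hp hW
  obtain ⟨C, hC⟩ := hp.bdd
  obtain ⟨S, hS, hd⟩ := hp.hasDeriv
  have hfc := hf.continuous
  obtain ⟨A, hA⟩ := exists_abs_le_of_continuous hfc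
  set t : ℕ → ℝ := fun m => 1 / ((m : ℝ) + 1) with ht
  have htpos : ∀ m, 0 < t m := fun m => Nat.one_div_pos_of_nat
  have ht0 : Tendsto t atTop (𝓝[≠] 0) :=
    tendsto_nhdsWithin_iff.2 ⟨tendsto_one_div_add_atTop_nhds_zero_nat,
      Eventually.of_forall fun m => (htpos m).ne'⟩
  have hΦt : ∀ m, Continuous fun x : UnitAddCircle => Φ (x + t m) := fun m =>
    hp.cont.comp (continuous_id.add continuous_const)
  have hlim : Tendsto (fun m => ∫ x, f x * ((t m)⁻¹ * (Φ (x + t m) - Φ x))) atTop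
      (𝓝 (∫ x, f x * φ x)) := by
    refine tendsto_integral_of_dominated_convergence (fun _ => A * C) (fun m => ?_)
      (integrable_const _) (fun m => Eventually.of_forall fun x => ?_) ?_
    · exact (hfc.mul (((hΦt m).sub hp.cont).const_mul _)).aestronglyMeasurable
    · rw [Real.norm_eq_abs, abs_mul]
      refine mul_le_mul (hA x) ?_ (abs_nonneg _) ((abs_nonneg _).trans (hA x))
      rw [abs_mul, abs_of_pos (inv_pos.2 (htpos m)), inv_mul_le_iff₀ (htpos m), mul_comm]
      simpa [abs_of_pos (htpos m)] using hp.abs_shift_sub_le hC x (t m)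
    · have : ∀ᵐ x : UnitAddCircle, x ∉ S := by
        simpa [ae_iff] using volume_countable_eq_zero hS
      filter_upwards [this] with x hx
      have h1 := (hd x hx).tendsto_slope_zero
      refine Tendsto.const_mul _ ?_
      have h2 := h1.comp ht0
      simpa [Function.comp_def] using h2
  refine le_of_tendsto' hlim fun m => ?_
  have hi1 : Integrable fun x : UnitAddCircle => f x * Φ (x + t m) :=
    (hfc.mul (hΦt m)).integrable_of_hasCompactSupport (HasCompactSupport.of_compactSpace _)
  have hi2 : Integrable fun x : UnitAddCircle => f x * Φ x :=
    (hfc.mul hp.cont).integrable_of_hasCompactSupport (HasCompactSupport.of_compactSpace _)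
  have hi3 : Integrable fun x : UnitAddCircle => f (x - t m) * Φ x :=
    ((hfc.comp (continuous_id.sub continuous_const)).mul hp.cont).integrable_of_hasCompactSupport
      (HasCompactSupport.of_compactSpace _)
  have h1 : ∫ x : UnitAddCircle, f x * Φ (x + t m) = ∫ x : UnitAddCircle, f (x - t m) * Φ x := by
    rw [← integral_add_right_eq_self (fun x : UnitAddCircle => f (x - t m) * Φ x)
      ((t m : ℝ) : UnitAddCircle)]
    simp
  have h2 : ∫ x, f x * ((t m)⁻¹ * (Φ (x + t m) - Φ x)) =
      (t m)⁻¹ * ∫ x : UnitAddCircle, (f (x - t m) - f x) * Φ x := by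
    have : ∀ x : UnitAddCircle, f x * ((t m)⁻¹ * (Φ (x + t m) - Φ x)) =
        (t m)⁻¹ * (f x * Φ (x + t m) - f x * Φ x) := fun x => by ring
    simp_rw [this]
    rw [integral_const_mul, integral_sub hi1 hi2, h1, ← integral_sub hi3 hi2]
    simp_rw [sub_mul]
  rw [h2, inv_mul_le_iff₀ (htpos m)]
  have h3 : ∀ x : UnitAddCircle, (f (x - t m) - f x) * Φ x ≤ t m * (k * M) := by
    intro x
    refine (le_abs_self _).trans ?_
    rw [abs_mul]
    have h4 : |f (x - t m) - f x| ≤ k * t m := by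
      have h5 := hf.dist_le_mul (x - t m) x
      rw [Real.dist_eq, dist_eq_norm] at h5
      refine h5.trans (mul_le_mul_of_nonneg_left ?_ k.2)
      have h6 := norm_coe_le_abs (t m)
      rw [abs_of_pos (htpos m)] at h6
      simpa using h6
    calc |f (x - t m) - f x| * |Φ x| ≤ (k * t m) * M :=
          mul_le_mul h4 ((hW x).trans (hWM x)) (abs_nonneg _) (mul_nonneg k.2 (htpos m).le)
      _ = t m * (k * M) := by ring
  calc ∫ x : UnitAddCircle, (f (x - t m) - f x) * Φ x ≤ ∫ x : UnitAddCircle, t m * (k * M) := by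
        refine integral_mono ?_ (integrable_const _) h3
        simp_rw [sub_mul]
        exact hi3.sub hi2
    _ = t m * (k * M) := by simp

end VarLE

/-! ### Compactness -/

theorem intervalIntegrable_coe {u : UnitAddCircle → ℝ} (hu : Integrable u) {a b : ℝ} (ha : 0 ≤ a)
    (hab : a ≤ b) (hb : b ≤ 1) : IntervalIntegrable (fun x : ℝ => u x) volume a b := by
  have h := (UnitAddCircle.measurePreserving_mk 0).integrable_comp hu.aestronglyMeasurable |>.2 hu
  rw [intervalIntegrable_iff_integrableOn_Ioc_of_le hab]
  have h2 : IntegrableOn (fun x : ℝ => u x) (Ioc 0 (0 + 1)) := h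
  exact h2.mono_set (Ioc_subset_Ioc ha (by linarith))

theorem integral_eq_sum_cells {u : UnitAddCircle → ℝ} (hu : Integrable u) {n : ℕ} {d : ℕ → ℝ}
    (h0 : d 0 = 0) (hn : d n = 1) (hd : ∀ i < n, d i < d (i + 1)) :
    ∫ x, u x = ∑ j ∈ Finset.range n, ∫ x in d j..d (j + 1), u x := by
  rw [intervalIntegral.sum_integral_adjacent_intervals, h0, hn,
    ← UnitAddCircle.intervalIntegral_preimage 0 u, zero_add]
  intro k hk
  exact intervalIntegrable_coe hu (h0 ▸ partition_mono hd (Nat.zero_le _) hk.le) (hd k hk).le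
    (hn ▸ partition_mono hd hk le_rfl)

theorem integral_abs_le_cells {W u : UnitAddCircle → ℝ} {K : ℝ} (hu : Integrable u)
    (hv : VarLE W u K) (hW : ∀ x, 1 ≤ W x) {n : ℕ} (hnpos : 0 < n) :
    ∫ x, |u x| ≤ 2 / n * K +
      ∑ j ∈ Finset.range n, |∫ x in ((j : ℝ) / n)..(((j + 1 : ℕ) : ℝ) / n), u x| := by
  refine integral_abs_le_of_forall_continuous hu fun φ hφ hφ1 => ?_
  have hn0 : (0 : ℝ) < n := Nat.cast_pos.2 hnpos
  set d : ℕ → ℝ := fun j => (j : ℝ) / n with hd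
  have hd0 : d 0 = 0 := by simp [hd]
  have hdn : d n = 1 := by simp [hd, hn0.ne']
  have hdlen : ∀ j, d (j + 1) - d j = 1 / n := fun j => by
    simp only [hd]; push_cast; field_simp; ring
  have hdlt : ∀ j < n, d j < d (j + 1) := fun j _ => by
    have := hdlen j
    have : 0 < 1 / (n : ℝ) := by positivity
    linarith
  set m : ℕ → ℝ := fun j => n * ∫ x in d j..d (j + 1), φ x with hm
  have hφr : Continuous fun x : ℝ => φ x := hφ.comp (AddCircle.continuous_mk' (1 : ℝ))
  have hm1 : ∀ j, |m j| ≤ 1 := fun j => by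
    have h1 := intervalIntegral.norm_integral_le_of_norm_le_const (a := d j) (b := d (j + 1))
      (C := 1) (f := fun x : ℝ => φ x) fun s _ => hφ1 _
    rw [hdlen, Real.norm_eq_abs, abs_of_pos (by positivity : 0 < 1 / (n : ℝ)), one_mul] at h1
    rw [hm, abs_mul, abs_of_pos hn0]
    calc _ ≤ (n : ℝ) * (1 / n) := mul_le_mul_of_nonneg_left h1 hn0.le
      _ = 1 := by field_simp
  have hcj : ∀ j, Continuous fun s : ℝ => φ s - m j := fun j => hφr.sub continuous_const
  have hb2 : ∀ (j : ℕ) (x : ℝ), |φ x - m j| ≤ 2 := fun j x =>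
    (abs_sub _ _).trans (by linarith [hφ1 x, hm1 j])
  have hend : ∀ j, ∫ s in d j..d (j + 1), (φ s - m j) = 0 := by
    intro j
    rw [intervalIntegral.integral_sub (hφr.intervalIntegrable _ _) (by simp),
      intervalIntegral.integral_const, hdlen, hm, smul_eq_mul]
    field_simp
    ring
  obtain ⟨Φ, ψ, hp, hΦ, S, hS, hψ⟩ := exists_testPair_of_pieces hd0 hdn hdlt
    (fun j x => ∫ s in d j..x, (φ s - m j)) (fun j x => φ x - m j) (S := ∅) countable_empty (C := 2)
    (fun j _ => Continuous.continuousOn (continuous_iff_continuousAt.2 fun x =>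
      ((hcj j).integral_hasStrictDerivAt (d j) x).hasDerivAt.continuousAt))
    (fun j _ => by simp only [hend, intervalIntegral.integral_same])
    (by
      have h1 : n - 1 + 1 = n := by omega
      have h2 := hend (n - 1)
      rw [h1, hdn] at h2
      rw [h2]
      have : d 0 = 0 := hd0
      simp only [this, intervalIntegral.integral_same])
    (fun j _ x _ _ => ((hcj j).integral_hasStrictDerivAt (d j) x).hasDerivAt)
    (fun j _ x _ _ => hb2 j x)
  have hΦb : ∀ x, |Φ x| ≤ 2 / n := by
    intro x
    obtain ⟨y, hy, rfl⟩ := AddCircle.eq_coe_Ico x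
    obtain ⟨j, hj, hyj⟩ := exists_mem_Ico_of_partition (d := d) (n := n) (y := y)
      (by rw [hd0]; exact hy.1) (by rw [hdn]; exact hy.2)
    rw [hΦ j hj y ⟨hyj.1, hyj.2.le⟩]
    have h1 := intervalIntegral.norm_integral_le_of_norm_le_const (a := d j) (b := y)
      (C := 2) (f := fun s : ℝ => φ s - m j) fun s _ => hb2 j s
    refine h1.trans ?_
    rw [abs_of_nonneg (by linarith [hyj.1])]
    have := hdlen j
    calc 2 * (y - d j) ≤ 2 * (1 / n) := by linarith [hyj.2]
      _ = 2 / n := by ring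
  have h1 : ∫ x, u x * ψ x ≤ 2 / n * K := hv.scale hp (by positivity) fun x => by
    refine (hΦb x).trans ?_
    have : 0 < 2 / (n : ℝ) := by positivity
    nlinarith [hW x]
  have hi1 : Integrable fun x => u x * ψ x := hp.integrable_mul hu
  have hi2 : Integrable fun x => u x * φ x := integrable_mul_of_abs_le hu hφ.measurable hφ1
  have h2 : ∫ x, (u x * φ x - u x * ψ x) =
      ∑ j ∈ Finset.range n, m j * ∫ x in d j..d (j + 1), u x := by
    rw [integral_eq_sum_cells (u := fun x => u x * φ x - u x * ψ x) (hi2.sub hi1) hd0 hdn hdlt]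
    refine Finset.sum_congr rfl fun j hj => ?_
    have hj := Finset.mem_range.1 hj
    rw [← intervalIntegral.integral_const_mul]
    refine intervalIntegral.integral_congr_ae ?_
    have h3 : ∀ᵐ x : ℝ, x ∉ {x : ℝ | (x : UnitAddCircle) ∈ S} ∪ {d (j + 1)} :=
      ((countable_coe_preimage hS).union (countable_singleton (d (j + 1)))).ae_notMem volume
    filter_upwards [h3] with x hx hxj
    rw [uIoc_of_le (hdlt j hj).le] at hxj
    rw [mem_union, not_or] at hx
    have := hψ j hj x ⟨hxj.1, lt_of_le_of_ne hxj.2 hx.2⟩ hx.1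
    simp only [this]
    ring
  rw [integral_sub hi2 hi1] at h2
  have h3 : ∑ j ∈ Finset.range n, m j * ∫ x in d j..d (j + 1), u x ≤
      ∑ j ∈ Finset.range n, |∫ x in d j..d (j + 1), u x| := by
    refine Finset.sum_le_sum fun j _ => (le_abs_self _).trans ?_
    rw [abs_mul]
    exact mul_le_of_le_one_left (abs_nonneg _) (hm1 j)
  linarith

theorem L1_norm_eq (f : UnitAddCircle →₁[volume] ℝ) : ‖f‖ = ∫ x, |f x| :=
  L1.norm_eq_integral_norm f

theorem exists_tendsto_of_varLE {W : UnitAddCircle → ℝ} (hW : ∀ x, 1 ≤ W x) {K A : ℝ}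
    (f : ℕ → UnitAddCircle →₁[volume] ℝ) (hK : ∀ m, VarLE W (f m) K) (hA : ∀ m, ‖f m‖ ≤ A)
    (U : Ultrafilter ℕ) : ∃ u : UnitAddCircle →₁[volume] ℝ, Tendsto f U (𝓝 u) := by
  have hint : ∀ m, Integrable (f m) := fun m => L1.integrable_coeFn _
  have hcell : ∀ n j : ℕ, ∃ c : ℝ, 0 < n → j < n →
      Tendsto (fun m => ∫ x in ((j : ℝ) / n)..(((j + 1 : ℕ) : ℝ) / n), f m x) U (𝓝 c) := by
    intro n j
    by_cases hn : 0 < n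
    · by_cases hj : j < n
      · have hn0 : (0 : ℝ) < n := Nat.cast_pos.2 hn
        have h1 : ∀ m, (∫ x in ((j : ℝ) / n)..(((j + 1 : ℕ) : ℝ) / n), f m x) ∈ Icc (-A) A := by
          intro m
          have hle : (j : ℝ) / n ≤ ((j + 1 : ℕ) : ℝ) / n := by gcongr; simp
          rw [mem_Icc, ← abs_le]
          refine (intervalIntegral.abs_integral_le_integral_abs hle).trans (le_trans ?_ (hA m))
          rw [L1_norm_eq, ← UnitAddCircle.intervalIntegral_preimage 0, zero_add]
          refine intervalIntegral.integral_mono_interval (by positivity) hle ?_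
            (Eventually.of_forall fun x => abs_nonneg _)
            (intervalIntegrable_coe (hint m).abs le_rfl zero_le_one le_rfl)
          rw [div_le_one hn0]
          exact_mod_cast hj
        obtain ⟨c, -, hc⟩ := isCompact_Icc.ultrafilter_le_nhds
          (U.map fun m => ∫ x in ((j : ℝ) / n)..(((j + 1 : ℕ) : ℝ) / n), f m x)
          (by
            rw [Filter.le_principal_iff]
            exact Filter.mem_map.2 (Filter.Eventually.of_forall h1))
        exact ⟨c, fun _ _ => hc⟩
      · exact ⟨0, fun _ h => absurd h hj⟩
    · exact ⟨0, fun h => absurd h hn⟩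
  choose c hc using hcell
  have hcauchy : Cauchy (Filter.map f U) := by
    rw [Metric.cauchy_iff]
    refine ⟨inferInstance, fun ε hε => ?_⟩
    obtain ⟨n, hn⟩ := exists_nat_gt (2 * (K + K) / (ε / 2) + 1)
    have hKK : 0 ≤ K := by
      have := hK 0 (fun _ => 0) (fun _ => 0) ⟨continuous_const, measurable_const, ⟨0, by simp⟩,
        ∅, countable_empty, fun x _ => hasDerivAt_const _ _⟩ fun x => by
          rw [abs_zero]; linarith [hW x]
      simpa using this
    have hn0 : (0 : ℝ) < n := lt_of_le_of_lt (by positivity) hn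
    have hnpos : 0 < n := Nat.cast_pos.1 hn0
    have hev : ∀ᶠ m in (U : Filter ℕ), ∀ j ∈ Finset.range n,
        |(∫ x in ((j : ℝ) / n)..(((j + 1 : ℕ) : ℝ) / n), f m x) - c n j| < ε / (4 * n) := by
      rw [Filter.eventually_all_finset]
      intro j hj
      have := (hc n j hnpos (Finset.mem_range.1 hj)).eventually
        (Metric.ball_mem_nhds _ (by positivity : 0 < ε / (4 * n)))
      exact this
    refine ⟨_, Filter.image_mem_map hev, ?_⟩
    rintro _ ⟨m, hm, rfl⟩ _ ⟨m', hm', rfl⟩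
    rw [dist_eq_norm, L1_norm_eq]
    have hae : (fun x => f m x + -1 * f m' x) =ᵐ[volume] ⇑(f m - f m') := by
      filter_upwards [Lp.coeFn_sub (f m) (f m')] with x hx
      rw [hx, Pi.sub_apply]; ring
    have hv := ((hK m).add ((hK m').const_mul (-1)) (hint m) ((hint m').const_mul _)).congr_ae hae
    have h1 := integral_abs_le_cells (L1.integrable_coeFn _) hv hW hnpos
    refine h1.trans_lt ?_
    have h2 : 2 / (n : ℝ) * (K + |(-1 : ℝ)| * K) < ε / 2 := by
      rw [abs_neg, abs_one, one_mul, div_mul_eq_mul_div, div_lt_iff₀ hn0]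
      have : 2 * (K + K) / (ε / 2) < n := by linarith
      rw [div_lt_iff₀ (by positivity)] at this
      linarith
    have h3 : ∑ j ∈ Finset.range n,
        |∫ x in ((j : ℝ) / n)..(((j + 1 : ℕ) : ℝ) / n), (f m - f m' : UnitAddCircle →₁[volume] ℝ) x| ≤
        ∑ j ∈ Finset.range n, ε / (2 * n) := by
      refine Finset.sum_le_sum fun j hj => ?_
      have hjn := Finset.mem_range.1 hj
      have hle : (j : ℝ) / n ≤ ((j + 1 : ℕ) : ℝ) / n := by gcongr; simp
      have hle1 : ((j + 1 : ℕ) : ℝ) / n ≤ 1 := by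
        rw [div_le_one hn0]; exact_mod_cast hjn
      have hj0 : (0 : ℝ) ≤ (j : ℝ) / n := by positivity
      have h4 : ∫ x in ((j : ℝ) / n)..(((j + 1 : ℕ) : ℝ) / n),
          (f m - f m' : UnitAddCircle →₁[volume] ℝ) x =
          (∫ x in ((j : ℝ) / n)..(((j + 1 : ℕ) : ℝ) / n), f m x) -
            ∫ x in ((j : ℝ) / n)..(((j + 1 : ℕ) : ℝ) / n), f m' x := by
        rw [← intervalIntegral.integral_sub (intervalIntegrable_coe (hint m) hj0 hle hle1)
          (intervalIntegrable_coe (hint m') hj0 hle hle1)]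
        refine intervalIntegral.integral_congr_ae_restrict ?_
        have h5 := (UnitAddCircle.measurePreserving_mk 0).quasiMeasurePreserving.ae
          (Lp.coeFn_sub (f m) (f m'))
        rw [uIoc_of_le hle]
        exact ae_restrict_of_ae_restrict_of_subset (Ioc_subset_Ioc hj0 (by linarith)) h5
      rw [h4]
      have h5 := hm j hj
      have h6 := hm' j hj
      have h7 : ε / (2 * n) = ε / (4 * n) + ε / (4 * n) := by field_simp; norm_num
      rw [h7]
      rw [abs_lt] at h5 h6
      rw [abs_le]
      constructor <;> linarith [h5.1, h5.2, h6.1, h6.2]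
    rw [Finset.sum_const, Finset.card_range, nsmul_eq_mul] at h3
    have h8 : (n : ℝ) * (ε / (2 * n)) = ε / 2 := by field_simp
    linarith
  exact CompleteSpace.complete hcauchy

/-! ### Derivatives of circle maps -/

/-- `T` has derivative `D` at `x`, in the coordinate of the universal cover. -/
def HasCircleDerivAt (T : UnitAddCircle → UnitAddCircle) (x : UnitAddCircle) (D : ℝ) : Prop :=
  ∃ (t : ℝ) (g : ℝ → ℝ), (t : UnitAddCircle) = x ∧ HasDerivAt g D t ∧
    ∀ᶠ s : ℝ in 𝓝 t, T (s : UnitAddCircle) = ((g s : ℝ) : UnitAddCircle)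

theorem circleDifferentiableAt_iff {T : UnitAddCircle → UnitAddCircle} {x : UnitAddCircle} :
    CircleDifferentiableAt T x ↔ ∃ D, HasCircleDerivAt T x D := by
  constructor
  · rintro ⟨t, g, ht, hg, h⟩
    exact ⟨_, t, g, ht, hg.hasDerivAt, h⟩
  · rintro ⟨D, t, g, ht, hg, h⟩
    exact ⟨t, g, ht, hg.differentiableAt, h⟩

theorem HasCircleDerivAt.rep {T : UnitAddCircle → UnitAddCircle} {x : UnitAddCircle} {D : ℝ}
    (h : HasCircleDerivAt T x D) {z : ℝ} (hz : (z : UnitAddCircle) = x) :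
    ∃ g : ℝ → ℝ, HasDerivAt g D z ∧
      ∀ᶠ s : ℝ in 𝓝 z, T (s : UnitAddCircle) = ((g s : ℝ) : UnitAddCircle) := by
  obtain ⟨t, g, ht, hg, h⟩ := h
  obtain ⟨m, rfl⟩ := coe_eq_coe_iff.1 (ht.trans hz.symm)
  refine ⟨fun s => g (s - m), ?_, ?_⟩
  · exact HasDerivAt.comp_sub_const _ _ (by simpa using hg)
  · have : Tendsto (fun s : ℝ => s - m) (𝓝 (t + m)) (𝓝 t) := by
      have : ContinuousAt (fun s : ℝ => s - m) (t + m) := by fun_prop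
      simpa [ContinuousAt] using this
    filter_upwards [this.eventually h] with s hs
    rw [← hs]
    congr 1
    rw [coe_eq_coe_iff]
    exact ⟨-m, by push_cast; ring⟩

theorem HasCircleDerivAt.continuousAt {T : UnitAddCircle → UnitAddCircle} {x : UnitAddCircle}
    {D : ℝ} (h : HasCircleDerivAt T x D) : ContinuousAt T x := by
  obtain ⟨t, rfl⟩ := QuotientAddGroup.mk_surjective x
  obtain ⟨g, hg, h⟩ := h.rep rfl
  have ho : IsOpenMap ((↑) : ℝ → UnitAddCircle) := QuotientAddGroup.isOpenMap_coe
  have h1 : ContinuousAt (fun s : ℝ => T s) t := by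
    have : ContinuousAt (fun s : ℝ => ((g s : ℝ) : UnitAddCircle)) t :=
      (AddCircle.continuous_mk' (1 : ℝ)).continuousAt.comp hg.continuousAt
    exact this.congr (h.mono fun s hs => hs.symm)
  have h2 : 𝓝 (t : UnitAddCircle) ≤ map ((↑) : ℝ → UnitAddCircle) (𝓝 t) :=
    ho.nhds_le t
  have h3 : Tendsto T (map ((↑) : ℝ → UnitAddCircle) (𝓝 t)) (𝓝 (T t)) := h1
  exact h3.mono_left h2

theorem HasCircleDerivAt.comp {S T : UnitAddCircle → UnitAddCircle} {x : UnitAddCircle}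
    {D E : ℝ} (hT : HasCircleDerivAt T x D) (hS : HasCircleDerivAt S (T x) E) :
    HasCircleDerivAt (S ∘ T) x (E * D) := by
  obtain ⟨t, g, rfl, hg, h⟩ := hT
  have h0 : T t = ((g t : ℝ) : UnitAddCircle) := h.self_of_nhds
  obtain ⟨f, hf, h'⟩ := hS.rep h0.symm
  refine ⟨t, f ∘ g, rfl, hf.comp t hg, ?_⟩
  filter_upwards [h, hg.continuousAt.eventually h'] with s hs hs'
  simp only [Function.comp_apply, hs, hs']

theorem HasCircleDerivAt.iterate {T : UnitAddCircle → UnitAddCircle} {x : UnitAddCircle}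
    {D : ℕ → ℝ} {k : ℕ} (h : ∀ i < k, HasCircleDerivAt T (T^[i] x) (D i)) :
    HasCircleDerivAt T^[k] x (∏ i ∈ Finset.range k, D i) := by
  induction k with
  | zero =>
    obtain ⟨t, rfl⟩ := QuotientAddGroup.mk_surjective x
    exact ⟨t, id, rfl, by simpa using hasDerivAt_id t, Eventually.of_forall fun s => rfl⟩
  | succ k ih =>
    have h1 := ih fun i hi => h i (by omega)
    have h2 := h1.comp (h k (by omega))
    rw [Finset.prod_range_succ, mul_comm, Function.iterate_succ']
    exact h2

theorem HasCircleDerivAt.eq_of_branch {T : UnitAddCircle → UnitAddCircle} {x : UnitAddCircle}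
    {D D' p q z : ℝ} {G : ℝ → ℝ} (h : HasCircleDerivAt T x D) (hpq : p < q)
    (hG : HasDerivWithinAt G D' (Icc p q) z) (hz : z ∈ Icc p q) (hzx : (z : UnitAddCircle) = x)
    (hT : ∀ s ∈ Ioo p q, T (s : UnitAddCircle) = ((G s : ℝ) : UnitAddCircle)) :
    T x = ((G z : ℝ) : UnitAddCircle) ∧ D = D' := by
  obtain ⟨g, hg, h⟩ := h.rep hzx
  have hcl : z ∈ closure (Ioo p q) := by rwa [closure_Ioo hpq.ne]
  have hne : (𝓝[Ioo p q] z).NeBot := mem_closure_iff_nhdsWithin_neBot.1 hcl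
  have hGo : HasDerivWithinAt G D' (Ioo p q) z := hG.mono Ioo_subset_Icc_self
  have hlim : Tendsto (fun s => g s - G s) (𝓝[Ioo p q] z) (𝓝 (g z - G z)) :=
    (hg.continuousAt.continuousWithinAt).sub hGo.continuousWithinAt
  have hint : ∀ᶠ s in 𝓝[Ioo p q] z, ∃ m : ℤ, g s - G s = m := by
    filter_upwards [h.filter_mono nhdsWithin_le_nhds, self_mem_nhdsWithin] with s hs hs'
    rw [hT s hs'] at hs
    obtain ⟨m, hm⟩ := coe_eq_coe_iff.1 hs
    exact ⟨m, by rw [hm]; ring⟩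
  have hnear : ∀ᶠ s in 𝓝[Ioo p q] z, |g s - G s - (g z - G z)| < 1 / 4 :=
    hlim.eventually (Metric.ball_mem_nhds _ (by norm_num))
  obtain ⟨s₀, ⟨m, hm⟩, hs₀⟩ := (hint.and hnear).exists
  have hconst : ∀ᶠ s in 𝓝[Ioo p q] z, g s - G s = m := by
    filter_upwards [hint, hnear] with s ⟨m', hm'⟩ hs
    rw [hm'] at hs ⊢
    rw [hm] at hs₀
    have : |((m' - m : ℤ) : ℝ)| < 1 := by
      push_cast
      rw [abs_lt] at *
      constructor <;> linarith [hs.1, hs.2, hs₀.1, hs₀.2]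
    have h2 : |m' - m| < 1 := by exact_mod_cast this
    have h3 := Int.abs_lt_one_iff.1 h2
    rw [sub_eq_zero.1 h3]
  have hzm : g z - G z = m :=
    tendsto_nhds_unique hlim (tendsto_const_nhds.congr' (hconst.mono fun s hs => hs.symm))
  constructor
  · have h1 := h.self_of_nhds
    rw [← hzx, h1, coe_eq_coe_iff]
    exact ⟨-m, by push_cast; linarith⟩
  · have hu : UniqueDiffWithinAt ℝ (Ioo p q) z :=
      uniqueDiffWithinAt_convex (convex_Ioo p q) (by rw [interior_Ioo]; exact nonempty_Ioo.2 hpq) hcl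
    have h1 : HasDerivWithinAt (fun s => G s + m) D (Ioo p q) z := by
      refine hg.hasDerivWithinAt.congr_of_eventuallyEq (hconst.mono fun s hs => ?_) ?_ <;> linarith
    have h2 : HasDerivWithinAt (fun s => G s + m) D' (Ioo p q) z := hGo.add_const _
    exact hu.eq_deriv _ h1 h2

theorem injOn_Ioo_of_hasDerivAt {G G' : ℝ → ℝ} {p q : ℝ}
    (h : ∀ x ∈ Ioo p q, HasDerivAt G (G' x) x) (h0 : ∀ x ∈ Ioo p q, G' x ≠ 0) :
    InjOn G (Ioo p q) := by
  have key : ∀ x ∈ Ioo p q, ∀ y ∈ Ioo p q, x < y → G x ≠ G y := by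
    intro x hx y hy hxy he
    have hsub : Icc x y ⊆ Ioo p q := fun z hz => ⟨hx.1.trans_le hz.1, hz.2.trans_lt hy.2⟩
    obtain ⟨c, hc, hc0⟩ := exists_hasDerivAt_eq_zero hxy
      (fun z hz => (h z (hsub hz)).continuousAt.continuousWithinAt) he
      (fun z hz => h z (hsub (Ioo_subset_Icc_self hz)))
    exact h0 c (hsub (Ioo_subset_Icc_self hc)) hc0
  intro x hx y hy he
  rcases lt_trichotomy x y with hl | hl | hl
  · exact absurd he (key x hx y hy hl)
  · exact hl
  · exact absurd he.symm (key y hy x hx hl)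

theorem countable_inter_of_injOn {G : ℝ → ℝ} {p q : ℝ} (h : InjOn G (Ioo p q)) {S : Set UnitAddCircle}
    (hS : S.Countable) (ω : UnitAddCircle) :
    {x : ℝ | x ∈ Ioo p q ∧ ((G x : ℝ) : UnitAddCircle) + ω ∈ S}.Countable := by
  have h1 := countable_coe_preimage (hS.preimage (add_left_injective ω))
  refine MapsTo.countable_of_injOn (f := G) (fun x hx => ?_) (h.mono fun x hx => hx.1) h1
  exact hx.2

/-! ### Branches of a piecewise expanding map -/

/-- Branches `g a` of `T` over the partition `d`, with derivatives `g' a` bounded away from zero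
by `c` and second derivatives `g'' a` bounded by `M`, such that `T^k` expands by the factor `Λ`. -/
structure ExpandingBranches (T : UnitAddCircle → UnitAddCircle) (n : ℕ) (d : ℕ → ℝ)
    (g g' g'' : ℕ → ℝ → ℝ) (c M Λ : ℝ) (k : ℕ) : Prop where
  d_zero : d 0 = 0
  d_last : d n = 1
  d_lt : ∀ i < n, d i < d (i + 1)
  map_eq : ∀ a < n, ∀ x ∈ Ioo (d a) (d (a + 1)), T (x : UnitAddCircle) = ((g a x : ℝ) : UnitAddCircle)
  hasDeriv : ∀ a < n, ∀ x ∈ Icc (d a) (d (a + 1)),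
    HasDerivWithinAt (g a) (g' a x) (Icc (d a) (d (a + 1))) x
  cont : ∀ a < n, ContinuousOn (g' a) (Icc (d a) (d (a + 1)))
  hasDeriv₂ : ∀ a < n, ∀ x ∈ Ioo (d a) (d (a + 1)), HasDerivAt (g' a) (g'' a x) x
  bdd₂ : ∀ a < n, ∀ x ∈ Ioo (d a) (d (a + 1)), |g'' a x| ≤ M
  c_pos : 0 < c
  lower : ∀ a < n, ∀ x ∈ Icc (d a) (d (a + 1)), c ≤ |g' a x|
  one_le : 1 ≤ M
  one_lt : 1 < Λ
  k_pos : 0 < k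
  expand : ∀ x (D : ℕ → ℝ), (∀ i < k, HasCircleDerivAt T (T^[i] x) (D i)) →
    Λ ≤ |∏ i ∈ Finset.range k, D i|

theorem exists_expandingBranches {T : UnitAddCircle → UnitAddCircle} (hT : IsPiecewiseExpanding T) :
    ∃ n d g g' g'' c M Λ k, ExpandingBranches T n d g g' g'' c M Λ k := by
  obtain ⟨⟨n, d, h0, hn, hlt, hg⟩, k, hk, Λ, hΛ, n₁, e, e0, en, elt, hG⟩ := hT
  choose! g hgC hgT hgΛ using hg
  choose! G hGC hGT hGΛ using hG
  set I : ℕ → Set ℝ := fun a => Icc (d a) (d (a + 1)) with hI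
  have hIu : ∀ a < n, UniqueDiffOn ℝ (I a) := fun a ha => uniqueDiffOn_Icc (hlt a ha)
  set g' : ℕ → ℝ → ℝ := fun a => derivWithin (g a) (I a) with hg'
  set g'' : ℕ → ℝ → ℝ := fun a => derivWithin (g' a) (I a) with hg''
  have hg'C : ∀ a < n, ContDiffOn ℝ 1 (g' a) (I a) := fun a ha =>
    (hgC a ha).derivWithin (hIu a ha) (by norm_num)
  have hg''C : ∀ a < n, ContinuousOn (g'' a) (I a) := fun a ha =>
    (hg'C a ha).continuousOn_derivWithin (hIu a ha) le_rfl
  have hd1 : ∀ a < n, ∀ x ∈ I a, HasDerivWithinAt (g a) (g' a x) (I a) x := fun a ha x hx =>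
    ((hgC a ha).differentiableOn (by norm_num) x hx).hasDerivWithinAt
  have hd2 : ∀ a < n, ∀ x ∈ Ioo (d a) (d (a + 1)), HasDerivAt (g' a) (g'' a x) x := fun a ha x hx =>
    ((hg'C a ha).differentiableOn (by norm_num) x (Ioo_subset_Icc_self hx)).hasDerivWithinAt.hasDerivAt
      (Icc_mem_nhds hx.1 hx.2)
  have hbound : ∃ M : ℝ, 1 ≤ M ∧ ∀ a < n, ∀ x ∈ I a, |g' a x| ≤ M ∧ |g'' a x| ≤ M := by
    have h1 : ∀ a, ∃ M : ℝ, a < n → ∀ x ∈ I a, |g' a x| ≤ M ∧ |g'' a x| ≤ M := by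
      intro a
      by_cases ha : a < n
      · obtain ⟨A, hA⟩ := isCompact_Icc.exists_bound_of_continuousOn (hg'C a ha).continuousOn
        obtain ⟨B, hB⟩ := isCompact_Icc.exists_bound_of_continuousOn (hg''C a ha)
        exact ⟨max A B, fun _ x hx => ⟨(hA x hx).trans (le_max_left _ _),
          (hB x hx).trans (le_max_right _ _)⟩⟩
      · exact ⟨0, fun h => absurd h ha⟩
    choose M hM using h1
    refine ⟨1 + ∑ a ∈ Finset.range n, |M a|, by
      have : 0 ≤ ∑ a ∈ Finset.range n, |M a| := Finset.sum_nonneg fun _ _ => abs_nonneg _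
      linarith, fun a ha x hx => ?_⟩
    have h2 : |M a| ≤ ∑ a ∈ Finset.range n, |M a| :=
      Finset.single_le_sum (f := fun a => |M a|) (fun _ _ => abs_nonneg _) (Finset.mem_range.2 ha)
    have h3 := hM a ha x hx
    have h4 := le_abs_self (M a)
    exact ⟨by linarith [h3.1], by linarith [h3.2]⟩
  obtain ⟨M, hM1, hM⟩ := hbound
  have hexp : ∀ x (D : ℕ → ℝ), (∀ i < k, HasCircleDerivAt T (T^[i] x) (D i)) →
      Λ ≤ |∏ i ∈ Finset.range k, D i| := by
    intro x D hD
    obtain ⟨z, hz, hzx⟩ := AddCircle.eq_coe_Ico x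
    obtain ⟨b, hb, hzb⟩ := exists_mem_Ico_of_partition (d := e) (n := n₁) (y := z)
      (by rw [e0]; exact hz.1) (by rw [en]; exact hz.2)
    have hzb' : z ∈ Icc (e b) (e (b + 1)) := ⟨hzb.1, hzb.2.le⟩
    have h1 := (HasCircleDerivAt.iterate hD).eq_of_branch (elt b hb)
      ((hGC b hb).differentiableOn (by norm_num) z hzb').hasDerivWithinAt hzb' hzx (hGT b hb)
    rw [h1.2]
    exact hGΛ b hb z hzb'
  have hfib : ∀ y, {x | T^[k] x = y}.Countable := by
    intro y
    have h1 : ∀ b < n₁, InjOn (G b) (Ioo (e b) (e (b + 1))) := fun b hb =>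
      injOn_Ioo_of_hasDerivAt (G' := derivWithin (G b) (Icc (e b) (e (b + 1)))) (fun x hx =>
        ((hGC b hb).differentiableOn (by norm_num) x
          (Ioo_subset_Icc_self hx)).hasDerivWithinAt.hasDerivAt (Icc_mem_nhds hx.1 hx.2))
        fun x hx hx0 => by
          have := hGΛ b hb x (Ioo_subset_Icc_self hx)
          rw [hx0, abs_zero] at this
          linarith
    have h2 : {x | T^[k] x = y} ⊆ ((↑) : ℝ → UnitAddCircle) '' (range e ∪ ⋃ b ∈ Iio n₁,
        {x : ℝ | x ∈ Ioo (e b) (e (b + 1)) ∧ ((G b x : ℝ) : UnitAddCircle) + 0 ∈ ({y} : Set UnitAddCircle)}) := by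
      intro x hx
      obtain ⟨z, hz, rfl⟩ := AddCircle.eq_coe_Ico x
      obtain ⟨b, hb, hzb⟩ := exists_mem_Ico_of_partition (d := e) (n := n₁) (y := z)
        (by rw [e0]; exact hz.1) (by rw [en]; exact hz.2)
      refine ⟨z, ?_, rfl⟩
      rcases eq_or_lt_of_le hzb.1 with h | h
      · exact Or.inl ⟨b, h⟩
      · refine Or.inr (mem_biUnion (x := b) hb ⟨⟨h, hzb.2⟩, ?_⟩)
        rw [add_zero, mem_singleton_iff, ← hGT b hb z ⟨h, hzb.2⟩]
        exact hx
    refine (((countable_range e).union (Countable.biUnion (to_countable _) fun b hb => ?_)).image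
      _).mono h2
    exact countable_inter_of_injOn (h1 b hb) (countable_singleton y) 0
  set E : Set UnitAddCircle := ((↑) : ℝ → UnitAddCircle) '' range d with hE
  have hEc : E.Countable := (countable_range d).image _
  have hbad : {x | ∃ i < k, T^[i] x ∈ E}.Countable := by
    have h1 : {x | ∃ i < k, T^[i] x ∈ E} ⊆ ⋃ i ∈ Iio k, ⋃ y ∈ E, {x | T^[k] x = T^[k - i] y} := by
      rintro x ⟨i, hi, hx⟩
      refine mem_biUnion (x := i) hi (mem_biUnion hx ?_)
      rw [mem_ofPred_eq, ← Function.iterate_add_apply]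
      congr 2
      omega
    exact (Countable.biUnion (to_countable _) fun i _ => hEc.biUnion fun y _ => hfib _).mono h1
  have hreg : ∀ x ∉ E, ∃ D, HasCircleDerivAt T x D ∧ |D| ≤ M := by
    intro x hx
    obtain ⟨z, hz, rfl⟩ := AddCircle.eq_coe_Ico x
    obtain ⟨b, hb, hzb⟩ := exists_mem_Ico_of_partition (d := d) (n := n) (y := z)
      (by rw [h0]; exact hz.1) (by rw [hn]; exact hz.2)
    have hzo : z ∈ Ioo (d b) (d (b + 1)) :=
      ⟨lt_of_le_of_ne hzb.1 fun h => hx ⟨z, ⟨b, h⟩, rfl⟩, hzb.2⟩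
    refine ⟨g' b z, ⟨z, g b, rfl, (hd1 b hb z (Ioo_subset_Icc_self hzo)).hasDerivAt
      (Icc_mem_nhds hzo.1 hzo.2), ?_⟩, (hM b hb z (Ioo_subset_Icc_self hzo)).1⟩
    filter_upwards [isOpen_Ioo.mem_nhds hzo] with s hs using hgT b hb s hs
  have hMpos : 0 < M := by linarith
  set c : ℝ := Λ / M ^ (k - 1) with hc
  have hcpos : 0 < c := by positivity
  have hlow : ∀ a < n, ∀ x ∈ Icc (d a) (d (a + 1)), c ≤ |g' a x| := by
    intro a ha
    have hgood : ∀ z ∈ Ioo (d a) (d (a + 1)), (z : UnitAddCircle) ∉ {x | ∃ i < k, T^[i] x ∈ E} →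
        c ≤ |g' a z| := by
      intro z hz hzb
      simp only [mem_ofPred_eq, not_exists, not_and] at hzb
      have h1 : ∀ i, ∃ D, i < k → HasCircleDerivAt T (T^[i] z) D ∧ |D| ≤ M := by
        intro i
        by_cases hi : i < k
        · obtain ⟨D, hD⟩ := hreg _ (hzb i hi)
          exact ⟨D, fun _ => hD⟩
        · exact ⟨0, fun h => absurd h hi⟩
      choose D hD using h1
      have h2 := hexp z D fun i hi => (hD i hi).1
      have h3 : D 0 = g' a z := ((hD 0 hk).1.eq_of_branch (hlt a ha)
        (hd1 a ha z (Ioo_subset_Icc_self hz)) (Ioo_subset_Icc_self hz) rfl (hgT a ha)).2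
      obtain ⟨l, rfl⟩ : ∃ l, k = l + 1 := ⟨k - 1, by omega⟩
      rw [Finset.prod_range_succ', h3, abs_mul, Finset.abs_prod] at h2
      have h4 : ∏ i ∈ Finset.range l, |D (i + 1)| ≤ M ^ l := by
        calc _ ≤ ∏ i ∈ Finset.range l, M := Finset.prod_le_prod (fun _ _ => abs_nonneg _)
              fun i hi => (hD (i + 1) (by have := Finset.mem_range.1 hi; omega)).2
          _ = M ^ l := by simp
      rw [hc, Nat.add_sub_cancel, div_le_iff₀ (by positivity), mul_comm]
      exact h2.trans (mul_le_mul_of_nonneg_right h4 (abs_nonneg _))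
    set B : Set ℝ := {z : ℝ | (z : UnitAddCircle) ∈ {x | ∃ i < k, T^[i] x ∈ E}} with hB
    have hBc : B.Countable := countable_coe_preimage hbad
    have hcl : IsClosed {x | x ∈ Icc (d a) (d (a + 1)) ∧ c ≤ |g' a x|} :=
      (hg'C a ha).continuousOn.abs.preimage_isClosed_of_isClosed isClosed_Icc isClosed_Ici
    have h1 : Ioo (d a) (d (a + 1)) ⊆ closure (Ioo (d a) (d (a + 1)) ∩ Bᶜ) :=
      (hBc.dense_compl ℝ).open_subset_closure_inter isOpen_Ioo
    have h2 : closure (Ioo (d a) (d (a + 1)) ∩ Bᶜ) ⊆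
        {x | x ∈ Icc (d a) (d (a + 1)) ∧ c ≤ |g' a x|} :=
      hcl.closure_subset_iff.2 fun z hz => ⟨Ioo_subset_Icc_self hz.1, hgood z hz.1 hz.2⟩
    have h3 := hcl.closure_subset_iff.2 (h1.trans h2)
    rw [closure_Ioo (hlt a ha).ne] at h3
    exact fun x hx => (h3 hx).2
  exact ⟨n, d, g, g', g'', c, M, Λ, k, h0, hn, hlt, hgT, hd1, fun a ha => (hg'C a ha).continuousOn,
    hd2, fun a ha x hx => (hM a ha x (Ioo_subset_Icc_self hx)).2, hcpos, hlow, hM1, hΛ, hk, hexp⟩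

section Branches

variable {T : UnitAddCircle → UnitAddCircle} {n k : ℕ} {d : ℕ → ℝ} {g g' g'' : ℕ → ℝ → ℝ}
  {c M Λ : ℝ}

theorem ExpandingBranches.exists_mem_Ico (h : ExpandingBranches T n d g g' g'' c M Λ k)
    (x : UnitAddCircle) : ∃ a < n, ∃ z ∈ Ico (d a) (d (a + 1)), (z : UnitAddCircle) = x := by
  obtain ⟨z, hz, hzx⟩ := AddCircle.eq_coe_Ico x
  obtain ⟨b, hb, hzb⟩ := exists_mem_Ico_of_partition (d := d) (n := n) (y := z)
    (by rw [h.d_zero]; exact hz.1) (by rw [h.d_last]; exact hz.2)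
  exact ⟨b, hb, z, hzb, hzx⟩

theorem ExpandingBranches.Icc_subset (h : ExpandingBranches T n d g g' g'' c M Λ k) {a : ℕ}
    (ha : a < n) : Icc (d a) (d (a + 1)) ⊆ Icc 0 1 := by
  rw [← h.d_zero, ← h.d_last]
  exact Icc_subset_Icc (partition_mono h.d_lt (Nat.zero_le _) ha.le)
    (partition_mono h.d_lt ha le_rfl)

theorem ExpandingBranches.hasDerivAt (h : ExpandingBranches T n d g g' g'' c M Λ k) {a : ℕ}
    (ha : a < n) {z : ℝ} (hz : z ∈ Ioo (d a) (d (a + 1))) : HasDerivAt (g a) (g' a z) z :=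
  (h.hasDeriv a ha z (Ioo_subset_Icc_self hz)).hasDerivAt (Icc_mem_nhds hz.1 hz.2)

theorem ExpandingBranches.hasCircleDerivAt (h : ExpandingBranches T n d g g' g'' c M Λ k) {a : ℕ}
    (ha : a < n) {z : ℝ} (hz : z ∈ Ioo (d a) (d (a + 1))) : HasCircleDerivAt T z (g' a z) := by
  refine ⟨z, g a, rfl, h.hasDerivAt ha hz, ?_⟩
  filter_upwards [isOpen_Ioo.mem_nhds hz] with s hs using h.map_eq a ha s hs

theorem ExpandingBranches.eq_of_hasCircleDerivAt (h : ExpandingBranches T n d g g' g'' c M Λ k)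
    {a : ℕ} (ha : a < n) {z D : ℝ} (hz : z ∈ Icc (d a) (d (a + 1))) (hD : HasCircleDerivAt T z D) :
    T z = ((g a z : ℝ) : UnitAddCircle) ∧ D = g' a z :=
  hD.eq_of_branch (h.d_lt a ha) (h.hasDeriv a ha z hz) hz rfl (h.map_eq a ha)

theorem ExpandingBranches.injOn (h : ExpandingBranches T n d g g' g'' c M Λ k) {a : ℕ}
    (ha : a < n) : InjOn (g a) (Ioo (d a) (d (a + 1))) :=
  injOn_Ioo_of_hasDerivAt (fun _ hx => h.hasDerivAt ha hx) fun x hx hx0 => by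
    have := h.lower a ha x (Ioo_subset_Icc_self hx)
    rw [hx0, abs_zero] at this
    linarith [h.c_pos]

theorem ExpandingBranches.mem_of_isTurningPoint (h : ExpandingBranches T n d g g' g'' c M Λ k)
    {x : UnitAddCircle} (hx : IsTurningPoint T x) : ∃ a < n, (d a : UnitAddCircle) = x := by
  obtain ⟨a, ha, z, hz, rfl⟩ := h.exists_mem_Ico x
  rcases eq_or_lt_of_le hz.1 with h1 | h1
  · exact ⟨a, ha, by rw [h1]⟩
  · exact absurd (circleDifferentiableAt_iff.2 ⟨_, h.hasCircleDerivAt ha ⟨h1, hz.2⟩⟩) hx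

theorem ExpandingBranches.finite_turning (h : ExpandingBranches T n d g g' g'' c M Λ k) :
    {x | IsTurningPoint T x}.Finite :=
  ((finite_Iio n).image fun a => (d a : UnitAddCircle)).subset fun _ hx =>
    h.mem_of_isTurningPoint hx

theorem ExpandingBranches.measurable (h : ExpandingBranches T n d g g' g'' c M Λ k) :
    Measurable T := by
  set E : Set UnitAddCircle := (fun a => (d a : UnitAddCircle)) '' Iio n with hE
  have hEf : E.Finite := (finite_Iio n).image _
  have hcont : ContinuousOn T Eᶜ := by
    intro x hx
    obtain ⟨a, ha, z, hz, rfl⟩ := h.exists_mem_Ico x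
    have hzo : z ∈ Ioo (d a) (d (a + 1)) :=
      ⟨lt_of_le_of_ne hz.1 fun he => hx ⟨a, ha, by simp only [he]⟩, hz.2⟩
    exact (h.hasCircleDerivAt ha hzo).continuousAt.continuousWithinAt
  classical
  have hm : Measurable (Eᶜ.piecewise T fun _ => 0) :=
    hcont.measurable_piecewise continuousOn_const hEf.measurableSet.compl
  refine hm.measurable_of_countable_ne (hEf.countable.mono fun x hx => ?_)
  by_contra hxE
  exact hx (piecewise_eq_of_mem _ _ _ hxE)

theorem volume_coe_preimage_inter_le {A : Set UnitAddCircle} (hA : MeasurableSet A) (N : ℕ) :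
    volume {x : ℝ | (x : UnitAddCircle) ∈ A ∧ x ∈ Ioc (-(N : ℝ)) N} ≤ (2 * N : ℕ) * volume A := by
  have h1 : {x : ℝ | (x : UnitAddCircle) ∈ A ∧ x ∈ Ioc (-(N : ℝ)) N} ⊆
      ⋃ i ∈ Finset.range (2 * N), {x : ℝ | (x : UnitAddCircle) ∈ A} ∩
        Ioc (-(N : ℝ) + i) (-(N : ℝ) + i + 1) := by
    rintro x ⟨hxA, hx⟩
    have hc : 0 < ⌈x + N⌉ := Int.ceil_pos.2 (by linarith [hx.1])
    obtain ⟨j, hj⟩ : ∃ j : ℕ, ⌈x + N⌉ = j + 1 := ⟨(⌈x + N⌉ - 1).toNat, by omega⟩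
    have h2 := Int.ceil_lt_add_one (x + N)
    have h3 := Int.le_ceil (x + N)
    rw [hj] at h2 h3
    push_cast at h2 h3
    refine mem_biUnion (x := j) ?_ ⟨hxA, by linarith, by linarith⟩
    have h4 : (j : ℝ) < 2 * N := by linarith [hx.2]
    exact Finset.mem_coe.2 (Finset.mem_range.2 (by exact_mod_cast h4))
  refine (measure_mono h1).trans ((measure_biUnion_finset_le _ _).trans ?_)
  have h2 : ∀ i : ℕ, volume ({x : ℝ | (x : UnitAddCircle) ∈ A} ∩
      Ioc (-(N : ℝ) + i) (-(N : ℝ) + i + 1)) = volume A := by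
    intro i
    have hp := UnitAddCircle.measurePreserving_mk (-(N : ℝ) + i)
    rw [← hp.measure_preimage hA.nullMeasurableSet, Measure.restrict_apply]
    · rfl
    · exact hp.measurable hA
  rw [Finset.sum_congr rfl fun i _ => h2 i]
  simp

theorem ExpandingBranches.volume_preimage_le (h : ExpandingBranches T n d g g' g'' c M Λ k) :
    ∃ C : NNReal, ∀ A, MeasurableSet A → volume (T ⁻¹' A) ≤ C * volume A := by
  have hN : ∃ N : ℕ, ∀ a < n, ∀ x ∈ Icc (d a) (d (a + 1)), |g a x| < N := by
    have h1 : ∀ a, ∃ B : ℝ, a < n → ∀ x ∈ Icc (d a) (d (a + 1)), |g a x| ≤ B := by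
      intro a
      by_cases ha : a < n
      · obtain ⟨B, hB⟩ := isCompact_Icc.exists_bound_of_continuousOn
          (fun x hx => (h.hasDeriv a ha x hx).continuousWithinAt)
        exact ⟨B, fun _ => hB⟩
      · exact ⟨0, fun h => absurd h ha⟩
    choose B hB using h1
    obtain ⟨N, hN⟩ := exists_nat_gt (∑ a ∈ Finset.range n, |B a|)
    refine ⟨N, fun a ha x hx => lt_of_le_of_lt ((hB a ha x hx).trans ((le_abs_self _).trans ?_)) hN⟩
    exact Finset.single_le_sum (f := fun a => |B a|) (fun _ _ => abs_nonneg _) (Finset.mem_range.2 ha)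
  obtain ⟨N, hN⟩ := hN
  set c' : NNReal := ⟨c, h.c_pos.le⟩ with hc'
  have hc'0 : c' ≠ 0 := fun h0 => h.c_pos.ne' (congrArg NNReal.toReal h0)
  refine ⟨n * (c'⁻¹ * (2 * N : ℕ)), fun A hA => ?_⟩
  have hp := UnitAddCircle.measurePreserving_mk 0
  have hTA : MeasurableSet (T ⁻¹' A) := h.measurable hA
  have hTA' : MeasurableSet {x : ℝ | T x ∈ A} := (AddCircle.measurable_mk' (a := (1 : ℝ))) hTA
  rw [← hp.measure_preimage hTA.nullMeasurableSet, Measure.restrict_apply (hp.measurable hTA)]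
  set s : ℕ → Set ℝ := fun a => Ioo (d a) (d (a + 1)) ∩ {x : ℝ | T x ∈ A} with hs
  have hcov : (QuotientAddGroup.mk : ℝ → UnitAddCircle) ⁻¹' (T ⁻¹' A) ∩ Ioc 0 (0 + 1) ⊆
      range d ∪ ⋃ a ∈ Finset.range n, s a := by
    rintro x ⟨hxA, hx⟩
    by_cases hxd : x ∈ range d
    · exact Or.inl hxd
    · right
      rw [zero_add] at hx
      have hx1 : x < d n := lt_of_le_of_ne (by rw [h.d_last]; exact hx.2) fun he => hxd ⟨n, he.symm⟩
      obtain ⟨b, hb, hzb⟩ := exists_mem_Ico_of_partition (d := d) (n := n) (y := x)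
        (by rw [h.d_zero]; exact hx.1.le) hx1
      exact mem_biUnion (x := b) (Finset.mem_coe.2 (Finset.mem_range.2 hb))
        ⟨⟨lt_of_le_of_ne hzb.1 fun he => hxd ⟨b, he⟩, hzb.2⟩, hxA⟩
  refine (measure_mono hcov).trans ((measure_union_le _ _).trans ?_)
  rw [(countable_range d).measure_zero, zero_add]
  refine (measure_biUnion_finset_le _ _).trans ?_
  have hsa : ∀ a ∈ Finset.range n, volume (s a) ≤ (c'⁻¹ * (2 * N : ℕ) : NNReal) * volume A := by
    intro a ha
    have ha := Finset.mem_range.1 ha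
    have hsm : MeasurableSet (s a) := measurableSet_Ioo.inter hTA'
    have h1 := lintegral_image_eq_lintegral_abs_deriv_mul hsm
      (fun x hx => (h.hasDerivAt ha hx.1).hasDerivWithinAt)
      ((h.injOn ha).mono inter_subset_left) 1
    simp only [Pi.one_apply, mul_one, lintegral_one, Measure.restrict_apply_univ] at h1
    have h2 : (c' : ENNReal) * volume (s a) ≤ volume (g a '' s a) := by
      rw [h1, ← setLIntegral_const]
      refine setLIntegral_mono' hsm fun x hx => ?_
      rw [← ENNReal.ofReal_coe_nnreal]
      exact ENNReal.ofReal_le_ofReal (h.lower a ha x (Ioo_subset_Icc_self hx.1))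
    have h3 : volume (g a '' s a) ≤ (2 * N : ℕ) * volume A := by
      refine (measure_mono ?_).trans (volume_coe_preimage_inter_le hA N)
      rintro _ ⟨x, hx, rfl⟩
      have h4 := abs_lt.1 (hN a ha x (Ioo_subset_Icc_self hx.1))
      refine ⟨?_, h4.1, h4.2.le⟩
      rw [← h.map_eq a ha x hx.1]
      exact hx.2
    have h5 : (c' : ENNReal)⁻¹ * (c' * volume (s a)) = volume (s a) := by
      rw [← mul_assoc, ENNReal.inv_mul_cancel (by simpa using hc'0) ENNReal.coe_ne_top, one_mul]
    rw [← h5, ENNReal.coe_mul, ENNReal.coe_inv hc'0, mul_assoc]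
    exact mul_le_mul_right (h2.trans h3) _
  refine (Finset.sum_le_sum hsa).trans ?_
  rw [Finset.sum_const, Finset.card_range, nsmul_eq_mul]
  push_cast
  simp only [mul_assoc, le_refl]

theorem isLimitValue_of_branch {T : UnitAddCircle → UnitAddCircle} {G : ℝ → ℝ} {p q z : ℝ}
    (hpq : p < q) (hz : z ∈ Icc p q) (hG : ContinuousWithinAt G (Icc p q) z)
    (hT : ∀ s ∈ Ioo p q, T (s : UnitAddCircle) = ((G s : ℝ) : UnitAddCircle)) :
    IsLimitValue T z (G z) := by
  set s : Set ℝ := Ioo p q ∩ {z}ᶜ with hs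
  have hcl : z ∈ closure s := by
    have h1 : Ioo p q ⊆ closure s :=
      ((countable_singleton z).dense_compl ℝ).open_subset_closure_inter isOpen_Ioo
    have h2 := isClosed_closure.closure_subset_iff.2 h1
    rw [closure_Ioo hpq.ne] at h2
    exact h2 hz
  have hne : (𝓝[s] z).NeBot := mem_closure_iff_nhdsWithin_neBot.1 hcl
  have hmap : Tendsto (fun t : ℝ => (t : UnitAddCircle)) (𝓝[s] z) (𝓝[≠] (z : UnitAddCircle)) := by
    refine tendsto_nhdsWithin_iff.2
      ⟨((AddCircle.continuous_mk' (1 : ℝ)).tendsto z).mono_left nhdsWithin_le_nhds, ?_⟩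
    have h1 : ∀ᶠ t in 𝓝[s] z, |t - z| < 1 :=
      nhdsWithin_le_nhds (Metric.ball_mem_nhds z one_pos)
    filter_upwards [h1, self_mem_nhdsWithin] with t ht hts he
    obtain ⟨m, hm⟩ := coe_eq_coe_iff.1 he
    have h2 : |(m : ℝ)| < 1 := by
      rw [← abs_neg]
      convert ht using 2
      rw [hm]; ring
    have h3 : m = 0 := Int.abs_lt_one_iff.1 (by exact_mod_cast h2)
    apply hts.2
    rw [mem_singleton_iff, hm, h3]
    simp
  refine MapClusterPt.of_comp hmap (Tendsto.mapClusterPt ?_)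
  have h1 : Tendsto (fun t : ℝ => ((G t : ℝ) : UnitAddCircle)) (𝓝[s] z) (𝓝 (G z)) := by
    have h2 := (hG.mono
      (inter_subset_left.trans Ioo_subset_Icc_self : s ⊆ _)).tendsto
    exact ((AddCircle.continuous_mk' (1 : ℝ)).tendsto (G z)).comp h2
  refine h1.congr' ?_
  filter_upwards [self_mem_nhdsWithin] with t ht using (hT t ht.1).symm

theorem ExpandingBranches.isLimitValue (h : ExpandingBranches T n d g g' g'' c M Λ k) {a : ℕ}
    (ha : a < n) {z : ℝ} (hz : z ∈ Icc (d a) (d (a + 1))) : IsLimitValue T z (g a z) :=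
  isLimitValue_of_branch (h.d_lt a ha) hz (h.hasDeriv a ha z hz).continuousWithinAt (h.map_eq a ha)

end Branches

/-! ### Noisy orbits and an adapted potential -/

/-- A step from `x` to `y` along a branch of the map, with errors at most `ε`. The weight `w` is at
most the inverse of the derivative, or twice that near a turning point. -/
def NoisyStep (T : UnitAddCircle → UnitAddCircle) (n : ℕ) (d : ℕ → ℝ) (g g' : ℕ → ℝ → ℝ) (ε : ℝ)
    (x y : UnitAddCircle) (w : ℝ) : Prop :=
  ∃ a < n, ∃ x' ∈ Icc (d a) (d (a + 1)), ∃ z ∈ Icc (d a) (d (a + 1)), (x' : UnitAddCircle) = x ∧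
    |x' - z| ≤ ε ∧ dist y (g a z : UnitAddCircle) ≤ ε ∧ 0 ≤ w ∧ w * |g' a z| ≤ 2 ∧
    ((∃ p, IsTurningPoint T p ∧ dist x p ≤ ε) ∨ w * |g' a z| ≤ 1)

section Branches

variable {T : UnitAddCircle → UnitAddCircle} {n k : ℕ} {d : ℕ → ℝ} {g g' g'' : ℕ → ℝ → ℝ}
  {c M Λ : ℝ}

theorem ExpandingBranches.step_le (h : ExpandingBranches T n d g g' g'' c M Λ k) {ε : ℝ}
    {x y : UnitAddCircle} {w : ℝ} (hs : NoisyStep T n d g g' ε x y w) : 0 ≤ w ∧ w ≤ 2 / c := by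
  obtain ⟨a, ha, x', -, z, hz, -, -, -, hw, hw2, -⟩ := hs
  refine ⟨hw, ?_⟩
  rw [le_div_iff₀ h.c_pos]
  exact (mul_le_mul_of_nonneg_left (h.lower a ha z hz) hw).trans hw2

theorem tendsto_ultrafilter_of_forall_lt (U : Ultrafilter ℕ) {a : ℕ → ℕ} {n : ℕ}
    (h : ∀ m, a m < n) : ∃ b < n, ∀ᶠ m in (U : Filter ℕ), a m = b := by
  obtain ⟨b, hb, hU⟩ := (finite_Iio n).isCompact.ultrafilter_le_nhds (U.map a)
    (Filter.le_principal_iff.2 (Filter.mem_map.2 (Filter.Eventually.of_forall h)))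
  rw [nhds_discrete] at hU
  exact ⟨b, hb, hU (show {b} ∈ pure b by simp)⟩

theorem exists_tendsto_ultrafilter {X : Type*} [TopologicalSpace X] {s : Set X} (hs : IsCompact s)
    (U : Ultrafilter ℕ) {x : ℕ → X} (h : ∀ m, x m ∈ s) :
    ∃ y ∈ s, Tendsto x (U : Filter ℕ) (𝓝 y) := by
  obtain ⟨y, hy, hU⟩ := hs.ultrafilter_le_nhds (U.map x)
    (Filter.le_principal_iff.2 (Filter.mem_map.2 (Filter.Eventually.of_forall h)))
  exact ⟨y, hy, hU⟩

theorem ExpandingBranches.step_limit (h : ExpandingBranches T n d g g' g'' c M Λ k)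
    (U : Ultrafilter ℕ) {ε w : ℕ → ℝ} {x y : ℕ → UnitAddCircle}
    (hs : ∀ m, NoisyStep T n d g g' (ε m) (x m) (y m) (w m)) {X Y : UnitAddCircle} {w₀ : ℝ}
    (hε : Tendsto ε (U : Filter ℕ) (𝓝 0)) (hx : Tendsto x (U : Filter ℕ) (𝓝 X))
    (hy : Tendsto y (U : Filter ℕ) (𝓝 Y)) (hw : Tendsto w (U : Filter ℕ) (𝓝 w₀)) :
    NoisyStep T n d g g' 0 X Y w₀ := by
  choose a ha x' hx' z hz hxx hxz hyz hw0 hw2 hor using hs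
  obtain ⟨b, hb, hab⟩ := tendsto_ultrafilter_of_forall_lt U ha
  obtain ⟨Z, -, hZ⟩ := exists_tendsto_ultrafilter (isCompact_Icc (a := (0 : ℝ)) (b := 1)) U
    fun m => h.Icc_subset (ha m) (hz m)
  have hzb : ∀ᶠ m in (U : Filter ℕ), z m ∈ Icc (d b) (d (b + 1)) := by
    filter_upwards [hab] with m hm
    rw [← hm]; exact hz m
  have hZb : Z ∈ Icc (d b) (d (b + 1)) := isClosed_Icc.mem_of_tendsto hZ hzb
  have hZw : Tendsto z (U : Filter ℕ) (𝓝[Icc (d b) (d (b + 1))] Z) := tendsto_nhdsWithin_iff.2 ⟨hZ, hzb⟩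
  have hx'Z : Tendsto x' (U : Filter ℕ) (𝓝 Z) := by
    have h1 : Tendsto (fun m => x' m - z m) (U : Filter ℕ) (𝓝 0) :=
      squeeze_zero_norm (fun m => hxz m) hε
    simpa using h1.add hZ
  have hXZ : (Z : UnitAddCircle) = X := by
    have h1 : Tendsto (fun m => (x' m : UnitAddCircle)) (U : Filter ℕ) (𝓝 (Z : UnitAddCircle)) :=
      ((AddCircle.continuous_mk' (1 : ℝ)).tendsto Z).comp hx'Z
    simp_rw [hxx] at h1
    exact tendsto_nhds_unique h1 hx
  have hg : Tendsto (fun m => ((g b (z m) : ℝ) : UnitAddCircle)) (U : Filter ℕ) (𝓝 (g b Z)) :=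
    ((AddCircle.continuous_mk' (1 : ℝ)).tendsto (g b Z)).comp
      ((h.hasDeriv b hb Z hZb).continuousWithinAt.tendsto.comp hZw)
  have hg' : Tendsto (fun m => w m * |g' b (z m)|) (U : Filter ℕ) (𝓝 (w₀ * |g' b Z|)) :=
    hw.mul ((h.cont b hb Z hZb).tendsto.comp hZw).abs
  refine ⟨b, hb, Z, hZb, Z, hZb, hXZ, by simp, ?_, ge_of_tendsto' hw hw0, ?_, ?_⟩
  · refine le_of_tendsto_of_tendsto (hy.dist hg) hε ?_
    filter_upwards [hab] with m hm
    rw [← hm]; exact hyz m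
  · refine le_of_tendsto hg' ?_
    filter_upwards [hab] with m hm
    rw [← hm]; exact hw2 m
  · rcases Ultrafilter.eventually_or.1 (Eventually.of_forall (f := (U : Filter ℕ)) hor) with h1 | h1
    · left
      have h2 : ∀ m, ∃ p, (∃ q, IsTurningPoint T q ∧ dist (x m) q ≤ ε m) →
          IsTurningPoint T p ∧ dist (x m) p ≤ ε m := fun m => by
        by_cases hm : ∃ q, IsTurningPoint T q ∧ dist (x m) q ≤ ε m
        · obtain ⟨q, hq⟩ := hm
          exact ⟨q, fun _ => hq⟩
        · exact ⟨0, fun h => absurd h hm⟩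
      choose p hp using h2
      obtain ⟨P, hP, hU⟩ := h.finite_turning.isCompact.ultrafilter_le_nhds (U.map p)
        (Filter.le_principal_iff.2 (Filter.mem_map.2 (h1.mono fun m hm => (hp m hm).1)))
      refine ⟨P, hP, le_of_tendsto_of_tendsto (hx.dist hU) hε ?_⟩
      exact h1.mono fun m hm => (hp m hm).2
    · right
      refine le_of_tendsto hg' ?_
      filter_upwards [hab, h1] with m hm hm1
      rw [← hm]; exact hm1

theorem prod_range_mul_blocks (w : ℕ → ℝ) (k q : ℕ) :
    ∏ i ∈ Finset.range (k * q), w i = ∏ b ∈ Finset.range q, ∏ j ∈ Finset.range k, w (k * b + j) := by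
  induction q with
  | zero => simp
  | succ q ih => rw [Nat.mul_succ, Finset.prod_range_add, ih, Finset.prod_range_succ]

theorem ExpandingBranches.exists_exact_contraction (h : ExpandingBranches T n d g g' g'' c M Λ k)
    (hper : ∀ p, ¬ IsPeriodicTurningPoint T p) :
    ∃ N : ℕ, 0 < N ∧ ∀ (x : ℕ → UnitAddCircle) (w : ℕ → ℝ),
      (∀ i < N, NoisyStep T n d g g' 0 (x i) (x (i + 1)) (w i)) →
        ∏ i ∈ Finset.range N, w i < 1 / 2 := by
  classical
  have hΛ : 0 < Λ := one_pos.trans h.one_lt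
  set D : ℝ := max 1 (2 / c) with hD
  have hD1 : 1 ≤ D := le_max_left _ _
  set s := h.finite_turning.toFinset.card with hs
  set B : ℝ := Λ * D ^ k with hB
  have hB1 : 1 ≤ B := one_le_mul_of_one_le_of_one_le h.one_lt.le (one_le_pow₀ hD1)
  have hB0 : 0 < B ^ s := by positivity
  obtain ⟨q, hq⟩ := exists_pow_lt_of_lt_one (show (0 : ℝ) < 1 / 2 / B ^ s by positivity)
    (inv_lt_one_of_one_lt₀ h.one_lt)
  refine ⟨k * (q + 1), Nat.mul_pos h.k_pos (Nat.succ_pos q), fun x w hstep => ?_⟩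
  have hw0 : ∀ i < k * (q + 1), 0 ≤ w i := fun i hi => (h.step_le (hstep i hi)).1
  have hlv : ∀ i < k * (q + 1), IsLimitValue T (x i) (x (i + 1)) := by
    intro i hi
    obtain ⟨a, ha, x', -, z, hz, hx', hxz, hy, -⟩ := hstep i hi
    have h1 : x' = z := by simpa [sub_eq_zero] using hxz
    have h2 := dist_le_zero.1 hy
    rw [h2, ← hx', h1]
    exact h.isLimitValue ha hz
  have htrans : ∀ i j, i < j → j ≤ k * (q + 1) → Relation.TransGen (IsLimitValue T) (x i) (x j) := by
    intro i j hij
    induction j, hij using Nat.le_induction with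
    | base => exact fun hj => Relation.TransGen.single (hlv i (by omega))
    | succ j hij ih => exact fun hj => (ih (by omega)).tail (hlv j (by omega))
  have hinj : ∀ i j, i < k * (q + 1) → j < k * (q + 1) → IsTurningPoint T (x i) → x i = x j → i = j := by
    intro i j hi hj ht he
    rcases lt_trichotomy i j with hl | hl | hl
    · exact absurd ⟨ht, he ▸ htrans i j hl hj.le⟩ (hper (x i))
    · exact hl
    · refine absurd ⟨ht, ?_⟩ (hper (x i))
      have := htrans j i hl hi.le
      rwa [← he] at this
  have hidx : ∀ b < q + 1, ∀ j < k, k * b + j < k * (q + 1) := by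
    intro b hb j hj
    calc k * b + j < k * (b + 1) := by rw [Nat.mul_succ]; omega
      _ ≤ k * (q + 1) := Nat.mul_le_mul_left k hb
  set bad : Finset ℕ := (Finset.range (q + 1)).filter
    fun b => ∃ j < k, IsTurningPoint T (x (k * b + j)) with hbad
  have hcard : bad.card ≤ s := by
    have h1 : ∀ b, ∃ j, b ∈ bad → j < k ∧ IsTurningPoint T (x (k * b + j)) := fun b => by
      by_cases hb : b ∈ bad
      · obtain ⟨j, hj⟩ := (Finset.mem_filter.1 hb).2
        exact ⟨j, fun _ => hj⟩
      · exact ⟨0, fun h => absurd h hb⟩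
    choose j hj using h1
    refine Finset.card_le_card_of_injOn (fun b => x (k * b + j b)) (fun b hb => ?_) ?_
    · exact Finset.mem_coe.2 (h.finite_turning.mem_toFinset.2 (hj b hb).2)
    · intro b hb b' hb' he
      have hbq := Finset.mem_range.1 (Finset.mem_filter.1 hb).1
      have hbq' := Finset.mem_range.1 (Finset.mem_filter.1 hb').1
      have h2 := hinj _ _ (hidx b hbq _ (hj b hb).1) (hidx b' hbq' _ (hj b' hb').1) (hj b hb).2 he
      have h3 : (k * b + j b) / k = b := by
        rw [Nat.mul_add_div h.k_pos, Nat.div_eq_of_lt (hj b hb).1, add_zero]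
      have h4 : (k * b' + j b') / k = b' := by
        rw [Nat.mul_add_div h.k_pos, Nat.div_eq_of_lt (hj b' hb').1, add_zero]
      rw [← h3, ← h4, h2]
  have hblock : ∀ b ∈ Finset.range (q + 1),
      ∏ j ∈ Finset.range k, w (k * b + j) ≤ Λ⁻¹ * if b ∈ bad then B else 1 := by
    intro b hb
    have hbq := Finset.mem_range.1 hb
    by_cases hbb : b ∈ bad
    · rw [if_pos hbb, hB, ← mul_assoc, inv_mul_cancel₀ hΛ.ne', one_mul]
      calc ∏ j ∈ Finset.range k, w (k * b + j) ≤ ∏ j ∈ Finset.range k, D := by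
            refine Finset.prod_le_prod (fun j hj => hw0 _ (hidx b hbq j (Finset.mem_range.1 hj)))
              fun j hj => ?_
            exact (h.step_le (hstep _ (hidx b hbq j (Finset.mem_range.1 hj)))).2.trans (le_max_right _ _)
        _ = D ^ k := by simp
    · rw [if_neg hbb, mul_one]
      have hnt : ∀ j < k, ¬ IsTurningPoint T (x (k * b + j)) := fun j hj ht =>
        hbb (Finset.mem_filter.2 ⟨hb, j, hj, ht⟩)
      have h1 : ∀ j, ∃ E, j < k → HasCircleDerivAt T (x (k * b + j)) E ∧
          x (k * b + j + 1) = T (x (k * b + j)) ∧ w (k * b + j) * |E| ≤ 1 := by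
        intro j
        by_cases hj : j < k
        · obtain ⟨E, hE⟩ := circleDifferentiableAt_iff.1 (not_not.1 (hnt j hj))
          obtain ⟨a, ha, x', -, z, hz, hx', hxz, hy, -, -, hor⟩ := hstep _ (hidx b hbq j hj)
          have hxz' : x' = z := by simpa [sub_eq_zero] using hxz
          rw [hxz'] at hx'
          rw [← hx'] at hE
          have h2 := h.eq_of_hasCircleDerivAt ha hz hE
          refine ⟨E, fun _ => ⟨hx' ▸ hE, ?_, ?_⟩⟩
          · rw [← hx', h2.1]; exact dist_le_zero.1 hy
          · rw [h2.2]
            rcases hor with ⟨p, hp, hpx⟩ | hor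
            · rw [← dist_le_zero.1 hpx] at hp
              exact absurd hp (hnt j hj)
            · exact hor
        · exact ⟨0, fun h => absurd h hj⟩
      choose E hE using h1
      have horb : ∀ j ≤ k, x (k * b + j) = T^[j] (x (k * b)) := by
        intro j
        induction j with
        | zero => intro _; rfl
        | succ j ih =>
          intro hj
          rw [Function.iterate_succ_apply', ← ih (by omega), ← (hE j (by omega)).2.1]
          rfl
      have h3 := h.expand (x (k * b)) E fun i hi => by
        rw [← horb i hi.le]; exact (hE i hi).1
      have hwn : 0 ≤ ∏ j ∈ Finset.range k, w (k * b + j) :=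
        Finset.prod_nonneg fun j hj => hw0 _ (hidx b hbq j (Finset.mem_range.1 hj))
      have h4 : (∏ j ∈ Finset.range k, w (k * b + j)) * |∏ j ∈ Finset.range k, E j| ≤ 1 := by
        rw [Finset.abs_prod, ← Finset.prod_mul_distrib]
        refine Finset.prod_le_one (fun j hj => ?_) fun j hj => (hE j (Finset.mem_range.1 hj)).2.2
        exact mul_nonneg (hw0 _ (hidx b hbq j (Finset.mem_range.1 hj))) (abs_nonneg _)
      rw [← one_div, le_div_iff₀ hΛ]
      exact (mul_le_mul_of_nonneg_left h3 hwn).trans h4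
  rw [prod_range_mul_blocks]
  calc ∏ b ∈ Finset.range (q + 1), ∏ j ∈ Finset.range k, w (k * b + j)
      ≤ ∏ b ∈ Finset.range (q + 1), (Λ⁻¹ * if b ∈ bad then B else 1) :=
        Finset.prod_le_prod (fun b hb => Finset.prod_nonneg fun j hj =>
          hw0 _ (hidx b (Finset.mem_range.1 hb) j (Finset.mem_range.1 hj))) hblock
    _ = Λ⁻¹ ^ (q + 1) * B ^ bad.card := by
        rw [Finset.prod_mul_distrib, Finset.prod_const, Finset.card_range, ← Finset.prod_filter,
          Finset.prod_const]
        congr 3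
        ext b
        simp only [Finset.mem_filter, hbad, Finset.mem_range]
        tauto
    _ ≤ Λ⁻¹ ^ q * B ^ s := by
        refine mul_le_mul ?_ (pow_le_pow_right₀ hB1 hcard) (by positivity) (by positivity)
        exact pow_le_pow_of_le_one (by positivity) (inv_lt_one_of_one_lt₀ h.one_lt).le (Nat.le_succ q)
    _ < 1 / 2 := by rwa [lt_div_iff₀ hB0] at hq

theorem ExpandingBranches.exists_noisy_contraction (h : ExpandingBranches T n d g g' g'' c M Λ k)
    (hper : ∀ p, ¬ IsPeriodicTurningPoint T p) :
    ∃ N : ℕ, 0 < N ∧ ∃ ε > 0, ∀ (x : ℕ → UnitAddCircle) (w : ℕ → ℝ),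
      (∀ i < N, NoisyStep T n d g g' ε (x i) (x (i + 1)) (w i)) →
        ∏ i ∈ Finset.range N, w i ≤ 1 / 2 := by
  obtain ⟨N, hN, hex⟩ := h.exists_exact_contraction hper
  refine ⟨N, hN, ?_⟩
  by_contra! hcon
  set ε : ℕ → ℝ := fun m => 1 / ((m : ℝ) + 1) with hε
  have hεpos : ∀ m, 0 < ε m := fun m => Nat.one_div_pos_of_nat
  choose x w hstep hprod using fun m => hcon (ε m) (hεpos m)
  set U : Ultrafilter ℕ := hyperfilter ℕ
  have hU : (U : Filter ℕ) ≤ atTop := Nat.hyperfilter_le_atTop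
  have hε0 : Tendsto ε (U : Filter ℕ) (𝓝 0) := tendsto_one_div_add_atTop_nhds_zero_nat.mono_left hU
  choose X hX using fun i => exists_tendsto_ultrafilter isCompact_univ U fun m => mem_univ (x m i)
  have hwl : ∀ i, ∃ w₀, i < N → Tendsto (fun m => w m i) (U : Filter ℕ) (𝓝 w₀) := fun i => by
    by_cases hi : i < N
    · obtain ⟨w₀, -, hw₀⟩ := exists_tendsto_ultrafilter isCompact_Icc U
        fun m => (h.step_le (hstep m i hi) : w m i ∈ Icc 0 (2 / c))
      exact ⟨w₀, fun _ => hw₀⟩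
    · exact ⟨0, fun h => absurd h hi⟩
  choose w₀ hw₀ using hwl
  have hlim := hex X w₀ fun i hi =>
    h.step_limit U (fun m => hstep m i hi) hε0 (hX i).2 (hX (i + 1)).2 (hw₀ i hi)
  have h1 : Tendsto (fun m => ∏ i ∈ Finset.range N, w m i) (U : Filter ℕ)
      (𝓝 (∏ i ∈ Finset.range N, w₀ i)) :=
    tendsto_finsetProd _ fun i hi => hw₀ i (Finset.mem_range.1 hi)
  exact absurd (ge_of_tendsto' h1 fun m => (hprod m).le) (not_le.2 hlim)

theorem ExpandingBranches.exists_potential (h : ExpandingBranches T n d g g' g'' c M Λ k)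
    (hper : ∀ p, ¬ IsPeriodicTurningPoint T p) :
    ∃ (W : UnitAddCircle → ℝ) (α ε R : ℝ), 0 < α ∧ α < 1 ∧ 0 < ε ∧ (∀ x, 1 ≤ W x ∧ W x ≤ R) ∧
      ∀ x y w, NoisyStep T n d g g' ε x y w → w * W y ≤ α * W x := by
  obtain ⟨N, hN, ε, hε, hcon⟩ := h.exists_noisy_contraction hper
  have hN0 : (0 : ℝ) < N := Nat.cast_pos.2 hN
  have hN1 : (1 : ℝ) ≤ N := by exact_mod_cast hN
  set α : ℝ := 1 + -(1 / (2 * N)) with hα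
  have hsmall : 1 / (2 * (N : ℝ)) ≤ 1 / 2 := by
    rw [div_le_div_iff₀ (by positivity) (by positivity)]; linarith
  have hα0 : 0 < α := by rw [hα]; linarith
  have hα1 : α < 1 := by
    have : 0 < 1 / (2 * (N : ℝ)) := by positivity
    rw [hα]; linarith
  have hαN : 1 / 2 ≤ α ^ N := by
    have h1 := one_add_mul_le_pow (show (-2 : ℝ) ≤ -(1 / (2 * N)) by linarith) N
    have h2 : 1 + (N : ℝ) * -(1 / (2 * N)) = 1 / 2 := by field_simp; norm_num
    rwa [h2] at h1
  set D : ℝ := max 1 (2 / c) with hD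
  have hD1 : 1 ≤ D := le_max_left _ _
  have hDα : 1 ≤ D / α := by rw [le_div_iff₀ hα0]; linarith
  set R : ℝ := (D / α) ^ N with hR
  have hbound : ∀ m (x : ℕ → UnitAddCircle) (w : ℕ → ℝ),
      (∀ i < m, NoisyStep T n d g g' ε (x i) (x (i + 1)) (w i)) →
        ∏ i ∈ Finset.range m, w i ≤ α ^ m * R := by
    intro m
    induction m using Nat.strong_induction_on with
    | _ m ih =>
      intro x w hs
      rcases lt_or_ge m N with hm | hm
      · calc ∏ i ∈ Finset.range m, w i ≤ ∏ i ∈ Finset.range m, D :=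
              Finset.prod_le_prod (fun i hi => (h.step_le (hs i (Finset.mem_range.1 hi))).1)
                fun i hi => (h.step_le (hs i (Finset.mem_range.1 hi))).2.trans (le_max_right _ _)
          _ = α ^ m * (D / α) ^ m := by
              rw [Finset.prod_const, Finset.card_range, ← mul_pow, mul_div_cancel₀ _ hα0.ne']
          _ ≤ α ^ m * R :=
              mul_le_mul_of_nonneg_left (pow_le_pow_right₀ hDα hm.le) (by positivity)
      · obtain ⟨l, rfl⟩ := Nat.exists_eq_add_of_le hm
        rw [Finset.prod_range_add]
        have h1 := hcon x w fun i hi => hs i (by omega)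
        have h2 := ih l (by omega) (fun i => x (N + i)) (fun i => w (N + i)) fun i hi => by
          have := hs (N + i) (by omega)
          rwa [add_assoc] at this
        have h3 : 0 ≤ ∏ i ∈ Finset.range l, w (N + i) := Finset.prod_nonneg fun i hi =>
          (h.step_le (hs (N + i) (by have := Finset.mem_range.1 hi; omega))).1
        calc _ ≤ α ^ N * (α ^ l * R) := mul_le_mul (h1.trans hαN) h2 h3 (by positivity)
          _ = α ^ (N + l) * R := by rw [pow_add]; ring
  set V : UnitAddCircle → Set ℝ := fun x₀ => {v | ∃ (m : ℕ) (x : ℕ → UnitAddCircle) (w : ℕ → ℝ),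
    x 0 = x₀ ∧ (∀ i < m, NoisyStep T n d g g' ε (x i) (x (i + 1)) (w i)) ∧
      v = α⁻¹ ^ m * ∏ i ∈ Finset.range m, w i} with hV
  have hVR : ∀ x, ∀ v ∈ V x, v ≤ R := by
    rintro x₀ v ⟨m, x, w, -, hs, rfl⟩
    rw [inv_pow, inv_mul_le_iff₀ (by positivity)]
    exact hbound m x w hs
  have hV1 : ∀ x, 1 ∈ V x := fun x₀ => ⟨0, fun _ => x₀, fun _ => 0, rfl, by simp, by simp⟩
  have hVb : ∀ x, BddAbove (V x) := fun x => ⟨R, hVR x⟩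
  refine ⟨fun x => sSup (V x), α, ε, R, hα0, hα1, hε, fun x =>
    ⟨le_csSup (hVb x) (hV1 x), csSup_le ⟨1, hV1 x⟩ (hVR x)⟩, fun x y w hs => ?_⟩
  have hw := (h.step_le hs).1
  rcases hw.eq_or_lt with h0 | hwpos
  · rw [← h0, zero_mul]
    exact mul_nonneg hα0.le (zero_le_one.trans (le_csSup (hVb x) (hV1 x)))
  · rw [mul_comm, ← le_div_iff₀ hwpos]
    refine csSup_le ⟨1, hV1 y⟩ ?_
    rintro v ⟨m, X, ω, hX, hst, rfl⟩
    rw [le_div_iff₀ hwpos]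
    have hmem : α⁻¹ ^ (m + 1) * ((∏ i ∈ Finset.range m, ω i) * w) ∈ V x := by
      refine ⟨m + 1, fun i => Nat.casesOn i x X, fun i => Nat.casesOn i w ω, rfl, ?_, ?_⟩
      · intro i hi
        cases i with
        | zero => simpa [hX] using hs
        | succ i => exact hst i (by omega)
      · rw [Finset.prod_range_succ']
        rfl
    have h1 := mul_le_mul_of_nonneg_left (le_csSup (hVb x) hmem) hα0.le
    refine le_trans (le_of_eq ?_) h1
    rw [pow_succ]
    field_simp

end Branches

/-! ### The Lasota–Yorke inequality -/

/-- The tent of width `r`, on the positive half-line. -/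
def tent (r s : ℝ) : ℝ := max 0 (1 - s / r)

theorem tent_zero (r : ℝ) : tent r 0 = 1 := by simp [tent]

theorem tent_of_le {r s : ℝ} (hr : 0 < r) (hs : r ≤ s) : tent r s = 0 := by
  have : 1 ≤ s / r := by rwa [le_div_iff₀ hr, one_mul]
  exact max_eq_left (by linarith)

theorem tent_nonneg (r s : ℝ) : 0 ≤ tent r s := le_max_left _ _

theorem tent_le_one {r s : ℝ} (hr : 0 < r) (hs : 0 ≤ s) : tent r s ≤ 1 := by
  have : 0 ≤ s / r := by positivity
  exact max_le zero_le_one (by linarith)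

theorem continuous_tent (r : ℝ) : Continuous (tent r) := by
  unfold tent
  fun_prop

theorem hasDerivAt_tent {r s : ℝ} (hr : 0 < r) (hs : s ≠ r) :
    HasDerivAt (tent r) (if s < r then -(1 / r) else 0) s := by
  rcases hs.lt_or_gt with h | h
  · rw [if_pos h]
    have h1 : HasDerivAt (fun s : ℝ => 1 - s / r) (-(1 / r)) s :=
      ((hasDerivAt_id s).div_const r).const_sub 1
    refine h1.congr_of_eventuallyEq ?_
    filter_upwards [Iio_mem_nhds h] with x hx
    have : x / r < 1 := by rwa [div_lt_one hr]
    exact max_eq_right (by linarith)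
  · rw [if_neg (not_lt.2 h.le)]
    refine (hasDerivAt_const s (0 : ℝ)).congr_of_eventuallyEq ?_
    filter_upwards [Ioi_mem_nhds h] with x hx using tent_of_le hr (le_of_lt hx)

theorem hasDerivAt_comp_circle {Φ : UnitAddCircle → ℝ} {D : ℝ} {g : ℝ → ℝ} {g' x : ℝ}
    {ω : UnitAddCircle} (hΦ : HasDerivAt (fun t : ℝ => Φ ((g x : UnitAddCircle) + ω + t)) D 0)
    (hg : HasDerivAt g g' x) : HasDerivAt (fun y : ℝ => Φ ((g y : UnitAddCircle) + ω)) (D * g') x := by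
  have h1 : HasDerivAt (fun y => g y - g x) g' x := hg.sub_const _
  have h2 := HasDerivAt.comp (h₂ := fun t : ℝ => Φ ((g x : UnitAddCircle) + ω + t)) x
    (by simpa using hΦ) h1
  refine h2.congr_of_eventuallyEq (Eventually.of_forall fun y => ?_)
  simp only [Function.comp_apply, AddCircle.coe_sub]
  congr 1; abel

section Branches

variable {T : UnitAddCircle → UnitAddCircle} {n k : ℕ} {d : ℕ → ℝ} {g g' g'' : ℕ → ℝ → ℝ}
  {c M Λ : ℝ}

theorem ExpandingBranches.exists_tent_width (h : ExpandingBranches T n d g g' g'' c M Λ k) {ε : ℝ}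
    (hε : 0 < ε) : ∃ r > 0, r ≤ ε ∧ ∀ a < n, 2 * r ≤ d (a + 1) - d a := by
  have h1 : ∀ m ≤ n, ∃ r > 0, r ≤ ε ∧ ∀ a < m, 2 * r ≤ d (a + 1) - d a := by
    intro m
    induction m with
    | zero => exact fun _ => ⟨ε, hε, le_rfl, by simp⟩
    | succ m ih =>
      intro hm
      obtain ⟨r, hr, hrε, hrd⟩ := ih (by omega)
      have h2 := sub_pos.2 (h.d_lt m (by omega))
      refine ⟨min r ((d (m + 1) - d m) / 2), lt_min hr (by linarith),
        (min_le_left _ _).trans hrε, fun a ha => ?_⟩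
      rcases Nat.lt_succ_iff_lt_or_eq.1 ha with h3 | rfl
      · have := min_le_left r ((d (m + 1) - d m) / 2)
        linarith [hrd a h3]
      · have := min_le_right r ((d (a + 1) - d a) / 2)
        linarith
  exact h1 n le_rfl

theorem ExpandingBranches.exists_corrected_testPair
    (h : ExpandingBranches T n d g g' g'' c M Λ k) {W : UnitAddCircle → ℝ} {α ε R r : ℝ}
    (hR : ∀ x, W x ≤ R)
    (hpot : ∀ x y w, NoisyStep T n d g g' ε x y w → w * W y ≤ α * W x) (hr : 0 < r) (hrε : r ≤ ε)
    (hrd : ∀ a < n, 2 * r ≤ d (a + 1) - d a) {t : ℝ} (ht : |t| ≤ ε) {Φ φ : UnitAddCircle → ℝ}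
    (hp : TestPair Φ φ) (hΦ : ∀ x, |Φ x| ≤ W x) :
    ∃ Φ' φ', TestPair Φ' φ' ∧ (∀ x, |Φ' x| ≤ α * W x) ∧
      ∀ᵐ x, |φ (T x + t) - φ' x| ≤ R * M / c ^ 2 + 2 * (R / c) / r := by
  classical
  obtain ⟨Cφ, hCφ⟩ := hp.bdd
  obtain ⟨S, hS, hΦd⟩ := hp.hasDeriv
  have hc := h.c_pos
  have hR0 : 0 ≤ R := (abs_nonneg _).trans ((hΦ 0).trans (hR 0))
  have hM0 : 0 ≤ M := zero_le_one.trans h.one_le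
  have hε0 : 0 ≤ ε := hr.le.trans hrε
  set P : ℕ → ℝ → ℝ := fun a x => Φ ((g a x : UnitAddCircle) + t) / g' a x with hP
  have hg'0 : ∀ a < n, ∀ x ∈ Icc (d a) (d (a + 1)), 0 < |g' a x| := fun a ha x hx =>
    hc.trans_le (h.lower a ha x hx)
  have hPle : ∀ a < n, ∀ x ∈ Icc (d a) (d (a + 1)), |P a x| ≤ R / c := by
    intro a ha x hx
    rw [hP, abs_div]
    exact div_le_div₀ hR0 ((hΦ _).trans (hR _)) hc (h.lower a ha x hx)
  have hstep : ∀ a < n, ∀ x ∈ Icc (d a) (d (a + 1)), ∀ z ∈ Icc (d a) (d (a + 1)), |x - z| ≤ ε →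
      ∀ w, 0 ≤ w → w ≤ 2 → ((∃ p, IsTurningPoint T p ∧ dist (x : UnitAddCircle) p ≤ ε) ∨ w ≤ 1) →
        w * |P a z| ≤ α * W x := by
    intro a ha x hx z hz hxz w hw0 hw2 hor
    have hpos := hg'0 a ha z hz
    have hwe : w / |g' a z| * |g' a z| = w := div_mul_cancel₀ _ hpos.ne'
    have h1 := hpot x ((g a z : UnitAddCircle) + t) (w / |g' a z|)
      ⟨a, ha, x, hx, z, hz, rfl, hxz, by
        rw [dist_eq_norm, add_sub_cancel_left]; exact (norm_coe_le_abs t).trans ht,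
        by positivity, by rw [hwe]; exact hw2, by rw [hwe]; exact hor⟩
    refine le_trans ?_ h1
    rw [hP, abs_div, mul_div_assoc', div_mul_eq_mul_div]
    gcongr
    exact hΦ _
  set L : ℕ → ℝ := fun a => if IsTurningPoint T (d a) then P a (d a) else 0 with hL
  set Q : ℕ → ℝ := fun a => if IsTurningPoint T (d (a + 1)) then P a (d (a + 1)) else 0 with hQ
  have hLle : ∀ a < n, |L a| ≤ R / c := fun a ha => by
    simp only [hL]
    split_ifs
    · exact hPle a ha _ ⟨le_rfl, (h.d_lt a ha).le⟩
    · rw [abs_zero]; positivity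
  have hQle : ∀ a < n, |Q a| ≤ R / c := fun a ha => by
    simp only [hQ]
    split_ifs
    · exact hPle a ha _ ⟨(h.d_lt a ha).le, le_rfl⟩
    · rw [abs_zero]; positivity
  set Ψ : ℕ → ℝ → ℝ := fun a x =>
    P a x - L a * tent r (x - d a) - Q a * tent r (d (a + 1) - x) with hΨ
  set ψ : ℕ → ℝ → ℝ := fun a x => φ ((g a x : UnitAddCircle) + t) -
    Φ ((g a x : UnitAddCircle) + t) * g'' a x / g' a x ^ 2 -
    L a * (if x - d a < r then -(1 / r) else 0) +
    Q a * (if d (a + 1) - x < r then -(1 / r) else 0) with hψ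
  set S₁ : Set ℝ := (⋃ a ∈ Iio n, {x : ℝ | x ∈ Ioo (d a) (d (a + 1)) ∧
    ((g a x : ℝ) : UnitAddCircle) + t ∈ S}) ∪
    (range (fun a => d a + r) ∪ range fun a => d (a + 1) - r) with hS₁
  have hS₁c : S₁.Countable := (Countable.biUnion (to_countable _) fun a ha =>
    countable_inter_of_injOn (h.injOn ha) hS _).union ((countable_range _).union (countable_range _))
  have hψ_sub : ∀ a < n, ∀ x ∈ Ioo (d a) (d (a + 1)),
      |φ ((g a x : UnitAddCircle) + t) - ψ a x| ≤ R * M / c ^ 2 + 2 * (R / c) / r := by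
    intro a ha x hx
    have hx' := Ioo_subset_Icc_self hx
    have h1 : |Φ ((g a x : UnitAddCircle) + t) * g'' a x / g' a x ^ 2| ≤ R * M / c ^ 2 := by
      rw [abs_div, abs_mul, abs_pow]
      refine div_le_div₀ (by positivity) ?_ (by positivity) ?_
      · exact mul_le_mul ((hΦ _).trans (hR _)) (h.bdd₂ a ha x hx) (abs_nonneg _) hR0
      · exact pow_le_pow_left₀ hc.le (h.lower a ha x hx') 2
    have habs : ∀ p : Prop, [Decidable p] → |(if p then -(1 / r) else 0 : ℝ)| ≤ 1 / r := by
      intro p _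
      split_ifs
      · rw [abs_neg, abs_of_pos (by positivity)]
      · rw [abs_zero]; positivity
    have h2 : |L a * (if x - d a < r then -(1 / r) else 0)| ≤ R / c * (1 / r) := by
      rw [abs_mul]
      exact mul_le_mul (hLle a ha) (habs _) (abs_nonneg _) (by positivity)
    have h3 : |Q a * (if d (a + 1) - x < r then -(1 / r) else 0)| ≤ R / c * (1 / r) := by
      rw [abs_mul]
      exact mul_le_mul (hQle a ha) (habs _) (abs_nonneg _) (by positivity)
    have h4 : φ ((g a x : UnitAddCircle) + t) - ψ a x =
        Φ ((g a x : UnitAddCircle) + t) * g'' a x / g' a x ^ 2 +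
        L a * (if x - d a < r then -(1 / r) else 0) -
        Q a * (if d (a + 1) - x < r then -(1 / r) else 0) := by
      simp only [hψ]; ring
    have h5 : 2 * (R / c) / r = R / c * (1 / r) + R / c * (1 / r) := by ring
    rw [h4, h5]
    refine (abs_sub _ _).trans ?_
    have := abs_add_le (Φ ((g a x : UnitAddCircle) + t) * g'' a x / g' a x ^ 2)
      (L a * (if x - d a < r then -(1 / r) else 0))
    linarith
  -- common value at the end points of the branches
  have hE : ∃ E : UnitAddCircle → ℝ, ∀ a < n, Ψ a (d a) = E (d a) ∧ Ψ a (d (a + 1)) = E (d (a + 1)) := by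
    have h1 : ∀ x, ∃ v, ∀ a < n, ∀ z ∈ Icc (d a) (d (a + 1)), (z : UnitAddCircle) = x →
        ¬ IsTurningPoint T x → P a z = v := by
      intro x
      by_cases hx : CircleDifferentiableAt T x
      · obtain ⟨D, hD⟩ := circleDifferentiableAt_iff.1 hx
        refine ⟨Φ (T x + t) / D, fun a ha z hz hzx _ => ?_⟩
        have h2 := h.eq_of_hasCircleDerivAt ha hz (hzx ▸ hD)
        rw [← hzx, h2.1, h2.2]
      · exact ⟨0, fun a _ z _ _ hnt => absurd hx hnt⟩
    choose v hv using h1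
    refine ⟨fun x => if IsTurningPoint T x then 0 else v x, fun a ha => ⟨?_, ?_⟩⟩
    · have h3 := hrd a ha
      simp only [hΨ, sub_self, tent_zero, hL]
      rw [tent_of_le hr (by linarith), mul_zero, sub_zero, mul_one]
      split_ifs with hturn
      · ring
      · rw [sub_zero]
        exact hv _ a ha _ ⟨le_rfl, (h.d_lt a ha).le⟩ rfl hturn
    · have h3 := hrd a ha
      simp only [hΨ, sub_self, tent_zero, hQ]
      rw [tent_of_le hr (by linarith), mul_zero, sub_zero, mul_one]
      split_ifs with hturn
      · ring
      · rw [sub_zero]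
        exact hv _ a ha _ ⟨(h.d_lt a ha).le, le_rfl⟩ rfl hturn
  obtain ⟨E, hE⟩ := hE
  have hnpos : 0 < n := by
    rcases Nat.eq_zero_or_pos n with h0 | h0
    · have h1 := h.d_last
      rw [h0, h.d_zero] at h1; norm_num at h1
    · exact h0
  have hglue : ∃ Φ' φ', TestPair Φ' φ' ∧ (∀ a < n, ∀ x ∈ Icc (d a) (d (a + 1)), Φ' x = Ψ a x) ∧
      ∃ S' : Set UnitAddCircle, S'.Countable ∧
        ∀ a < n, ∀ x ∈ Ioo (d a) (d (a + 1)), (x : UnitAddCircle) ∉ S' → φ' x = ψ a x := by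
    refine exists_testPair_of_pieces h.d_zero h.d_last h.d_lt Ψ ψ
      hS₁c (C := Cφ + (R * M / c ^ 2 + 2 * (R / c) / r)) ?_ ?_ ?_ ?_ ?_
    · intro a ha
      have hgc : ContinuousOn (g a) (Icc (d a) (d (a + 1))) := fun x hx =>
        (h.hasDeriv a ha x hx).continuousWithinAt
      have h1 : Continuous fun y : ℝ => Φ ((y : UnitAddCircle) + t) :=
        hp.cont.comp ((AddCircle.continuous_mk' (1 : ℝ)).add continuous_const)
      have h2 : ContinuousOn (P a) (Icc (d a) (d (a + 1))) :=
        (h1.comp_continuousOn hgc).div (h.cont a ha) fun x hx => abs_pos.1 (hg'0 a ha x hx)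
      refine (h2.sub ?_).sub ?_
      · exact (continuous_const.mul ((continuous_tent r).comp
          (continuous_id.sub continuous_const))).continuousOn
      · exact (continuous_const.mul ((continuous_tent r).comp
          (continuous_const.sub continuous_id))).continuousOn
    · intro a ha
      rw [(hE a (by omega)).2, (hE (a + 1) ha).1]
    · have h1 : n - 1 + 1 = n := by omega
      have h2 := (hE (n - 1) (by omega)).2
      have h3 := (hE 0 hnpos).1
      rw [h1, h.d_last] at h2
      rw [h.d_zero] at h3
      rw [h2, h3]
      congr 1
      simp
    · intro a ha x hx hxS
      have hx' := Ioo_subset_Icc_self hx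
      have hxS1 : ((g a x : ℝ) : UnitAddCircle) + t ∉ S := fun hmem =>
        hxS (Or.inl (mem_biUnion (x := a) ha ⟨hx, hmem⟩))
      have hxr : x - d a ≠ r := fun he => hxS (Or.inr (Or.inl ⟨a, by simp only; linarith⟩))
      have hxr' : d (a + 1) - x ≠ r := fun he => hxS (Or.inr (Or.inr ⟨a, by simp only; linarith⟩))
      have hne : g' a x ≠ 0 := abs_pos.1 (hg'0 a ha x hx')
      have h1 := (hasDerivAt_comp_circle (hΦd _ hxS1) (h.hasDerivAt ha hx)).fun_div
        (h.hasDeriv₂ a ha x hx) hne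
      have h2 : HasDerivAt (fun y => tent r (y - d a)) (if x - d a < r then -(1 / r) else 0) x :=
        HasDerivAt.comp_sub_const x (d a) (hasDerivAt_tent hr hxr)
      have h3 : HasDerivAt (fun y => tent r (d (a + 1) - y))
          (-(if d (a + 1) - x < r then -(1 / r) else 0)) x :=
        HasDerivAt.comp_const_sub (d (a + 1)) x (hasDerivAt_tent hr hxr')
      have h4 := (h1.fun_sub (h2.const_mul (L a))).fun_sub (h3.const_mul (Q a))
      refine h4.congr_deriv ?_
      simp only [hψ]
      field_simp
      ring
    · intro a ha x hx _
      have h1 := hψ_sub a ha x hx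
      have h2 := hCφ ((g a x : UnitAddCircle) + t)
      have h3 := abs_sub (φ ((g a x : UnitAddCircle) + t)) (φ ((g a x : UnitAddCircle) + t) - ψ a x)
      rw [sub_sub_cancel] at h3
      linarith
  obtain ⟨Φ', φ', hp', hΦ', S', hS', hφ'⟩ := hglue
  refine ⟨Φ', φ', hp', fun x => ?_, ?_⟩
  · obtain ⟨a, ha, z, hz, rfl⟩ := h.exists_mem_Ico x
    have hzc : z ∈ Icc (d a) (d (a + 1)) := ⟨hz.1, hz.2.le⟩
    rw [hΦ' a ha z hzc]
    have hbase : |P a z| ≤ α * W z := by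
      have := hstep a ha z hzc z hzc (by simpa using hε0) 1 zero_le_one one_le_two (Or.inr le_rfl)
      rwa [one_mul] at this
    have hd := hrd a ha
    have hhalf : ∀ e ∈ Icc (d a) (d (a + 1)), |z - e| ≤ ε → IsTurningPoint T e → ∀ s, 0 ≤ s → s ≤ 1 →
        |P a z - P a e * s| ≤ α * W z := by
      intro e he hze hte s hs0 hs1
      have hnear : dist (z : UnitAddCircle) e ≤ ε := by
        rw [dist_eq_norm, ← AddCircle.coe_sub]
        exact (norm_coe_le_abs _).trans hze
      have h1 := hstep a ha z hzc z hzc (by simpa using hε0) 2 zero_le_two le_rfl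
        (Or.inl ⟨_, hte, hnear⟩)
      have h2 := hstep a ha z hzc e he hze 2 zero_le_two le_rfl (Or.inl ⟨_, hte, hnear⟩)
      refine (abs_sub _ _).trans ?_
      rw [abs_mul, abs_of_nonneg hs0]
      have h3 : |P a e| * s ≤ |P a e| := mul_le_of_le_one_right (abs_nonneg _) hs1
      linarith
    simp only [hΨ]
    by_cases h1 : z - d a < r
    · rw [tent_of_le (s := d (a + 1) - z) hr (by linarith), mul_zero, sub_zero]
      simp only [hL]
      split_ifs with hturn
      · refine hhalf (d a) ⟨le_rfl, (h.d_lt a ha).le⟩ ?_ hturn _ (tent_nonneg _ _)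
          (tent_le_one hr (by linarith [hz.1]))
        rw [abs_of_nonneg (by linarith [hz.1])]
        linarith
      · rwa [zero_mul, sub_zero]
    · rw [tent_of_le (s := z - d a) hr (not_lt.1 h1), mul_zero, sub_zero]
      by_cases h2 : d (a + 1) - z < r
      · simp only [hQ]
        split_ifs with hturn
        · refine hhalf (d (a + 1)) ⟨(h.d_lt a ha).le, le_rfl⟩ ?_ hturn _ (tent_nonneg _ _)
            (tent_le_one hr (by linarith [hz.2]))
          rw [abs_sub_comm, abs_of_nonneg (by linarith [hz.2])]
          linarith
        · rwa [zero_mul, sub_zero]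
      · rwa [tent_of_le hr (not_lt.1 h2), mul_zero, sub_zero]
  · have h1 := (hS'.union ((countable_range d).image fun x : ℝ => (x : UnitAddCircle)))
    have h2 : ∀ᵐ x : UnitAddCircle, x ∉ S' ∪ (fun x : ℝ => (x : UnitAddCircle)) '' range d :=
      compl_mem_ae_iff.2 (volume_countable_eq_zero h1)
    filter_upwards [h2] with x hx
    rw [mem_union, not_or] at hx
    obtain ⟨a, ha, z, hz, rfl⟩ := h.exists_mem_Ico x
    have hzo : z ∈ Ioo (d a) (d (a + 1)) :=
      ⟨lt_of_le_of_ne hz.1 fun he => hx.2 ⟨z, ⟨a, he⟩, rfl⟩, hz.2⟩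
    rw [hφ' a ha z hzo hx.1, h.map_eq a ha z hzo]
    exact hψ_sub a ha z hzo

theorem ExpandingBranches.lasotaYorke (h : ExpandingBranches T n d g g' g'' c M Λ k)
    (hper : ∀ p, ¬ IsPeriodicTurningPoint T p) :
    ∃ (W : UnitAddCircle → ℝ) (α B ε R : ℝ), 0 < α ∧ α < 1 ∧ 0 ≤ B ∧ 0 < ε ∧
      (∀ x, 1 ≤ W x) ∧ (∀ x, W x ≤ R) ∧ ∀ (f : UnitAddCircle → ℝ) (K : ℝ), Integrable f →
        VarLE W f K → ∀ t : ℝ, |t| ≤ ε → ∀ Φ φ, TestPair Φ φ → (∀ x, |Φ x| ≤ W x) →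
          ∫ x, f x * φ (T x + t) ≤ α * K + B * ∫ x, |f x| := by
  obtain ⟨W, α, ε, R, hα0, hα1, hε, hW, hpot⟩ := h.exists_potential hper
  obtain ⟨r, hr, hrε, hrd⟩ := h.exists_tent_width hε
  have hR0 : 0 ≤ R := zero_le_one.trans ((hW 0).1.trans (hW 0).2)
  have hc := h.c_pos
  have hM0 : 0 ≤ M := zero_le_one.trans h.one_le
  refine ⟨W, α, R * M / c ^ 2 + 2 * (R / c) / r, ε, R, hα0, hα1, by positivity, hε,
    fun x => (hW x).1, fun x => (hW x).2, fun f K hf hK t ht Φ φ hp hΦ => ?_⟩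
  obtain ⟨Φ', φ', hp', hΦ', hφ'⟩ := h.exists_corrected_testPair (fun x => (hW x).2) hpot hr hrε hrd
    ht hp hΦ
  obtain ⟨C, hC⟩ := hp.bdd
  have h1 := hK.scale hp' hα0 hΦ'
  have hi1 := hp'.integrable_mul hf
  have hi2 : Integrable fun x => f x * φ (T x + t) :=
    integrable_mul_of_abs_le hf (hp.meas.comp (h.measurable.add_const _)) fun x => hC _
  set B := R * M / c ^ 2 + 2 * (R / c) / r with hB
  have h2 : ∫ x, (f x * φ (T x + t) - f x * φ' x) ≤ ∫ x, B * |f x| := by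
    refine integral_mono_ae (hi2.sub hi1) (hf.abs.const_mul B) ?_
    filter_upwards [hφ'] with x hx
    have : f x * φ (T x + t) - f x * φ' x = f x * (φ (T x + t) - φ' x) := by ring
    rw [this]
    refine (le_abs_self _).trans ?_
    rw [abs_mul, mul_comm]
    exact mul_le_mul_of_nonneg_right hx (abs_nonneg _)
  rw [integral_sub hi2 hi1, integral_const_mul] at h2
  linarith

end Branches

/-! ### Densities and the transfer operator -/

theorem integrable_ofReal_withDensity_finite {h : UnitAddCircle → ℝ} (hi : Integrable h) :
    IsFiniteMeasure (densityMeasure h) :=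
  isFiniteMeasure_withDensity_ofReal hi.2

theorem densityMeasure_apply {h : UnitAddCircle → ℝ} (hi : Integrable h) (h0 : ∀ᵐ x, 0 ≤ h x)
    {A : Set UnitAddCircle} (hA : MeasurableSet A) :
    densityMeasure h A = ENNReal.ofReal (∫ x in A, h x) := by
  rw [densityMeasure, withDensity_apply _ hA,
    ofReal_integral_eq_lintegral_ofReal hi.integrableOn (ae_restrict_of_ae h0)]

theorem integral_densityMeasure {h : UnitAddCircle → ℝ} (hi : Integrable h) (h0 : ∀ᵐ x, 0 ≤ h x)
    (φ : UnitAddCircle → ℝ) : ∫ x, φ x ∂(densityMeasure h) = ∫ x, h x * φ x := by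
  rw [densityMeasure, integral_withDensity_eq_integral_toReal_smul₀
    hi.1.aemeasurable.ennreal_ofReal (Eventually.of_forall fun x => ENNReal.ofReal_lt_top)]
  refine integral_congr_ae ?_
  filter_upwards [h0] with x hx
  rw [ENNReal.toReal_ofReal hx, smul_eq_mul]

theorem ae_eq_of_forall_integral_mul {u v : UnitAddCircle → ℝ} (hu : Integrable u)
    (hv : Integrable v) (h : ∀ φ : UnitAddCircle → ℝ, Measurable φ → (∀ x, |φ x| ≤ 1) →
      ∫ x, u x * φ x = ∫ x, v x * φ x) : u =ᵐ[volume] v := by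
  refine Integrable.ae_eq_of_forall_setIntegral_eq u v hu hv fun s hs _ => ?_
  have h1 := h (s.indicator fun _ => 1) (measurable_const.indicator hs) fun x => by
    by_cases hx : x ∈ s <;> simp [hx]
  have h2 : ∀ w : UnitAddCircle → ℝ, ∀ x, w x * s.indicator (fun _ => (1 : ℝ)) x = s.indicator w x := by
    intro w x
    by_cases hx : x ∈ s <;> simp [hx]
  simp_rw [h2] at h1
  rwa [integral_indicator hs, integral_indicator hs] at h1

section Transfer

variable {T : UnitAddCircle → UnitAddCircle}

theorem exists_transfer_of_nonneg (hT : Measurable T) (hns : (volume.map T) ≪ volume)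
    {f : UnitAddCircle → ℝ} (hf : Integrable f) (h0 : ∀ᵐ x, 0 ≤ f x) :
    ∃ g : UnitAddCircle → ℝ, Integrable g ∧ ∀ φ : UnitAddCircle → ℝ, Measurable φ →
      (∀ x, |φ x| ≤ 1) → ∫ x, g x * φ x = ∫ x, f x * φ (T x) := by
  have := integrable_ofReal_withDensity_finite hf
  set ν := (densityMeasure f).map T with hν
  have hνac : ν ≪ volume :=
    ((withDensity_absolutelyContinuous _ _).map hT).trans hns
  refine ⟨fun x => (ν.rnDeriv volume x).toReal, Measure.integrable_toReal_rnDeriv, fun φ hφ hφ1 => ?_⟩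
  have h1 := integral_rnDeriv_smul hνac (f := φ)
  simp only [smul_eq_mul] at h1
  rw [h1, hν, integral_map hT.aemeasurable hφ.aestronglyMeasurable, integral_densityMeasure hf h0]

theorem exists_transfer (hT : Measurable T) (hns : (volume.map T) ≪ volume)
    {f : UnitAddCircle → ℝ} (hf : Integrable f) :
    ∃ g : UnitAddCircle → ℝ, Integrable g ∧ ∀ φ : UnitAddCircle → ℝ, Measurable φ →
      (∀ x, |φ x| ≤ 1) → ∫ x, g x * φ x = ∫ x, f x * φ (T x) := by
  obtain ⟨g₁, hg₁, h₁⟩ := exists_transfer_of_nonneg hT hns hf.pos_part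
    (Eventually.of_forall fun x => le_max_right _ _)
  obtain ⟨g₂, hg₂, h₂⟩ := exists_transfer_of_nonneg hT hns hf.neg_part
    (Eventually.of_forall fun x => le_max_right _ _)
  refine ⟨fun x => g₁ x - g₂ x, hg₁.sub hg₂, fun φ hφ hφ1 => ?_⟩
  have hφT : Measurable fun x => φ (T x) := hφ.comp hT
  simp_rw [sub_mul]
  rw [integral_sub (integrable_mul_of_abs_le hg₁ hφ hφ1) (integrable_mul_of_abs_le hg₂ hφ hφ1),
    h₁ φ hφ hφ1, h₂ φ hφ hφ1, ← integral_sub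
      (integrable_mul_of_abs_le hf.pos_part hφT fun x => hφ1 _)
      (integrable_mul_of_abs_le hf.neg_part hφT fun x => hφ1 _)]
  congr 1
  ext x
  rw [← sub_mul]
  congr 1
  rcases le_total 0 (f x) with h | h
  · rw [max_eq_left h, max_eq_right (by linarith), sub_zero]
  · rw [max_eq_right h, max_eq_left (by linarith)]; ring

/-- `L` is the transfer operator of `T` on `L¹`. -/
structure IsTransferOperator (T : UnitAddCircle → UnitAddCircle)
    (L : (UnitAddCircle →₁[volume] ℝ) →L[ℝ] (UnitAddCircle →₁[volume] ℝ)) : Prop where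
  integral_mul : ∀ (f : UnitAddCircle →₁[volume] ℝ) (φ : UnitAddCircle → ℝ), Measurable φ →
    ∀ C, (∀ x, |φ x| ≤ C) → ∫ x, L f x * φ x = ∫ x, f x * φ (T x)
  norm_le : ∀ f, ‖L f‖ ≤ ‖f‖

theorem exists_isTransferOperator (hT : Measurable T) (hns : (volume.map T) ≪ volume) :
    ∃ L, IsTransferOperator T L := by
  have hex : ∀ f : UnitAddCircle →₁[volume] ℝ, ∃ g : UnitAddCircle →₁[volume] ℝ,
      ∀ φ : UnitAddCircle → ℝ, Measurable φ → (∀ x, |φ x| ≤ 1) →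
        ∫ x, g x * φ x = ∫ x, f x * φ (T x) := by
    intro f
    obtain ⟨g, hg, h⟩ := exists_transfer hT hns (L1.integrable_coeFn f)
    refine ⟨hg.toL1 g, fun φ hφ hφ1 => ?_⟩
    rw [← h φ hφ hφ1]
    exact integral_congr_ae (hg.coeFn_toL1.mono fun x hx => by
      show (hg.toL1 g) x * φ x = g x * φ x
      rw [hx])
  choose L hL using hex
  have hint : ∀ f : UnitAddCircle →₁[volume] ℝ, Integrable f := L1.integrable_coeFn
  have hm : ∀ (f : UnitAddCircle →₁[volume] ℝ) (φ : UnitAddCircle → ℝ), Measurable φ →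
      (∀ x, |φ x| ≤ 1) → Integrable fun x => f x * φ x := fun f φ hφ hφ1 =>
    integrable_mul_of_abs_le (hint f) hφ hφ1
  have hadd : ∀ f g, L (f + g) = L f + L g := by
    intro f g
    refine Lp.ext ((ae_eq_of_forall_integral_mul (hint _) ((hint (L f)).add (hint (L g)))
      fun φ hφ hφ1 => ?_).trans (Lp.coeFn_add _ _).symm)
    have hφT : Measurable fun x => φ (T x) := hφ.comp hT
    simp only [Pi.add_apply, add_mul]
    rw [integral_add (hm _ _ hφ hφ1) (hm _ _ hφ hφ1), hL _ _ hφ hφ1, hL _ _ hφ hφ1, hL _ _ hφ hφ1,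
      ← integral_add (hm _ _ hφT fun x => hφ1 _) (hm _ _ hφT fun x => hφ1 _)]
    refine integral_congr_ae ?_
    filter_upwards [Lp.coeFn_add f g] with x hx
    rw [hx, Pi.add_apply, add_mul]
  have hsmul : ∀ (c : ℝ) f, L (c • f) = c • L f := by
    intro c f
    refine Lp.ext ((ae_eq_of_forall_integral_mul (hint _) ((hint (L f)).const_mul c)
      fun φ hφ hφ1 => ?_).trans ?_)
    · simp only [mul_assoc]
      rw [hL _ _ hφ hφ1, integral_const_mul, hL _ _ hφ hφ1, ← integral_const_mul]
      refine integral_congr_ae ?_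
      filter_upwards [Lp.coeFn_smul c f] with x hx
      rw [hx, Pi.smul_apply, smul_eq_mul, mul_assoc]
    · filter_upwards [Lp.coeFn_smul c (L f)] with x hx
      rw [hx, Pi.smul_apply, smul_eq_mul]
  have hnorm : ∀ f, ‖L f‖ ≤ 1 * ‖f‖ := by
    intro f
    rw [one_mul, L1_norm_eq, L1_norm_eq]
    refine integral_abs_le_of_forall_continuous (hint _) fun φ hφ hφ1 => ?_
    rw [hL _ _ hφ.measurable hφ1]
    refine integral_mono (hm _ _ (hφ.measurable.comp hT) fun x => hφ1 _) (hint f).abs fun x => ?_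
    refine (le_abs_self _).trans ?_
    rw [abs_mul]
    exact mul_le_of_le_one_right (abs_nonneg _) (hφ1 _)
  refine ⟨LinearMap.mkContinuous ⟨⟨L, hadd⟩, hsmul⟩ 1 hnorm, ⟨fun f φ hφ C hC => ?_, fun f => ?_⟩⟩
  · show ∫ x, L f x * φ x = _
    have hD : 0 < |C| + 1 := by positivity
    have h1 := hL f (fun x => (|C| + 1)⁻¹ * φ x) (hφ.const_mul _) fun x => by
      rw [abs_mul, abs_of_pos (inv_pos.2 hD), inv_mul_le_iff₀ hD]
      linarith [hC x, le_abs_self C]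
    have h2 : ∀ a b : ℝ, a * ((|C| + 1)⁻¹ * b) = (|C| + 1)⁻¹ * (a * b) := fun a b => by ring
    simp_rw [h2, integral_const_mul] at h1
    exact mul_left_cancel₀ (inv_pos.2 hD).ne' h1
  · have := hnorm f
    rwa [one_mul] at this

theorem isInvariantDensity_iff (hT : Measurable T) {h : UnitAddCircle → ℝ}
    (hh : IsProbabilityDensity h) : IsInvariantDensity T h ↔
      ∀ φ : UnitAddCircle → ℝ, Measurable φ → ∀ C, (∀ x, |φ x| ≤ C) →
        ∫ x, h x * φ (T x) = ∫ x, h x * φ x := by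
  have hfin := integrable_ofReal_withDensity_finite hh.integrable
  constructor
  · rintro ⟨-, hinv⟩ φ hφ C hC
    have h1 := integral_map (μ := densityMeasure h) hT.aemeasurable hφ.aestronglyMeasurable
    rw [hinv, integral_densityMeasure hh.integrable hh.nonneg,
      integral_densityMeasure hh.integrable hh.nonneg] at h1
    exact h1.symm
  · refine fun hφ => ⟨hh, Measure.ext fun A hA => ?_⟩
    rw [Measure.map_apply hT hA, densityMeasure_apply hh.integrable hh.nonneg (hT hA),
      densityMeasure_apply hh.integrable hh.nonneg hA]
    have h1 := hφ (A.indicator fun _ => 1) (measurable_const.indicator hA) 1 fun x => by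
      by_cases hx : x ∈ A <;> simp [hx]
    rw [← integral_indicator hA, ← integral_indicator (hT hA)]
    congr 1
    refine Eq.trans ?_ (h1.trans ?_) <;> congr 1 <;> ext x
    · by_cases hx : T x ∈ A <;> simp [hx, indicator]
    · by_cases hx : x ∈ A <;> simp [hx, indicator]

end Transfer

/-! ### Contraction of averages of the transfer operator -/

theorem testPair_zero : TestPair (fun _ => 0) fun _ => 0 where
  cont := continuous_const
  meas := measurable_const
  bdd := ⟨0, by simp⟩
  hasDeriv := ⟨∅, countable_empty, fun _ _ => hasDerivAt_const _ _⟩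

theorem abs_integral_mul_sub_le (f g : UnitAddCircle →₁[volume] ℝ) {φ : UnitAddCircle → ℝ}
    (hφ : Measurable φ) {C : ℝ} (hC : ∀ x, |φ x| ≤ C) :
    |(∫ x, f x * φ x) - ∫ x, g x * φ x| ≤ C * ‖f - g‖ := by
  rw [← integral_sub (integrable_mul_of_abs_le (L1.integrable_coeFn f) hφ hC)
    (integrable_mul_of_abs_le (L1.integrable_coeFn g) hφ hC), L1_norm_eq, ← integral_const_mul]
  refine abs_integral_le_integral_abs.trans (integral_mono_ae ?_ ?_ ?_)
  · exact ((integrable_mul_of_abs_le (L1.integrable_coeFn f) hφ hC).sub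
      (integrable_mul_of_abs_le (L1.integrable_coeFn g) hφ hC)).abs
  · exact (L1.integrable_coeFn _).abs.const_mul C
  · filter_upwards [Lp.coeFn_sub f g] with x hx
    rw [hx, Pi.sub_apply, ← sub_mul, abs_mul, mul_comm]
    exact mul_le_mul_of_nonneg_right (hC x) (abs_nonneg _)

theorem tendsto_integral_mul {l : Filter ℕ} {f : ℕ → UnitAddCircle →₁[volume] ℝ}
    {u : UnitAddCircle →₁[volume] ℝ} (h : Tendsto f l (𝓝 u)) {φ : UnitAddCircle → ℝ}
    (hφ : Measurable φ) {C : ℝ} (hC : ∀ x, |φ x| ≤ C) :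
    Tendsto (fun m => ∫ x, f m x * φ x) l (𝓝 (∫ x, u x * φ x)) := by
  rw [tendsto_iff_dist_tendsto_zero]
  have h1 : Tendsto (fun m => C * ‖f m - u‖) l (𝓝 0) := by
    simpa using (tendsto_iff_norm_sub_tendsto_zero.1 h).const_mul C
  exact squeeze_zero (fun _ => dist_nonneg) (fun m => abs_integral_mul_sub_le _ _ hφ hC) h1

theorem varLE_of_tendsto {W : UnitAddCircle → ℝ} {K : ℝ} {l : Filter ℕ} [l.NeBot]
    {f : ℕ → UnitAddCircle →₁[volume] ℝ} {u : UnitAddCircle →₁[volume] ℝ} (h : Tendsto f l (𝓝 u))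
    (hf : ∀ m, VarLE W (f m) K) : VarLE W u K := by
  intro Φ φ hp hΦ
  obtain ⟨C, hC⟩ := hp.bdd
  exact le_of_tendsto' (tendsto_integral_mul h hp.meas hC) fun m => hf m Φ φ hp hΦ

theorem VarLE.nonneg {W f : UnitAddCircle → ℝ} {K : ℝ} (hf : VarLE W f K) (hW : ∀ x, 1 ≤ W x) :
    0 ≤ K := by
  simpa using hf _ _ testPair_zero fun x => by rw [abs_zero]; linarith [hW x]

theorem VarLE.add_L1 {W : UnitAddCircle → ℝ} {f g : UnitAddCircle →₁[volume] ℝ} {K K' : ℝ}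
    (hf : VarLE W f K) (hg : VarLE W g K') : VarLE W (f + g : UnitAddCircle →₁[volume] ℝ) (K + K') :=
  (hf.add hg (L1.integrable_coeFn f) (L1.integrable_coeFn g)).congr_ae (Lp.coeFn_add f g).symm

theorem VarLE.smul_L1 {W : UnitAddCircle → ℝ} {f : UnitAddCircle →₁[volume] ℝ} {K : ℝ}
    (hf : VarLE W f K) (c : ℝ) : VarLE W (c • f : UnitAddCircle →₁[volume] ℝ) (|c| * K) :=
  (hf.const_mul c).congr_ae (Lp.coeFn_smul c f).symm

theorem varLE_zero_L1 (W : UnitAddCircle → ℝ) : VarLE W (0 : UnitAddCircle →₁[volume] ℝ) 0 := by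
  have h : VarLE W (fun _ => 0) 0 := fun Φ φ _ _ => by simp
  exact h.congr_ae (Lp.coeFn_zero ℝ 1 volume).symm

theorem VarLE.sum_L1 {W : UnitAddCircle → ℝ} {f : ℕ → UnitAddCircle →₁[volume] ℝ} {K : ℕ → ℝ}
    (N : ℕ) (hf : ∀ j < N, VarLE W (f j) (K j)) :
    VarLE W (∑ j ∈ Finset.range N, f j : UnitAddCircle →₁[volume] ℝ) (∑ j ∈ Finset.range N, K j) := by
  induction N with
  | zero => simpa using varLE_zero_L1 W
  | succ N ih =>
    rw [Finset.sum_range_succ, Finset.sum_range_succ]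
    exact (ih fun j hj => hf j (by omega)).add_L1 (hf N (Nat.lt_succ_self N))

theorem integral_L1_sub (f g : UnitAddCircle →₁[volume] ℝ) :
    ∫ x, (f - g : UnitAddCircle →₁[volume] ℝ) x = (∫ x, f x) - ∫ x, g x := by
  rw [← integral_sub (L1.integrable_coeFn f) (L1.integrable_coeFn g)]
  exact integral_congr_ae (Lp.coeFn_sub f g)

section Average

variable {T : UnitAddCircle → UnitAddCircle}
  {L : (UnitAddCircle →₁[volume] ℝ) →L[ℝ] (UnitAddCircle →₁[volume] ℝ)}

theorem IsTransferOperator.integral_eq (hL : IsTransferOperator T L)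
    (f : UnitAddCircle →₁[volume] ℝ) : ∫ x, L f x = ∫ x, f x := by
  simpa using hL.integral_mul f (fun _ => 1) measurable_const 1 (by simp)

theorem IsTransferOperator.pow_norm_le (hL : IsTransferOperator T L)
    (f : UnitAddCircle →₁[volume] ℝ) (j : ℕ) : ‖(L ^ j) f‖ ≤ ‖f‖ := by
  induction j with
  | zero => simp
  | succ j ih =>
    rw [pow_succ', mul_apply_eq_comp]
    exact (hL.norm_le _).trans ih

theorem IsTransferOperator.pow_integral_eq (hL : IsTransferOperator T L)
    (f : UnitAddCircle →₁[volume] ℝ) (j : ℕ) : ∫ x, (L ^ j) f x = ∫ x, f x := by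
  induction j with
  | zero => simp
  | succ j ih =>
    rw [pow_succ', mul_apply_eq_comp, hL.integral_eq, ih]

/-- The average of the first `N` iterates of `L`. -/
def average (L : (UnitAddCircle →₁[volume] ℝ) →L[ℝ] (UnitAddCircle →₁[volume] ℝ)) (N : ℕ)
    (f : UnitAddCircle →₁[volume] ℝ) : UnitAddCircle →₁[volume] ℝ :=
  (N : ℝ)⁻¹ • ∑ j ∈ Finset.range N, (L ^ j) f

theorem average_smul (N : ℕ) (c : ℝ) (f : UnitAddCircle →₁[volume] ℝ) :
    average L N (c • f) = c • average L N f := by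
  simp only [average, map_smul, ← Finset.smul_sum]
  exact smul_comm _ _ _

theorem average_sub (N : ℕ) (f g : UnitAddCircle →₁[volume] ℝ) :
    average L N (f - g) = average L N f - average L N g := by
  simp only [average, map_sub, Finset.sum_sub_distrib, smul_sub]

theorem IsTransferOperator.average_norm_le (hL : IsTransferOperator T L) {N : ℕ} (hN : 0 < N)
    (f : UnitAddCircle →₁[volume] ℝ) : ‖average L N f‖ ≤ ‖f‖ := by
  have hN0 : (0 : ℝ) < N := Nat.cast_pos.2 hN
  rw [average, norm_smul, Real.norm_eq_abs, abs_of_pos (inv_pos.2 hN0), inv_mul_le_iff₀ hN0]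
  refine (norm_sum_le _ _).trans ((Finset.sum_le_sum fun j _ => hL.pow_norm_le f j).trans ?_)
  simp

theorem IsTransferOperator.average_integral (hL : IsTransferOperator T L) {N : ℕ} (hN : 0 < N)
    (f : UnitAddCircle →₁[volume] ℝ) : ∫ x, average L N f x = ∫ x, f x := by
  have hN0 : (N : ℝ) ≠ 0 := (Nat.cast_pos.2 hN).ne'
  have h1 : ∀ m, ∫ x, (∑ j ∈ Finset.range m, (L ^ j) f : UnitAddCircle →₁[volume] ℝ) x =
      m * ∫ x, f x := by
    intro m
    induction m with
    | zero =>
      rw [Finset.range_zero, Finset.sum_empty, integral_congr_ae (Lp.coeFn_zero ℝ 1 volume)]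
      simp
    | succ m ih =>
      rw [Finset.sum_range_succ, integral_congr_ae (Lp.coeFn_add _ _)]
      simp only [Pi.add_apply]
      rw [integral_add (L1.integrable_coeFn _) (L1.integrable_coeFn _), ih, hL.pow_integral_eq]
      push_cast; ring
  rw [average, integral_congr_ae (Lp.coeFn_smul _ _)]
  simp only [Pi.smul_apply, smul_eq_mul]
  rw [integral_const_mul, h1, ← mul_assoc, inv_mul_cancel₀ hN0, one_mul]

theorem IsTransferOperator.norm_map_average_sub_le (hL : IsTransferOperator T L) {N : ℕ}
    (hN : 0 < N) (f : UnitAddCircle →₁[volume] ℝ) :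
    ‖L (average L N f) - average L N f‖ ≤ 2 * ‖f‖ / N := by
  have hN0 : (0 : ℝ) < N := Nat.cast_pos.2 hN
  have h1 : L (average L N f) - average L N f = (N : ℝ)⁻¹ • ((L ^ N) f - f) := by
    have h2 : ∀ m, L (∑ j ∈ Finset.range m, (L ^ j) f) - ∑ j ∈ Finset.range m, (L ^ j) f =
        (L ^ m) f - f := by
      intro m
      induction m with
      | zero => simp
      | succ m ih =>
        rw [Finset.sum_range_succ, map_add, pow_succ', mul_apply_eq_comp,
          add_sub_add_comm, ih]
        abel
    rw [average, map_smul, ← smul_sub, h2]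
  rw [h1, norm_smul, Real.norm_eq_abs, abs_of_pos (inv_pos.2 hN0), inv_mul_le_iff₀ hN0,
    mul_div_cancel₀ _ hN0.ne']
  have := norm_sub_le ((L ^ N) f) f
  linarith [hL.pow_norm_le f N]

theorem IsTransferOperator.norm_sub_average_le (hL : IsTransferOperator T L) {N : ℕ}
    (hN : 0 < N) (f : UnitAddCircle →₁[volume] ℝ) :
    ‖f - average L N f‖ ≤ N * ‖f - L f‖ := by
  have hN0 : (0 : ℝ) < N := Nat.cast_pos.2 hN
  have h1 : ∀ j : ℕ, ‖f - (L ^ j) f‖ ≤ j * ‖f - L f‖ := by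
    intro j
    induction j with
    | zero => simp
    | succ j ih =>
      have h2 : f - (L ^ (j + 1)) f = (f - (L ^ j) f) + (L ^ j) (f - L f) := by
        rw [map_sub, ← mul_apply_eq_comp, ← pow_succ]; abel
      rw [h2]
      refine (norm_add_le _ _).trans ?_
      rw [Nat.cast_succ]
      linarith [hL.pow_norm_le (f - L f) j]
  have h3 : f - average L N f = (N : ℝ)⁻¹ • ∑ j ∈ Finset.range N, (f - (L ^ j) f) := by
    rw [Finset.sum_sub_distrib, smul_sub, average, Finset.sum_const, Finset.card_range,
      ← Nat.cast_smul_eq_nsmul ℝ, smul_smul, inv_mul_cancel₀ hN0.ne', one_smul]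
  rw [h3, norm_smul, Real.norm_eq_abs, abs_of_pos (inv_pos.2 hN0), inv_mul_le_iff₀ hN0]
  refine (norm_sum_le _ _).trans ?_
  calc ∑ j ∈ Finset.range N, ‖f - (L ^ j) f‖ ≤ ∑ j ∈ Finset.range N, N * ‖f - L f‖ := by
        refine Finset.sum_le_sum fun j hj => (h1 j).trans ?_
        have : (j : ℝ) ≤ N := by exact_mod_cast (Finset.mem_range.1 hj).le
        exact mul_le_mul_of_nonneg_right this (norm_nonneg _)
    _ = N * (N * ‖f - L f‖) := by simp

variable {W : UnitAddCircle → ℝ} {α B : ℝ}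

theorem IsTransferOperator.varLE_pow (hL : IsTransferOperator T L) (hα1 : α < 1)
    (hB : 0 ≤ B) (hLY : ∀ (f : UnitAddCircle →₁[volume] ℝ) K, VarLE W f K →
      VarLE W (L f) (α * K + B * ‖f‖)) {f : UnitAddCircle →₁[volume] ℝ} {K : ℝ} (hf : VarLE W f K)
    (j : ℕ) : VarLE W ((L ^ j) f) (α ^ j * K + B / (1 - α) * ‖f‖) := by
  have h1α : 0 < 1 - α := by linarith
  induction j with
  | zero =>
    simp only [pow_zero, one_mul, one_apply_eq_self]
    refine hf.mono ?_
    have : 0 ≤ B / (1 - α) * ‖f‖ := by positivity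
    linarith
  | succ j ih =>
    rw [pow_succ' L, mul_apply_eq_comp]
    refine (hLY _ _ ih).mono ?_
    have h2 : B * ‖(L ^ j) f‖ ≤ B * ‖f‖ := mul_le_mul_of_nonneg_left (hL.pow_norm_le f j) hB
    have h3 : α * (B / (1 - α) * ‖f‖) + B * ‖f‖ = B / (1 - α) * ‖f‖ := by field_simp; ring
    have h4 : α * (α ^ j * K + B / (1 - α) * ‖f‖) = α ^ (j + 1) * K + α * (B / (1 - α) * ‖f‖) := by
      rw [pow_succ]; ring
    linarith

theorem IsTransferOperator.varLE_average (hL : IsTransferOperator T L) (hα0 : 0 < α) (hα1 : α < 1)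
    (hB : 0 ≤ B) (hLY : ∀ (f : UnitAddCircle →₁[volume] ℝ) K, VarLE W f K →
      VarLE W (L f) (α * K + B * ‖f‖)) {f : UnitAddCircle →₁[volume] ℝ} {K : ℝ} (hK : 0 ≤ K)
    (hf : VarLE W f K) {N : ℕ} (hN : 0 < N) :
    VarLE W (average L N f) (K / (N * (1 - α)) + B / (1 - α) * ‖f‖) := by
  have hN0 : (0 : ℝ) < N := Nat.cast_pos.2 hN
  have h1α : 0 < 1 - α := by linarith
  have h1 := (VarLE.sum_L1 N fun j _ => hL.varLE_pow hα1 hB hLY hf j).smul_L1 (N : ℝ)⁻¹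
  refine VarLE.mono h1 ?_
  rw [abs_of_pos (inv_pos.2 hN0), inv_mul_le_iff₀ hN0, Finset.sum_add_distrib, ← Finset.sum_mul]
  have h2 : ∑ j ∈ Finset.range N, α ^ j ≤ (1 - α)⁻¹ := by
    rw [← tsum_geometric_of_lt_one hα0.le hα1]
    exact (summable_geometric_of_lt_one hα0.le hα1).sum_le_tsum _ fun _ _ => by positivity
  have h3 : (∑ j ∈ Finset.range N, α ^ j) * K ≤ (1 - α)⁻¹ * K := mul_le_mul_of_nonneg_right h2 hK
  have h4 : (N : ℝ) * (K / (N * (1 - α)) + B / (1 - α) * ‖f‖) =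
      (1 - α)⁻¹ * K + N * (B / (1 - α) * ‖f‖) := by field_simp
  rw [h4]
  simp only [Finset.sum_const, Finset.card_range, nsmul_eq_mul]
  linarith

theorem IsTransferOperator.eventually_average_small (hL : IsTransferOperator T L) (hα0 : 0 < α)
    (hα1 : α < 1) (hB : 0 ≤ B) (hW : ∀ x, 1 ≤ W x)
    (hLY : ∀ (f : UnitAddCircle →₁[volume] ℝ) K, VarLE W f K → VarLE W (L f) (α * K + B * ‖f‖))
    (huniq : ∀ u, L u = u → ∫ x, u x = 0 → u = 0) {η : ℝ} (hη : 0 < η) :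
    ∀ᶠ N in atTop, ∀ f : UnitAddCircle →₁[volume] ℝ, ∫ x, f x = 0 → ‖f‖ ≤ 1 → VarLE W f 1 →
      ‖average L N f‖ ≤ η := by
  by_contra hcon
  obtain ⟨N, hNmono, hN⟩ := extraction_of_frequently_atTop
    ((not_eventually.1 hcon).and_eventually (eventually_gt_atTop 0))
  have hNpos : ∀ m, 0 < N m := fun m => (hN m).2
  have hN' : ∀ m, ∃ f : UnitAddCircle →₁[volume] ℝ, ∫ x, f x = 0 ∧ ‖f‖ ≤ 1 ∧ VarLE W f 1 ∧
      η < ‖average L (N m) f‖ := fun m => by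
    have := (hN m).1
    push Not at this
    exact this
  choose f hf0 hf1 hfv hfη using hN'
  set U : Ultrafilter ℕ := hyperfilter ℕ
  have hU : (U : Filter ℕ) ≤ atTop := Nat.hyperfilter_le_atTop
  have h1α : 0 < 1 - α := by linarith
  obtain ⟨u, hu⟩ := exists_tendsto_of_varLE hW (fun m => average L (N m) (f m))
    (K := 1 / (1 - α) + B / (1 - α)) (A := 1)
    (fun m => (hL.varLE_average hα0 hα1 hB hLY zero_le_one (hfv m) (hNpos m)).mono (by
      have h1 : (1 : ℝ) ≤ N m := by exact_mod_cast hNpos m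
      have h2 : 1 / ((N m : ℝ) * (1 - α)) ≤ 1 / (1 - α) :=
        one_div_le_one_div_of_le h1α (by nlinarith)
      have h3 : B / (1 - α) * ‖f m‖ ≤ B / (1 - α) := mul_le_of_le_one_right (by positivity) (hf1 m)
      linarith))
    (fun m => (hL.average_norm_le (hNpos m) _).trans (hf1 m)) U
  have hLu : L u = u := by
    have h1 : Tendsto (fun m => ‖L (average L (N m) (f m)) - average L (N m) (f m)‖) (U : Filter ℕ)
        (𝓝 ‖L u - u‖) := (((L.continuous.tendsto u).comp hu).sub hu).norm
    have h2 : Tendsto (fun m => 2 / (N m : ℝ)) (U : Filter ℕ) (𝓝 0) :=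
      (tendsto_const_nhds.div_atTop (tendsto_natCast_atTop_atTop.comp hNmono.tendsto_atTop)).mono_left hU
    have h3 := le_of_tendsto_of_tendsto' h1 h2 fun m =>
      (hL.norm_map_average_sub_le (hNpos m) (f m)).trans (by
        have := hf1 m
        have : (0 : ℝ) < N m := Nat.cast_pos.2 (hNpos m)
        gcongr
        linarith)
    exact sub_eq_zero.1 (norm_le_zero_iff.1 h3)
  have hu0 : ∫ x, u x = 0 := by
    have h1 := tendsto_integral_mul hu (φ := fun _ => 1) measurable_const (C := 1) (by simp)
    simp only [mul_one] at h1
    refine tendsto_nhds_unique h1 (tendsto_const_nhds.congr fun m => ?_)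
    rw [hL.average_integral (hNpos m), hf0 m]
  have h1 : η ≤ ‖u‖ := ge_of_tendsto' hu.norm fun m => (hfη m).le
  rw [huniq u hLu hu0, norm_zero] at h1
  linarith

theorem IsTransferOperator.exists_average_contraction (hL : IsTransferOperator T L) (hα0 : 0 < α)
    (hα1 : α < 1) (hB : 0 ≤ B) (hW : ∀ x, 1 ≤ W x)
    (hLY : ∀ (f : UnitAddCircle →₁[volume] ℝ) K, VarLE W f K → VarLE W (L f) (α * K + B * ‖f‖))
    (huniq : ∀ u, L u = u → ∫ x, u x = 0 → u = 0) :
    ∃ N : ℕ, 0 < N ∧ ∀ (f : UnitAddCircle →₁[volume] ℝ) K, ∫ x, f x = 0 → ‖f‖ ≤ K → VarLE W f K →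
      ‖average L N (average L N f)‖ ≤ K / 2 ∧ VarLE W (average L N (average L N f)) (K / 2) := by
  have h1α : 0 < 1 - α := by linarith
  set B' := B / (1 - α) with hB'
  have hB'0 : 0 ≤ B' := by positivity
  set η : ℝ := 1 / (4 * (B' + 1)) with hη
  have hη0 : 0 < η := by positivity
  have hη4 : η ≤ 1 / 4 := by
    rw [hη, div_le_div_iff₀ (by positivity) (by positivity)]; linarith
  have hηB : B' * η ≤ 1 / 4 := by
    rw [hη, mul_one_div, div_le_div_iff₀ (by positivity) (by positivity)]; linarith
  obtain ⟨N₀, hN₀⟩ := exists_nat_gt (4 * (1 + B') / (1 - α))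
  obtain ⟨N, hNη, hNN, hNpos⟩ := ((hL.eventually_average_small hα0 hα1 hB hW hLY huniq hη0).and
    ((eventually_ge_atTop N₀).and (eventually_gt_atTop 0))).exists
  have hN0 : (0 : ℝ) < N := Nat.cast_pos.2 hNpos
  have hbig : 4 * (1 + B') ≤ N * (1 - α) := by
    have h1 : (N₀ : ℝ) ≤ N := by exact_mod_cast hNN
    have h2 := hN₀.le.trans h1
    rwa [div_le_iff₀ h1α] at h2
  have key : ∀ f : UnitAddCircle →₁[volume] ℝ, ∫ x, f x = 0 → ‖f‖ ≤ 1 → VarLE W f 1 →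
      ‖average L N (average L N f)‖ ≤ 1 / 2 ∧ VarLE W (average L N (average L N f)) (1 / 2) := by
    intro f hf0 hf1 hfv
    have h1 := hNη f hf0 hf1 hfv
    have hpos : 0 < (N : ℝ) * (1 - α) := by positivity
    have h2 : VarLE W (average L N f) (1 + B') :=
      (hL.varLE_average hα0 hα1 hB hLY zero_le_one hfv hNpos).mono (by
        have h3 : 1 / ((N : ℝ) * (1 - α)) ≤ 1 := by
          rw [div_le_one hpos]; linarith
        have h4 : B' * ‖f‖ ≤ B' := mul_le_of_le_one_right hB'0 hf1
        linarith)
    refine ⟨(hL.average_norm_le hNpos _).trans (by linarith), ?_⟩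
    refine (hL.varLE_average hα0 hα1 hB hLY (by positivity) h2 hNpos).mono ?_
    have h5 : (1 + B') / ((N : ℝ) * (1 - α)) ≤ 1 / 4 := by
      rw [div_le_div_iff₀ hpos (by norm_num)]; linarith
    have h6 : B' * ‖average L N f‖ ≤ B' * η := mul_le_mul_of_nonneg_left h1 hB'0
    linarith
  refine ⟨N, hNpos, fun f K hf0 hfK hfv => ?_⟩
  have hK : 0 ≤ K := (norm_nonneg f).trans hfK
  rcases hK.eq_or_lt with h0 | hKpos
  · have : f = 0 := norm_le_zero_iff.1 (h0 ▸ hfK)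
    have h1 : average L N (average L N f) = 0 := by simp [this, average]
    rw [h1, ← h0]
    exact ⟨by simp, by simpa using varLE_zero_L1 W⟩
  · have h1 := key (K⁻¹ • f) (by
        rw [integral_congr_ae (Lp.coeFn_smul _ _)]
        simp only [Pi.smul_apply, smul_eq_mul]
        rw [integral_const_mul, hf0, mul_zero])
      (by
        rw [norm_smul, Real.norm_eq_abs, abs_of_pos (inv_pos.2 hKpos), inv_mul_le_iff₀ hKpos, mul_one]
        exact hfK)
      ((hfv.smul_L1 K⁻¹).mono (by
        rw [abs_of_pos (inv_pos.2 hKpos), inv_mul_cancel₀ hKpos.ne']))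
    rw [average_smul, average_smul] at h1
    constructor
    · have h2 := h1.1
      rw [norm_smul, Real.norm_eq_abs, abs_of_pos (inv_pos.2 hKpos), inv_mul_le_iff₀ hKpos] at h2
      linarith
    · have h2 := h1.2.smul_L1 K
      rw [smul_smul, mul_inv_cancel₀ hKpos.ne', one_smul] at h2
      exact h2.mono (by rw [abs_of_pos hKpos]; linarith)

theorem IsTransferOperator.exists_norm_le (hL : IsTransferOperator T L) (hα0 : 0 < α)
    (hα1 : α < 1) (hB : 0 ≤ B) (hW : ∀ x, 1 ≤ W x)
    (hLY : ∀ (f : UnitAddCircle →₁[volume] ℝ) K, VarLE W f K → VarLE W (L f) (α * K + B * ‖f‖))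
    (huniq : ∀ u, L u = u → ∫ x, u x = 0 → u = 0) :
    ∃ A : ℝ, 0 ≤ A ∧ ∀ (f : UnitAddCircle →₁[volume] ℝ) K, ∫ x, f x = 0 → ‖f‖ ≤ K → VarLE W f K →
      ∀ m : ℕ, ‖f‖ ≤ K / 2 ^ m + m * A * ‖f - L f‖ := by
  obtain ⟨N, hN, hcon⟩ := hL.exists_average_contraction hα0 hα1 hB hW hLY huniq
  refine ⟨2 * N, by positivity, fun f K hf0 hfK hfv m => ?_⟩
  set Q : (UnitAddCircle →₁[volume] ℝ) → UnitAddCircle →₁[volume] ℝ :=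
    fun f => average L N (average L N f) with hQ
  have hQsub : ∀ f g, Q (f - g) = Q f - Q g := fun f g => by
    simp only [hQ, average_sub]
  have hQn : ∀ f, ‖Q f‖ ≤ ‖f‖ := fun f =>
    (hL.average_norm_le hN _).trans (hL.average_norm_le hN _)
  have hdiff : ‖f - Q f‖ ≤ 2 * N * ‖f - L f‖ := by
    have h1 : f - Q f = (f - average L N f) + average L N (f - average L N f) := by
      simp only [hQ, average_sub]; abel
    rw [h1]
    refine (norm_add_le _ _).trans ?_
    have h2 := hL.average_norm_le hN (f - average L N f)
    have h3 := hL.norm_sub_average_le hN f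
    linarith
  have hQm : ∀ m, ∫ x, (Q^[m] f) x = 0 ∧ ‖Q^[m] f‖ ≤ K / 2 ^ m ∧ VarLE W (Q^[m] f) (K / 2 ^ m) := by
    intro m
    induction m with
    | zero => exact ⟨hf0, by simpa using hfK, by simpa using hfv⟩
    | succ m ih =>
      rw [Function.iterate_succ_apply', pow_succ, ← div_div]
      refine ⟨?_, hcon _ _ ih.1 ih.2.1 ih.2.2⟩
      rw [hL.average_integral hN, hL.average_integral hN, ih.1]
  have hstep : ∀ m, ‖Q^[m] f - Q^[m + 1] f‖ ≤ ‖f - Q f‖ := by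
    intro m
    induction m with
    | zero => simp
    | succ m ih =>
      rw [Function.iterate_succ_apply' Q (m + 1), Function.iterate_succ_apply' Q m, ← hQsub]
      refine (hQn _).trans ?_
      rw [← Function.iterate_succ_apply' Q m]
      exact ih
  have htel : ∀ m : ℕ, ‖f‖ ≤ ‖Q^[m] f‖ + m * ‖f - Q f‖ := by
    intro m
    induction m with
    | zero => simp
    | succ m ih =>
      have h1 := norm_le_norm_add_norm_sub' (Q^[m] f) (Q^[m + 1] f)
      have h2 := hstep m
      push_cast
      linarith
  have h1 := htel m
  have h2 : (m : ℝ) * ‖f - Q f‖ ≤ m * (2 * N * ‖f - L f‖) :=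
    mul_le_mul_of_nonneg_left hdiff (Nat.cast_nonneg m)
  linarith [(hQm m).2.1]

end Average

/-! ### The noise kernel -/

theorem IsNoiseKernel.exists_monotone {ρ : ℝ → ℝ} (hρ : IsNoiseKernel ρ) :
    ∃ (G : ℝ → ℝ) (V : ℝ), Monotone G ∧ (∀ x, 0 ≤ G x ∧ G x ≤ V) ∧
      ∀ x y, x ≤ y → |ρ y - ρ x| ≤ G y - G x := by
  obtain ⟨p, q, hp, hq, hpq⟩ :=
    hρ.boundedVariation.locallyBoundedVariationOn.exists_monotoneOn_sub_monotoneOn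
  set cl : ℝ → ℝ := fun x => max (-1) (min 1 x) with hcl
  have hclm : Monotone cl := fun x y h => max_le_max le_rfl (min_le_min le_rfl h)
  have hcli : ∀ x, cl x ∈ Icc (-1 : ℝ) 1 := fun x =>
    ⟨le_max_left _ _, max_le (by norm_num) (min_le_left _ _)⟩
  have hcle : ∀ x ∈ Icc (-1 : ℝ) 1, cl x = x := fun x hx => by
    simp only [hcl]; rw [min_eq_right hx.2, max_eq_right hx.1]
  have hm1 : (-1 : ℝ) ∈ Icc (-1 : ℝ) 1 := by simp
  have h1 : (1 : ℝ) ∈ Icc (-1 : ℝ) 1 := by simp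
  set R : ℝ := |p (-1)| + |p 1| + |q (-1)| + |q 1| with hR
  have hR0 : 0 ≤ R := by positivity
  have hρR : ∀ x ∈ Icc (-1 : ℝ) 1, |ρ x| ≤ R := by
    intro x hx
    rw [hpq, Pi.sub_apply, abs_le]
    have a1 := hp hm1 hx hx.1
    have a2 := hp hx h1 hx.2
    have a3 := hq hm1 hx hx.1
    have a4 := hq hx h1 hx.2
    constructor <;> linarith [neg_abs_le (p (-1)), le_abs_self (p 1), neg_abs_le (q (-1)),
      le_abs_self (q 1), abs_nonneg (p 1), abs_nonneg (p (-1)), abs_nonneg (q 1), abs_nonneg (q (-1))]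
  set s₁ : ℝ → ℝ := fun x => if -1 ≤ x then R else 0 with hs₁
  set s₂ : ℝ → ℝ := fun x => if 1 < x then R else 0 with hs₂
  have hs₁m : Monotone s₁ := by
    intro x y h
    simp only [hs₁]
    split_ifs <;> linarith
  have hs₂m : Monotone s₂ := by
    intro x y h
    simp only [hs₂]
    split_ifs <;> linarith
  have hs₁b : ∀ x, 0 ≤ s₁ x ∧ s₁ x ≤ R := fun x => by
    simp only [hs₁]; split_ifs <;> constructor <;> linarith
  have hs₂b : ∀ x, 0 ≤ s₂ x ∧ s₂ x ≤ R := fun x => by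
    simp only [hs₂]; split_ifs <;> constructor <;> linarith
  have hP : Monotone fun x => p (cl x) := fun x y h => hp (hcli x) (hcli y) (hclm h)
  have hQ : Monotone fun x => q (cl x) := fun x y h => hq (hcli x) (hcli y) (hclm h)
  refine ⟨fun x => p (cl x) + q (cl x) + s₁ x + s₂ x - (p (-1) + q (-1)),
    p 1 + q 1 + 2 * R - (p (-1) + q (-1)), fun x y h => ?_, fun x => ?_, fun x y h => ?_⟩
  · have := hP h
    have := hQ h
    have := hs₁m h
    have := hs₂m h
    simp only at *
    linarith
  · have a1 := hp hm1 (hcli x) (hcli x).1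
    have a2 := hp (hcli x) h1 (hcli x).2
    have a3 := hq hm1 (hcli x) (hcli x).1
    have a4 := hq (hcli x) h1 (hcli x).2
    constructor <;> linarith [(hs₁b x).1, (hs₂b x).1, (hs₁b x).2, (hs₂b x).2]
  · have b1 := hP h
    have b2 := hQ h
    have b3 := hs₁m h
    have b4 := hs₂m h
    simp only at b1 b2
    by_cases hx : x ∈ Icc (-1 : ℝ) 1
    · by_cases hy : y ∈ Icc (-1 : ℝ) 1
      · have e1 : |ρ y - ρ x| ≤ (p y - p x) + (q y - q x) := by
          rw [hcle x hx, hcle y hy] at b1 b2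
          rw [hpq, Pi.sub_apply, Pi.sub_apply, abs_le]
          constructor <;> linarith
        have e2 := congrArg p (hcle x hx)
        have e3 := congrArg p (hcle y hy)
        have e4 := congrArg q (hcle x hx)
        have e5 := congrArg q (hcle y hy)
        linarith
      · have hy1 : 1 < y := by
          by_contra hy1
          exact hy ⟨hx.1.trans h, not_lt.1 hy1⟩
        have b5 : s₂ y = R := if_pos hy1
        have b6 : s₂ x = 0 := if_neg (not_lt.2 hx.2)
        rw [hρ.support y hy, zero_sub, abs_neg]
        linarith [hρR x hx]
    · by_cases hy : y ∈ Icc (-1 : ℝ) 1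
      · have hx1 : ¬ -1 ≤ x := fun hx1 => hx ⟨hx1, h.trans hy.2⟩
        have b5 : s₁ y = R := if_pos hy.1
        have b6 : s₁ x = 0 := if_neg hx1
        rw [hρ.support x hx, sub_zero]
        linarith [hρR y hy]
      · rw [hρ.support x hx, hρ.support y hy, sub_zero, abs_zero]
        linarith

theorem measurable_of_monotone_bound {r G : ℝ → ℝ} (hG : Monotone G)
    (h : ∀ x y, x ≤ y → |r y - r x| ≤ G y - G x) : Measurable r := by
  have h1 : Monotone fun x => r x + G x := fun x y hxy => by
    have := (abs_le.1 (h x y hxy)).1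
    show r x + G x ≤ r y + G y
    linarith
  have h2 := h1.measurable.sub hG.measurable
  have h3 : r = (fun x => r x + G x) - G := by
    ext x
    simp
  rw [h3]
  exact h2

theorem integral_abs_shift_sub_le {r G : ℝ → ℝ} {V N : ℝ} (hG : Monotone G)
    (hGV : ∀ x, 0 ≤ G x ∧ G x ≤ V) (h : ∀ x y, x ≤ y → |r y - r x| ≤ G y - G x) (hN : 0 ≤ N)
    (hsupp : ∀ x, N < |x| → r x = 0) {s : ℝ} (hs : 0 ≤ s) :
    ∫ t, |r (t + s) - r t| ≤ V * s := by
  have hr := measurable_of_monotone_bound hG h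
  have h1 : ∀ t, t ∉ Ioc (-N - s - 1) (N + 1) → |r (t + s) - r t| = 0 := by
    intro t ht
    have h2 : N < |t| ∧ N < |t + s| := by
      by_cases h3 : -N - s - 1 < t
      · have h4 : N + 1 < t := not_le.1 fun h4 => ht ⟨h3, h4⟩
        exact ⟨by linarith [le_abs_self t], by linarith [le_abs_self (t + s)]⟩
      · rw [not_lt] at h3
        exact ⟨by linarith [neg_abs_le t], by linarith [neg_abs_le (t + s)]⟩
    rw [hsupp _ h2.1, hsupp _ h2.2, sub_zero, abs_zero]
  have hab : -N - s - 1 ≤ N + 1 := by linarith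
  have hGi : ∀ a b, IntervalIntegrable G volume a b := fun a b => hG.intervalIntegrable
  have hGsi : ∀ a b, IntervalIntegrable (fun t => G (t + s)) volume a b := fun a b =>
    Monotone.intervalIntegrable fun x y hxy => hG (by linarith)
  rw [← setIntegral_eq_integral_of_forall_compl_eq_zero h1,
    ← intervalIntegral.integral_of_le hab]
  calc ∫ t in (-N - s - 1)..(N + 1), |r (t + s) - r t|
      ≤ ∫ t in (-N - s - 1)..(N + 1), (G (t + s) - G t) := by
        refine intervalIntegral.integral_mono_on hab ?_ ((hGsi _ _).sub (hGi _ _))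
          fun t _ => h t (t + s) (by linarith)
        refine ((hGsi _ _).sub (hGi _ _)).mono_fun
          (((hr.comp (measurable_id.add_const s)).sub hr).abs).aestronglyMeasurable
          (Eventually.of_forall fun t => ?_)
        simp only [Real.norm_eq_abs, abs_abs]
        exact (h t (t + s) (by linarith)).trans (le_abs_self _)
    _ = (∫ t in (N + 1)..(N + 1 + s), G t) - ∫ t in (-N - s - 1)..(-N - 1), G t := by
        rw [intervalIntegral.integral_sub (hGsi _ _) (hGi _ _),
          intervalIntegral.integral_comp_add_right]
        have e1 := intervalIntegral.integral_add_adjacent_intervals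
          (hGi (-N - s - 1) (-N - 1)) (hGi (-N - 1) (N + 1 + s))
        have e2 := intervalIntegral.integral_add_adjacent_intervals
          (hGi (-N - s - 1) (N + 1)) (hGi (N + 1) (N + 1 + s))
        have e3 : -N - s - 1 + s = -N - 1 := by ring
        rw [e3]
        linarith
    _ ≤ V * s - 0 := by
        refine sub_le_sub ?_ (intervalIntegral.integral_nonneg (by linarith) fun t _ => (hGV t).1)
        calc ∫ t in (N + 1)..(N + 1 + s), G t ≤ ∫ t in (N + 1)..(N + 1 + s), V :=
              intervalIntegral.integral_mono_on (by linarith) (hGi _ _) (by simp)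
                fun t _ => (hGV t).2
          _ = V * s := by simp [mul_comm]
    _ = V * s := sub_zero _

/-- `r` is a probability density supported in `[-δ, δ]`, bounded by `V` and of variation at most `V`. -/
structure IsScaledKernel (r : ℝ → ℝ) (δ V : ℝ) : Prop where
  meas : Measurable r
  nonneg : ∀ t, 0 ≤ r t
  le : ∀ t, r t ≤ V
  support : ∀ t, δ < |t| → r t = 0
  integral_eq_one : ∫ t, r t = 1
  shift : ∀ s, 0 ≤ s → ∫ t, |r (t + s) - r t| ≤ V * s

theorem IsScaledKernel.integrable {r : ℝ → ℝ} {δ V : ℝ} (h : IsScaledKernel r δ V) : Integrable r := by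
  by_contra hi
  have := h.integral_eq_one
  rw [integral_undef hi] at this
  norm_num at this

theorem IsNoiseKernel.isScaledKernel {ρ : ℝ → ℝ} (hρ : IsNoiseKernel ρ) {δ : ℝ} (hδ : 0 < δ) :
    ∃ V, IsScaledKernel (rescaledKernel ρ δ) δ V := by
  obtain ⟨G, V, hG, hGV, h⟩ := hρ.exists_monotone
  set r := rescaledKernel ρ δ with hr
  set G' : ℝ → ℝ := fun x => 1 / δ * G (x / δ) with hG'
  have hδ' : 0 < 1 / δ := by positivity
  have hG'm : Monotone G' := fun x y hxy =>
    mul_le_mul_of_nonneg_left (hG (div_le_div_of_nonneg_right hxy hδ.le)) hδ'.le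
  have hG'V : ∀ x, 0 ≤ G' x ∧ G' x ≤ 1 / δ * V := fun x =>
    ⟨mul_nonneg hδ'.le (hGV _).1, mul_le_mul_of_nonneg_left (hGV _).2 hδ'.le⟩
  have hrG : ∀ x y, x ≤ y → |r y - r x| ≤ G' y - G' x := by
    intro x y hxy
    have h1 := h (x / δ) (y / δ) (div_le_div_of_nonneg_right hxy hδ.le)
    simp only [hr, rescaledKernel, hG']
    rw [← mul_sub, ← mul_sub, abs_mul, abs_of_pos hδ']
    exact mul_le_mul_of_nonneg_left h1 hδ'.le
  have hsupp : ∀ t, δ < |t| → r t = 0 := by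
    intro t ht
    have : t / δ ∉ Icc (-1 : ℝ) 1 := by
      rw [mem_Icc, ← abs_le, abs_div, abs_of_pos hδ, div_le_one hδ]
      exact not_le.2 ht
    simp only [hr, rescaledKernel, hρ.support _ this, mul_zero]
  refine ⟨1 / δ * V, measurable_of_monotone_bound hG'm hrG, fun t =>
    mul_nonneg hδ'.le (hρ.nonneg _), fun t => ?_, hsupp, ?_, fun s hs =>
    integral_abs_shift_sub_le hG'm hG'V hrG hδ.le hsupp hs⟩
  · have h1 := hrG (min t (-δ - 1)) t (min_le_left _ _)
    have h2 : r (min t (-δ - 1)) = 0 := hsupp _ (by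
      have := neg_abs_le (min t (-δ - 1))
      have := min_le_right t (-δ - 1)
      linarith)
    rw [h2, sub_zero] at h1
    linarith [le_abs_self (r t), (hG'V t).2, (hG'V (min t (-δ - 1))).1]
  · simp only [hr, rescaledKernel]
    rw [integral_const_mul, Measure.integral_comp_div ρ δ, hρ.integral_eq_one, abs_of_pos hδ]
    simp [hδ.ne']

/-! ### The noise law -/

theorem noiseLaw_of_pos (ρ : ℝ → ℝ) {δ : ℝ} (hδ : 0 < δ) : noiseLaw ρ δ =
    (volume.withDensity fun x : ℝ => ENNReal.ofReal (rescaledKernel ρ δ x)).map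
      fun x : ℝ => (x : UnitAddCircle) := if_neg hδ.ne'

theorem measurable_coe_circle : Measurable fun x : ℝ => (x : UnitAddCircle) :=
  AddCircle.measurable_mk'

section Noise

variable {ρ : ℝ → ℝ} {δ V : ℝ}

theorem isProbabilityMeasure_noiseLaw (hδ : 0 < δ)
    (hr : IsScaledKernel (rescaledKernel ρ δ) δ V) : IsProbabilityMeasure (noiseLaw ρ δ) := by
  rw [noiseLaw_of_pos ρ hδ]
  have : IsProbabilityMeasure
      (volume.withDensity fun x : ℝ => ENNReal.ofReal (rescaledKernel ρ δ x)) := by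
    refine ⟨?_⟩
    rw [withDensity_apply _ MeasurableSet.univ, Measure.restrict_univ,
      ← ofReal_integral_eq_lintegral_ofReal hr.integrable (Eventually.of_forall hr.nonneg),
      hr.integral_eq_one, ENNReal.ofReal_one]
  exact Measure.isProbabilityMeasure_map measurable_coe_circle.aemeasurable

theorem integral_noiseLaw (hδ : 0 < δ) (hr : IsScaledKernel (rescaledKernel ρ δ) δ V)
    {F : UnitAddCircle → ℝ} (hF : Measurable F) :
    ∫ ω, F ω ∂(noiseLaw ρ δ) = ∫ t : ℝ, rescaledKernel ρ δ t * F t := by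
  rw [noiseLaw_of_pos ρ hδ, integral_map measurable_coe_circle.aemeasurable hF.aestronglyMeasurable,
    integral_withDensity_eq_integral_toReal_smul hr.meas.ennreal_ofReal
      (Eventually.of_forall fun x => ENNReal.ofReal_lt_top)]
  congr 1
  ext t
  rw [ENNReal.toReal_ofReal (hr.nonneg t), smul_eq_mul]

theorem integral_noiseLaw_le (hδ : 0 < δ) (hr : IsScaledKernel (rescaledKernel ρ δ) δ V)
    {F : UnitAddCircle → ℝ} (hF : Measurable F) {C b : ℝ} (hC : ∀ x, |F x| ≤ C)
    (hb : ∀ t : ℝ, |t| ≤ δ → F t ≤ b) : ∫ ω, F ω ∂(noiseLaw ρ δ) ≤ b := by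
  have hprob := isProbabilityMeasure_noiseLaw hδ hr
  have hae : ∀ᵐ ω ∂(noiseLaw ρ δ), F ω ≤ b := by
    rw [noiseLaw_of_pos ρ hδ, ae_map_iff measurable_coe_circle.aemeasurable
      (measurableSet_le hF measurable_const), ae_withDensity_iff hr.meas.ennreal_ofReal]
    refine Eventually.of_forall fun t ht => hb t (not_lt.1 fun hlt => ht ?_)
    rw [hr.support t hlt, ENNReal.ofReal_zero]
  calc ∫ ω, F ω ∂(noiseLaw ρ δ) ≤ ∫ ω, b ∂(noiseLaw ρ δ) := by
        refine integral_mono_ae ?_ (integrable_const b) hae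
        exact (integrable_const C).mono' hF.aestronglyMeasurable (Eventually.of_forall hC)
    _ = b := by simp

variable {T : UnitAddCircle → UnitAddCircle} {h : UnitAddCircle → ℝ}

theorem isProbabilityMeasure_densityMeasure (hh : IsProbabilityDensity h) :
    IsProbabilityMeasure (densityMeasure h) := by
  refine ⟨?_⟩
  rw [densityMeasure_apply hh.integrable hh.nonneg MeasurableSet.univ, Measure.restrict_univ,
    hh.integral_eq_one, ENNReal.ofReal_one]

theorem IsStationaryDensity.integral_mul_eq (hT : Measurable T) (hδ : 0 < δ)
    (hr : IsScaledKernel (rescaledKernel ρ δ) δ V) (hh : IsStationaryDensity T ρ δ h)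
    {φ : UnitAddCircle → ℝ} (hφ : Measurable φ) {C : ℝ} (hC : ∀ x, |φ x| ≤ C) :
    Measurable (fun ω => ∫ x, h x * φ (T x + ω)) ∧ (∀ ω, |∫ x, h x * φ (T x + ω)| ≤ C) ∧
      ∫ x, h x * φ x = ∫ ω, (∫ x, h x * φ (T x + ω)) ∂(noiseLaw ρ δ) := by
  have hprob := isProbabilityMeasure_noiseLaw hδ hr
  have hprob' := isProbabilityMeasure_densityMeasure hh.1
  have hprob'' : IsProbabilityMeasure ((densityMeasure h).map T) :=
    Measure.isProbabilityMeasure_map hT.aemeasurable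
  have hF : ∀ ω, ∫ y, φ (ω + y) ∂((densityMeasure h).map T) = ∫ x, h x * φ (T x + ω) := by
    intro ω
    have hm : Measurable fun y => φ (ω + y) := hφ.comp (measurable_const_add ω)
    rw [integral_map hT.aemeasurable hm.aestronglyMeasurable,
      integral_densityMeasure hh.1.integrable hh.1.nonneg]
    simp_rw [add_comm ω]
  refine ⟨?_, fun ω => ?_, ?_⟩
  · simp_rw [← hF]
    have hm : StronglyMeasurable fun p : UnitAddCircle × UnitAddCircle => φ (p.1 + p.2) :=
      (hφ.comp measurable_add).stronglyMeasurable
    exact hm.integral_prod_right'.measurable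
  · rw [← hF]
    have := norm_integral_le_of_norm_le_const (μ := (densityMeasure h).map T)
      (f := fun y => φ (ω + y)) (C := C) (Eventually.of_forall fun y => hC _)
    simpa using this
  · rw [← integral_densityMeasure hh.1.integrable hh.1.nonneg, ← hh.2, annealedTransfer, integral_conv]
    · simp_rw [hF]
    · exact (integrable_const C).mono' hφ.aestronglyMeasurable (Eventually.of_forall hC)

theorem IsStationaryDensity.integral_mul_le (hT : Measurable T) (hδ : 0 < δ)
    (hr : IsScaledKernel (rescaledKernel ρ δ) δ V) (hh : IsStationaryDensity T ρ δ h)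
    {φ : UnitAddCircle → ℝ} (hφ : Measurable φ) {C : ℝ} (hC : ∀ x, |φ x| ≤ C) {b : ℝ}
    (hb : ∀ t : ℝ, |t| ≤ δ → ∫ x, h x * φ (T x + t) ≤ b) : ∫ x, h x * φ x ≤ b := by
  obtain ⟨h1, h2, h3⟩ := hh.integral_mul_eq hT hδ hr hφ hC
  rw [h3]
  exact integral_noiseLaw_le hδ hr h1 h2 hb

end Noise

/-! ### Lipschitz densities of stationary measures -/

section Lipschitz

variable {ρ : ℝ → ℝ} {δ V : ℝ} {T : UnitAddCircle → UnitAddCircle}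

theorem noiseLaw_le (hδ : 0 < δ) (hδ1 : δ ≤ 1) (hr : IsScaledKernel (rescaledKernel ρ δ) δ V)
    {A : Set UnitAddCircle} (hA : MeasurableSet A) :
    noiseLaw ρ δ A ≤ ENNReal.ofReal V * 4 * volume A := by
  have hA' : MeasurableSet ((fun x : ℝ => (x : UnitAddCircle)) ⁻¹' A) := measurable_coe_circle hA
  have h1 : ∀ t, ENNReal.ofReal (rescaledKernel ρ δ t) ≤
      (Ioc (-2 : ℝ) 2).indicator (fun _ => ENNReal.ofReal V) t := by
    intro t
    by_cases ht : t ∈ Ioc (-2 : ℝ) 2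
    · rw [indicator_of_mem ht]
      exact ENNReal.ofReal_le_ofReal (hr.le t)
    · rw [hr.support t, ENNReal.ofReal_zero]
      · exact zero_le
      · by_contra h
        have h2 := abs_le.1 ((not_lt.1 h).trans hδ1)
        exact ht ⟨by linarith [h2.1], by linarith [h2.2]⟩
  have h2 := volume_coe_preimage_inter_le hA 2
  rw [noiseLaw_of_pos ρ hδ, Measure.map_apply measurable_coe_circle hA, withDensity_apply _ hA']
  calc ∫⁻ t in (fun x : ℝ => (x : UnitAddCircle)) ⁻¹' A, ENNReal.ofReal (rescaledKernel ρ δ t)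
      ≤ ∫⁻ t in (fun x : ℝ => (x : UnitAddCircle)) ⁻¹' A,
          (Ioc (-2 : ℝ) 2).indicator (fun _ => ENNReal.ofReal V) t := lintegral_mono h1
    _ = ENNReal.ofReal V * volume (Ioc (-2 : ℝ) 2 ∩ (fun x : ℝ => (x : UnitAddCircle)) ⁻¹' A) := by
        rw [lintegral_indicator_const measurableSet_Ioc, Measure.restrict_apply measurableSet_Ioc]
    _ ≤ ENNReal.ofReal V * (4 * volume A) := by
        refine mul_le_mul_right ?_ _
        refine le_trans (measure_mono ?_) (h2.trans (le_of_eq ?_))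
        · rintro t ⟨h3, h4⟩
          exact ⟨h4, by simpa using h3⟩
        · norm_num
    _ = _ := (mul_assoc _ _ _).symm

theorem exists_bounded_density {η : Measure UnitAddCircle} [IsFiniteMeasure η] {C : NNReal}
    (hη : ∀ A, MeasurableSet A → η A ≤ C * volume A) :
    ∃ p : UnitAddCircle → ℝ, Measurable p ∧ (∀ x, 0 ≤ p x) ∧ (∀ x, p x ≤ C) ∧
      η = volume.withDensity fun x => ENNReal.ofReal (p x) := by
  have hac : η ≪ volume := Measure.AbsolutelyContinuous.mk fun A hA h0 => by
    have := hη A hA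
    rw [h0, mul_zero] at this
    exact le_antisymm this zero_le
  have hd : volume.withDensity (η.rnDeriv volume) = η := Measure.withDensity_rnDeriv_eq _ _ hac
  have hle : η.rnDeriv volume ≤ᵐ[volume] fun _ => (C : ENNReal) := by
    refine ae_le_of_forall_setLIntegral_le_of_sigmaFinite (Measure.measurable_rnDeriv _ _) ?_
    intro A hA _
    rw [← withDensity_apply _ hA, hd, setLIntegral_const]
    exact hη A hA
  refine ⟨fun x => min (η.rnDeriv volume x).toReal C,
    (Measure.measurable_rnDeriv _ _).ennreal_toReal.min measurable_const,
    fun x => le_min ENNReal.toReal_nonneg C.2, fun x => min_le_right _ _, ?_⟩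
  conv_lhs => rw [← hd]
  refine withDensity_congr_ae ?_
  filter_upwards [hle] with x hx
  have hfin : η.rnDeriv volume x ≠ ⊤ := (hx.trans_lt ENNReal.coe_lt_top).ne
  have : (η.rnDeriv volume x).toReal ≤ C := by
    have := ENNReal.toReal_mono ENNReal.coe_ne_top hx
    simpa using this
  rw [min_eq_left this, ENNReal.ofReal_toReal hfin]

theorem exists_lipschitz_density (hT : Measurable T) {C : NNReal}
    (hC : ∀ A, MeasurableSet A → volume (T ⁻¹' A) ≤ C * volume A) (hδ : 0 < δ) (hδ1 : δ ≤ 1)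
    (hr : IsScaledKernel (rescaledKernel ρ δ) δ V) {μ : Measure UnitAddCircle}
    [IsProbabilityMeasure μ] (hμ : annealedTransfer T ρ δ μ = μ) :
    ∃ h : UnitAddCircle → ℝ, (∃ K : NNReal, LipschitzWith K h) ∧ (∀ x, 0 ≤ h x) ∧
      μ = densityMeasure h := by
  have hprob := isProbabilityMeasure_noiseLaw hδ hr
  set ν := noiseLaw ρ δ with hν
  set η := μ.map T with hη
  have hηp : IsProbabilityMeasure η := Measure.isProbabilityMeasure_map hT.aemeasurable
  have hμeq : μ = ν.conv η := hμ.symm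
  have hμle : ∀ A, MeasurableSet A → μ A ≤ ENNReal.ofReal V * 4 * volume A := by
    intro A hA
    rw [hμeq, Measure.conv_comm, ← lintegral_indicator_one hA,
      Measure.lintegral_conv (measurable_one.indicator hA)]
    calc ∫⁻ y, ∫⁻ ω, A.indicator 1 (y + ω) ∂ν ∂η
        ≤ ∫⁻ _, ENNReal.ofReal V * 4 * volume A ∂η := by
          refine lintegral_mono fun y => ?_
          have hAy : MeasurableSet ((fun ω => y + ω) ⁻¹' A) := measurable_const_add y hA
          have e1 : ∀ ω, A.indicator (1 : UnitAddCircle → ENNReal) (y + ω) =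
              ((fun ω => y + ω) ⁻¹' A).indicator 1 ω := fun ω => rfl
          simp_rw [e1]
          rw [lintegral_indicator_one hAy]
          refine (noiseLaw_le hδ hδ1 hr hAy).trans_eq ?_
          rw [measure_preimage_add]
      _ = _ := by simp
  set C₃ : NNReal := V.toNNReal * 4 * C with hC₃
  have hηle : ∀ A, MeasurableSet A → η A ≤ C₃ * volume A := by
    intro A hA
    rw [hη, Measure.map_apply hT hA]
    refine (hμle _ (hT hA)).trans ((mul_le_mul_right (hC A hA) _).trans_eq ?_)
    rw [hC₃, ← mul_assoc]
    simp [ENNReal.ofReal]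
  obtain ⟨p, hpm, hp0, hpC, hηp'⟩ := exists_bounded_density hηle
  set r := rescaledKernel ρ δ with hrdef
  set h : UnitAddCircle → ℝ := fun x => ∫ t : ℝ, r t * p (x - t) with hh
  have hshm : ∀ x : UnitAddCircle, Measurable fun t : ℝ => p (x - t) := fun x =>
    hpm.comp (measurable_const.sub measurable_coe_circle)
  have habs : ∀ x, |p x| ≤ C₃ := fun x => by rw [abs_of_nonneg (hp0 x)]; exact hpC x
  have hint : ∀ x, Integrable fun t : ℝ => r t * p (x - t) := fun x =>
    hr.integrable.mul_bdd (c := C₃) (hshm x).aestronglyMeasurable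
      (Eventually.of_forall fun t => habs _)
  have hhx : ∀ x, ENNReal.ofReal (h x) = ∫⁻ ω, ENNReal.ofReal (p (x - ω)) ∂ν := by
    intro x
    have hm : Measurable fun ω => ENNReal.ofReal (p (x - ω)) :=
      (hpm.comp (measurable_const.sub measurable_id)).ennreal_ofReal
    rw [hν, noiseLaw_of_pos ρ hδ, lintegral_map hm measurable_coe_circle,
      lintegral_withDensity_eq_lintegral_mul _ hr.meas.ennreal_ofReal
        (hshm x).ennreal_ofReal, hh, ofReal_integral_eq_lintegral_ofReal (hint x)
        (Eventually.of_forall fun t => mul_nonneg (hr.nonneg t) (hp0 _))]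
    refine lintegral_congr fun t => ?_
    rw [ENNReal.ofReal_mul (hr.nonneg t)]
    rfl
  have hV : 0 ≤ V := (hr.nonneg 0).trans (hr.le 0)
  have hstep : ∀ (x : UnitAddCircle) (s : ℝ), 0 ≤ s → |h (x + s) - h x| ≤ C₃ * V * s := by
    intro x s hs
    have hrs : Integrable fun t => r (t + s) := hr.integrable.comp_add_right s
    have e1 : h (x + s) = ∫ t : ℝ, r (t + s) * p (x - t) := by
      rw [hh]
      simp only
      rw [← integral_add_right_eq_self _ s]
      congr 1
      ext t
      congr 2
      rw [AddCircle.coe_add]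
      abel
    have hi2 : Integrable fun t : ℝ => r (t + s) * p (x - t) :=
      hrs.mul_bdd (c := C₃) (hshm x).aestronglyMeasurable (Eventually.of_forall fun t => habs _)
    rw [e1, hh]
    simp only
    rw [← integral_sub hi2 (hint x)]
    calc |∫ t : ℝ, (r (t + s) * p (x - t) - r t * p (x - t))|
        ≤ ∫ t : ℝ, |r (t + s) * p (x - t) - r t * p (x - t)| := abs_integral_le_integral_abs
      _ ≤ ∫ t : ℝ, |r (t + s) - r t| * C₃ := by
          refine integral_mono (hi2.sub (hint x)).abs ((hrs.sub hr.integrable).abs.mul_const _)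
            fun t => ?_
          simp only
          rw [← sub_mul, abs_mul]
          exact mul_le_mul_of_nonneg_left (habs _) (abs_nonneg _)
      _ = (∫ t : ℝ, |r (t + s) - r t|) * C₃ := integral_mul_const _ _
      _ ≤ (V * s) * C₃ := mul_le_mul_of_nonneg_right (hr.shift s hs) C₃.2
      _ = C₃ * V * s := by ring
  have hlip : LipschitzWith (C₃ * V.toNNReal) h := by
    refine LipschitzWith.of_dist_le_mul fun x y => ?_
    obtain ⟨s, hs, hsd⟩ := exists_real_add_eq x y
    rw [← hsd, Real.dist_eq, NNReal.coe_mul, Real.coe_toNNReal V hV]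
    rcases le_total 0 s with h0 | h0
    · rw [abs_of_nonneg h0, ← hs, abs_sub_comm]
      exact hstep x s h0
    · rw [abs_of_nonpos h0]
      have hx : x = y + ((-s : ℝ) : UnitAddCircle) := by
        rw [← hs, AddCircle.coe_neg]
        abel
      have := hstep y (-s) (by linarith)
      rwa [← hx] at this
  refine ⟨h, ⟨_, hlip⟩, fun x => integral_nonneg fun t => mul_nonneg (hr.nonneg t) (hp0 _), ?_⟩
  ext A hA
  rw [densityMeasure, withDensity_apply _ hA, ← lintegral_indicator hA, hμeq,
    ← lintegral_indicator_one hA, Measure.lintegral_conv (measurable_one.indicator hA)]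
  have hin : ∀ ω, ∫⁻ y, A.indicator (1 : UnitAddCircle → ENNReal) (ω + y) ∂η =
      ∫⁻ x, A.indicator (fun x => ENNReal.ofReal (p (x - ω))) x := by
    intro ω
    have hm : Measurable fun y => A.indicator (1 : UnitAddCircle → ENNReal) (ω + y) :=
      (measurable_one.indicator hA).comp (measurable_const_add ω)
    rw [hηp', lintegral_withDensity_eq_lintegral_mul _ hpm.ennreal_ofReal hm,
      ← lintegral_add_left_eq_self (fun x => A.indicator (fun x => ENNReal.ofReal (p (x - ω))) x) ω]
    refine lintegral_congr fun y => ?_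
    by_cases hy : ω + y ∈ A
    · simp [hy]
    · simp [hy]
  simp_rw [hin]
  rw [lintegral_lintegral_swap]
  · refine lintegral_congr fun x => ?_
    by_cases hx : x ∈ A
    · simp only [indicator_of_mem hx]
      exact (hhx x).symm
    · simp [indicator_of_notMem hx]
  · have hm : Measurable fun q : UnitAddCircle × UnitAddCircle =>
        ENNReal.ofReal (p (q.2 - q.1)) :=
      (hpm.comp (measurable_snd.sub measurable_fst)).ennreal_ofReal
    exact (hm.indicator (measurable_snd hA)).aemeasurable

end Lipschitz

/-! ### The upper bound -/

section UpperBound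

variable {T : UnitAddCircle → UnitAddCircle}

/-- `u dx` is an invariant signed measure of `T`. -/
def IsInvariantWeight (T : UnitAddCircle → UnitAddCircle) (u : UnitAddCircle → ℝ) : Prop :=
  ∀ φ : UnitAddCircle → ℝ, Measurable φ → ∀ C, (∀ x, |φ x| ≤ C) →
    ∫ x, u x * φ (T x) = ∫ x, u x * φ x

theorem IsInvariantWeight.posPart (hT : Measurable T) {u : UnitAddCircle → ℝ} (hu : Measurable u)
    (hui : Integrable u) (h : IsInvariantWeight T u) : IsInvariantWeight T fun x => max (u x) 0 := by
  have hpi : Integrable fun x => max (u x) 0 := hui.pos_part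
  set P : Set UnitAddCircle := {x | 0 < u x} with hP
  have hPm : MeasurableSet P := measurableSet_lt measurable_const hu
  have hle : ∀ φ : UnitAddCircle → ℝ, Measurable φ → ∀ C, (∀ x, |φ x| ≤ C) → (∀ x, 0 ≤ φ x) →
      ∫ x, max (u x) 0 * φ x ≤ ∫ x, max (u x) 0 * φ (T x) := by
    intro φ hφ C hC h0
    have hC' : ∀ x, |P.indicator φ x| ≤ C := fun x => by
      by_cases hx : x ∈ P
      · rw [indicator_of_mem hx]; exact hC x
      · rw [indicator_of_notMem hx, abs_zero]; exact (abs_nonneg _).trans (hC x)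
    have hle' : ∀ x, P.indicator φ x ≤ φ x := fun x => indicator_le_self' (fun _ _ => h0 _) x
    have h0' : ∀ x, 0 ≤ P.indicator φ x := fun x => indicator_nonneg (fun _ _ => h0 _) x
    calc ∫ x, max (u x) 0 * φ x = ∫ x, u x * P.indicator φ x := by
          congr 1
          ext x
          by_cases hx : 0 < u x
          · rw [max_eq_left hx.le, indicator_of_mem (show x ∈ P from hx)]
          · rw [max_eq_right (not_lt.1 hx), indicator_of_notMem (show x ∉ P from hx), zero_mul,
              mul_zero]
      _ = ∫ x, u x * P.indicator φ (T x) := (h _ (hφ.indicator hPm) C hC').symm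
      _ ≤ ∫ x, max (u x) 0 * φ (T x) := by
          refine integral_mono
            (integrable_mul_of_abs_le hui ((hφ.indicator hPm).comp hT) fun x => hC' _)
            (integrable_mul_of_abs_le hpi (hφ.comp hT) fun x => hC _) fun x => ?_
          exact (mul_le_mul_of_nonneg_right (le_max_left _ _) (h0' _)).trans
            (mul_le_mul_of_nonneg_left (hle' _) (le_max_right _ _))
  intro φ hφ C hC
  have hi1 := integrable_mul_of_abs_le hpi hφ hC
  have hi2 := integrable_mul_of_abs_le hpi (hφ.comp hT) fun x => hC (T x)
  have hb : ∀ x, 0 ≤ C + φ x ∧ 0 ≤ C - φ x := fun x => by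
    have := abs_le.1 (hC x)
    constructor <;> linarith
  have h1 := hle (fun x => C + φ x) (hφ.const_add C) (2 * C)
    (fun x => by rw [abs_of_nonneg (hb x).1]; linarith [(hb x).2]) fun x => (hb x).1
  have h2 := hle (fun x => C - φ x) (hφ.const_sub C) (2 * C)
    (fun x => by rw [abs_of_nonneg (hb x).2]; linarith [(hb x).1]) fun x => (hb x).2
  simp only [mul_add, mul_sub] at h1 h2
  simp only [Function.comp_def] at hi2
  rw [integral_add (hpi.mul_const C) hi1, integral_add (hpi.mul_const C) hi2] at h1
  rw [integral_sub (hpi.mul_const C) hi1, integral_sub (hpi.mul_const C) hi2] at h2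
  linarith

theorem IsInvariantWeight.neg {u : UnitAddCircle → ℝ} (h : IsInvariantWeight T u) :
    IsInvariantWeight T fun x => -u x := fun φ hφ C hC => by
  simp only [neg_mul, integral_neg, h φ hφ C hC]

theorem IsInvariantWeight.isInvariantDensity (hT : Measurable T) {u : UnitAddCircle → ℝ}
    (hu : Integrable u) (h0 : ∀ x, 0 ≤ u x) (h : IsInvariantWeight T u) (hc : 0 < ∫ x, u x) :
    IsInvariantDensity T fun x => (∫ y, u y)⁻¹ * u x := by
  refine (isInvariantDensity_iff hT ⟨hu.const_mul _, Eventually.of_forall fun x =>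
    mul_nonneg (inv_nonneg.2 hc.le) (h0 x), ?_⟩).2 fun φ hφ C hC => ?_
  · rw [integral_const_mul, inv_mul_cancel₀ hc.ne']
  · simp only [mul_assoc, integral_const_mul, h φ hφ C hC]

/-- If the invariant density is unique, there are no invariant weights of zero mean. -/
theorem IsInvariantWeight.ae_eq_zero (hT : Measurable T) {h₀ : UnitAddCircle → ℝ}
    (huniq : ∀ h : UnitAddCircle → ℝ, IsInvariantDensity T h → h =ᵐ[volume] h₀)
    {u : UnitAddCircle → ℝ} (hu : Measurable u) (hui : Integrable u) (h : IsInvariantWeight T u)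
    (hz : ∫ x, u x = 0) : u =ᵐ[volume] 0 := by
  have hp := h.posPart hT hu hui
  have hn := h.neg.posPart hT hu.neg hui.neg
  have hpi : Integrable fun x => max (u x) 0 := hui.pos_part
  have hni : Integrable fun x => max (-u x) 0 := hui.neg_part
  have hsub : ∀ x, u x = max (u x) 0 - max (-u x) 0 := fun x => by
    rcases le_total 0 (u x) with h0 | h0
    · rw [max_eq_left h0, max_eq_right (by linarith), sub_zero]
    · rw [max_eq_right h0, max_eq_left (by linarith)]; ring
  have heq : ∫ x, max (u x) 0 = ∫ x, max (-u x) 0 := by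
    have h1 : ∫ x, u x = (∫ x, max (u x) 0) - ∫ x, max (-u x) 0 := by
      rw [← integral_sub hpi hni]
      exact integral_congr_ae (Eventually.of_forall hsub)
    linarith
  have hp0 : ∀ x, 0 ≤ max (u x) 0 := fun x => le_max_right _ _
  have hn0 : ∀ x, 0 ≤ max (-u x) 0 := fun x => le_max_right _ _
  have hI : 0 ≤ ∫ x, max (u x) 0 := integral_nonneg fun x => hp0 x
  rcases hI.eq_or_lt with h0 | h0
  · have e1 := (integral_eq_zero_iff_of_nonneg hp0 hpi).1 h0.symm
    have e2 := (integral_eq_zero_iff_of_nonneg hn0 hni).1 (heq ▸ h0.symm)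
    filter_upwards [e1, e2] with x h1 h2
    rw [hsub x, h1, h2, sub_self]
    rfl
  · have e1 := huniq _ (hp.isInvariantDensity hT hpi hp0 h0)
    have e2 := huniq _ (hn.isInvariantDensity hT hni hn0 (heq ▸ h0))
    filter_upwards [e1, e2] with x h1 h2
    rw [← heq, ← h1] at h2
    have h3 := mul_left_cancel₀ (inv_pos.2 h0).ne' h2
    rw [hsub x, h3, sub_self]
    rfl

variable {L : (UnitAddCircle →₁[volume] ℝ) →L[ℝ] (UnitAddCircle →₁[volume] ℝ)}

theorem IsTransferOperator.map_eq_iff (hL : IsTransferOperator T L) (f : UnitAddCircle →₁[volume] ℝ) :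
    L f = f ↔ IsInvariantWeight T f := by
  constructor
  · intro h φ hφ C hC
    rw [← hL.integral_mul f φ hφ C hC, h]
  · intro h
    refine Lp.ext (ae_eq_of_forall_integral_mul (L1.integrable_coeFn _) (L1.integrable_coeFn _)
      fun φ hφ hφ1 => ?_)
    rw [hL.integral_mul f φ hφ 1 hφ1, h φ hφ 1 hφ1]

variable {W : UnitAddCircle → ℝ} {α B R : ℝ}

theorem IsTransferOperator.exists_fixed (hL : IsTransferOperator T L) (hα0 : 0 < α) (hα1 : α < 1)
    (hB : 0 ≤ B) (hW : ∀ x, 1 ≤ W x) (hWR : ∀ x, W x ≤ R)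
    (hLY : ∀ (f : UnitAddCircle →₁[volume] ℝ) K, VarLE W f K → VarLE W (L f) (α * K + B * ‖f‖)) :
    ∃ u, L u = u ∧ ∫ x, u x = 1 ∧ VarLE W u (B / (1 - α)) := by
  have hone : Integrable fun _ : UnitAddCircle => (1 : ℝ) := integrable_const 1
  set e : UnitAddCircle →₁[volume] ℝ := hone.toL1 with he
  have hee : e =ᵐ[volume] fun _ => 1 := hone.coeFn_toL1
  have hnorm : ‖e‖ = 1 := by
    rw [L1_norm_eq, integral_congr_ae (hee.mono fun x hx => show |e x| = 1 by rw [hx, abs_one])]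
    simp
  have hint : ∫ x, e x = 1 := by
    rw [integral_congr_ae hee]
    simp
  have hvar : VarLE W e 0 := by
    have := (varLE_of_lipschitz hWR (LipschitzWith.const (1 : ℝ))).congr_ae hee.symm
    simpa using this
  have hav : ∀ m : ℕ, VarLE W (average L (m + 1) e) (B / (1 - α)) := fun m => by
    have := hL.varLE_average hα0 hα1 hB hLY le_rfl hvar (Nat.succ_pos m)
    simpa [hnorm] using this
  obtain ⟨u, hu⟩ := exists_tendsto_of_varLE hW (fun m => average L (m + 1) e) hav
    (fun m => hL.average_norm_le (Nat.succ_pos m) e) (hyperfilter ℕ)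
  refine ⟨u, ?_, ?_, varLE_of_tendsto hu hav⟩
  · have h1 : Tendsto (fun m : ℕ => L (average L (m + 1) e) - average L (m + 1) e) (hyperfilter ℕ)
        (𝓝 (L u - u)) := ((L.continuous.tendsto u).comp hu).sub hu
    have h2 : Tendsto (fun m : ℕ => L (average L (m + 1) e) - average L (m + 1) e) (hyperfilter ℕ)
        (𝓝 0) := by
      refine (squeeze_zero_norm (a := fun m : ℕ => 2 * (1 / ((m : ℝ) + 1))) (fun m => ?_)
        ?_).mono_left Nat.hyperfilter_le_atTop
      · refine (hL.norm_map_average_sub_le (Nat.succ_pos m) e).trans_eq ?_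
        rw [hnorm]
        push_cast
        ring
      · simpa using (tendsto_one_div_add_atTop_nhds_zero_nat (𝕜 := ℝ)).const_mul 2
    exact sub_eq_zero.1 (tendsto_nhds_unique h1 h2)
  · have h1 := tendsto_integral_mul hu (φ := fun _ => 1) measurable_const (C := 1) (by simp)
    simp only [mul_one] at h1
    refine tendsto_nhds_unique h1 ?_
    simp only [hL.average_integral (Nat.succ_pos _), hint]
    exact tendsto_const_nhds

end UpperBound

section Stationary

variable {ρ : ℝ → ℝ} {δ V : ℝ} {T : UnitAddCircle → UnitAddCircle} {h : UnitAddCircle → ℝ}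
variable {L : (UnitAddCircle →₁[volume] ℝ) →L[ℝ] (UnitAddCircle →₁[volume] ℝ)}
variable {W : UnitAddCircle → ℝ} {α B ε R : ℝ}

theorem IsProbabilityDensity.integral_abs_eq_one (hh : IsProbabilityDensity h) : ∫ x, |h x| = 1 :=
  (integral_congr_ae (hh.nonneg.mono fun _ hx => abs_of_nonneg hx)).trans hh.integral_eq_one

theorem IsStationaryDensity.exists_lipschitz (hT : Measurable T) {C : NNReal}
    (hC : ∀ A, MeasurableSet A → volume (T ⁻¹' A) ≤ C * volume A) (hδ : 0 < δ) (hδ1 : δ ≤ 1)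
    (hr : IsScaledKernel (rescaledKernel ρ δ) δ V) (hh : IsStationaryDensity T ρ δ h) :
    ∃ (h' : UnitAddCircle → ℝ) (K : NNReal), LipschitzWith K h' ∧ h' =ᵐ[volume] h := by
  have hprob := isProbabilityMeasure_densityMeasure hh.1
  obtain ⟨h', ⟨K, hK⟩, h0, heq⟩ := exists_lipschitz_density hT hC hδ hδ1 hr hh.2
  obtain ⟨A, hA⟩ := exists_abs_le_of_continuous hK.continuous
  have hi := integrable_of_abs_le hK.continuous.measurable hA
  refine ⟨h', K, hK, ae_eq_of_forall_integral_mul hi hh.1.integrable fun φ _ _ => ?_⟩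
  rw [← integral_densityMeasure hi (Eventually.of_forall h0),
    ← integral_densityMeasure hh.1.integrable hh.1.nonneg, heq]

theorem IsStationaryDensity.varLE (hT : Measurable T) {C : NNReal}
    (hC : ∀ A, MeasurableSet A → volume (T ⁻¹' A) ≤ C * volume A) (hδ : 0 < δ) (hδ1 : δ ≤ 1)
    (hδε : δ ≤ ε) (hr : IsScaledKernel (rescaledKernel ρ δ) δ V) (hα0 : 0 < α) (hα1 : α < 1)
    (hWR : ∀ x, W x ≤ R)
    (hLY : ∀ (f : UnitAddCircle → ℝ) (K : ℝ), Integrable f →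
        VarLE W f K → ∀ t : ℝ, |t| ≤ ε → ∀ Φ φ, TestPair Φ φ → (∀ x, |Φ x| ≤ W x) →
          ∫ x, f x * φ (T x + t) ≤ α * K + B * ∫ x, |f x|)
    (hh : IsStationaryDensity T ρ δ h) : VarLE W h (B / (1 - α)) := by
  have h1α : 0 < 1 - α := by linarith
  obtain ⟨h', K, hK, hae⟩ := hh.exists_lipschitz hT hC hδ hδ1 hr
  have hv0 : VarLE W h (K * R) := (varLE_of_lipschitz hWR hK).congr_ae hae
  have hstep : ∀ K, VarLE W h K → VarLE W h (α * K + B) := by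
    intro K hK Φ φ hp hΦ
    obtain ⟨A, hA⟩ := hp.bdd
    refine hh.integral_mul_le hT hδ hr hp.meas hA fun t ht => ?_
    have := hLY h K hh.1.integrable hK t (ht.trans hδε) Φ φ hp hΦ
    rwa [hh.1.integral_abs_eq_one, mul_one] at this
  have hn : ∀ n : ℕ, VarLE W h (α ^ n * (K * R - B / (1 - α)) + B / (1 - α)) := by
    intro n
    induction n with
    | zero => simpa using hv0
    | succ n ih =>
      convert hstep _ ih using 1
      field_simp
      ring
  intro Φ φ hp hΦ
  have hlim : Tendsto (fun n : ℕ => α ^ n * (K * R - B / (1 - α)) + B / (1 - α)) atTop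
      (𝓝 (0 * (K * R - B / (1 - α)) + B / (1 - α))) :=
    ((tendsto_pow_atTop_nhds_zero_of_lt_one hα0.le hα1).mul_const _).add_const _
  rw [zero_mul, zero_add] at hlim
  exact ge_of_tendsto' hlim fun n => hn n Φ φ hp hΦ

/-- A stationary density is almost invariant under the transfer operator. -/
theorem IsTransferOperator.norm_sub_map_le (hL : IsTransferOperator T L) (hT : Measurable T)
    (hδ : 0 < δ) (hr : IsScaledKernel (rescaledKernel ρ δ) δ V) (hh : IsStationaryDensity T ρ δ h)
    (hW : ∀ x, 1 ≤ W x) {f : UnitAddCircle →₁[volume] ℝ} (hf : f =ᵐ[volume] h) {K : ℝ}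
    (hK : VarLE W (L f) K) : ‖f - L f‖ ≤ δ * K := by
  have hK0 := hK.nonneg hW
  rw [L1_norm_eq]
  refine integral_abs_le_of_forall_continuous (L1.integrable_coeFn _) fun φ hφ hφ1 => ?_
  have hφs : ∀ t : ℝ, Continuous fun x : UnitAddCircle => φ (x + t) := fun t =>
    hφ.comp (continuous_id.add continuous_const)
  have e1 : ∫ x, (f - L f : UnitAddCircle →₁[volume] ℝ) x * φ x =
      (∫ x, h x * φ x) - ∫ x, L f x * φ x := by
    rw [← integral_sub (integrable_mul_of_abs_le hh.1.integrable hφ.measurable hφ1)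
      (integrable_mul_of_abs_le (L1.integrable_coeFn _) hφ.measurable hφ1)]
    refine integral_congr_ae ?_
    filter_upwards [Lp.coeFn_sub f (L f), hf] with x h1 h2
    rw [h1, Pi.sub_apply, h2, sub_mul]
  have e2 : ∫ x, h x * φ x ≤ (∫ x, L f x * φ x) + δ * K := by
    refine hh.integral_mul_le hT hδ hr hφ.measurable hφ1 fun t ht => ?_
    have e3 : ∫ x, h x * φ (T x + t) = ∫ x, L f x * φ (x + t) := by
      rw [hL.integral_mul f (fun x => φ (x + t)) (hφs t).measurable 1 fun x => hφ1 _]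
      exact integral_congr_ae (hf.mono fun x hx => by
        show h x * φ (T x + t) = f x * φ (T x + t)
        rw [hx])
    have e4 := hK.integral_shift_sub_le hW hφ hφ1 t
    simp only [mul_sub] at e4
    rw [integral_sub (integrable_mul_of_abs_le (L1.integrable_coeFn _) (hφs t).measurable
      fun x => hφ1 _) (integrable_mul_of_abs_le (L1.integrable_coeFn _) hφ.measurable hφ1)] at e4
    have e5 : |t| * K ≤ δ * K := mul_le_mul_of_nonneg_right ht hK0
    linarith
  linarith

theorem isStationaryDensity_zero_iff :
    IsStationaryDensity T ρ 0 h ↔ IsInvariantDensity T h := by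
  have : noiseLaw ρ 0 = Measure.dirac 0 := if_pos rfl
  refine and_congr_right fun hh => ?_
  have hprob := isProbabilityMeasure_densityMeasure hh
  rw [annealedTransfer, this, Measure.dirac_zero_conv]

theorem exists_pow_two_ge {δ : ℝ} (hδ : 0 < δ) : ∃ m : ℕ, 1 / 2 ^ m ≤ δ ∧
    (m : ℝ) ≤ |Real.log δ| / Real.log 2 + 1 := by
  have hl2 : 0 < Real.log 2 := Real.log_pos one_lt_two
  refine ⟨⌈|Real.log δ| / Real.log 2⌉₊, ?_, (Nat.ceil_lt_add_one (by positivity)).le⟩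
  have h1 := Nat.le_ceil (|Real.log δ| / Real.log 2)
  set m := ⌈|Real.log δ| / Real.log 2⌉₊
  rw [div_le_iff₀ hl2] at h1
  rw [← Real.log_le_log_iff (by positivity) hδ, Real.log_div one_ne_zero (by positivity),
    Real.log_one, Real.log_pow]
  linarith [neg_abs_le (Real.log δ)]

theorem exists_integral_abs_sub_le (hT : Measurable T) {C : NNReal}
    (hC : ∀ A, MeasurableSet A → volume (T ⁻¹' A) ≤ C * volume A) (hα0 : 0 < α) (hα1 : α < 1)
    (hB : 0 ≤ B) (hε : 0 < ε) (hW : ∀ x, 1 ≤ W x) (hWR : ∀ x, W x ≤ R)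
    (hLY : ∀ (f : UnitAddCircle → ℝ) (K : ℝ), Integrable f →
        VarLE W f K → ∀ t : ℝ, |t| ≤ ε → ∀ Φ φ, TestPair Φ φ → (∀ x, |Φ x| ≤ W x) →
          ∫ x, f x * φ (T x + t) ≤ α * K + B * ∫ x, |f x|)
    (hρ : IsNoiseKernel ρ) {h₀ : UnitAddCircle → ℝ} (hh₀ : IsInvariantDensity T h₀)
    (huniq : ∀ h : UnitAddCircle → ℝ, IsInvariantDensity T h → h =ᵐ[volume] h₀) {δbar : ℝ}
    (hδbar : δbar ∈ Ioo (0 : ℝ) 1) : ∃ C : ℝ, 0 ≤ C ∧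
      ∀ δ ∈ Ico (0 : ℝ) δbar, ∀ h : UnitAddCircle → ℝ, IsStationaryDensity T ρ δ h →
        ∫ x, |h₀ x - h x| ≤ C * (δ * |Real.log δ|) := by
  have h1α : 0 < 1 - α := by linarith
  have hl2 : 0 < Real.log 2 := Real.log_pos one_lt_two
  have hac : volume.map T ≪ volume := Measure.AbsolutelyContinuous.mk fun A hA h0 => by
    have := hC A hA
    rw [h0, mul_zero] at this
    rw [Measure.map_apply hT hA]
    exact le_antisymm this zero_le
  obtain ⟨L, hL⟩ := exists_isTransferOperator hT hac
  have hLY' : ∀ (f : UnitAddCircle →₁[volume] ℝ) K, VarLE W f K → VarLE W (L f) (α * K + B * ‖f‖) := by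
    intro f K hK Φ φ hp hΦ
    obtain ⟨A, hA⟩ := hp.bdd
    rw [hL.integral_mul f φ hp.meas A hA, L1_norm_eq]
    simpa using hLY f K (L1.integrable_coeFn f) hK 0 (by simpa using hε.le) Φ φ hp hΦ
  have huniq' : ∀ u : UnitAddCircle →₁[volume] ℝ, L u = u → ∫ x, u x = 0 → u = 0 := by
    intro u hu h0
    have h1 := ((hL.map_eq_iff u).1 hu).ae_eq_zero hT huniq (Lp.stronglyMeasurable u).measurable
      (L1.integrable_coeFn u) h0
    exact Lp.ext (h1.trans (Lp.coeFn_zero ℝ 1 volume).symm)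
  obtain ⟨A, hA0, hA⟩ := hL.exists_norm_le hα0 hα1 hB hW hLY' huniq'
  obtain ⟨u, huL, hu1, huv⟩ := hL.exists_fixed hα0 hα1 hB hW hWR hLY'
  set f₀ : UnitAddCircle →₁[volume] ℝ := hh₀.1.integrable.toL1 with hf₀
  have hf₀h : f₀ =ᵐ[volume] h₀ := hh₀.1.integrable.coeFn_toL1
  have hf₀1 : ∫ x, f₀ x = 1 := by rw [integral_congr_ae hf₀h, hh₀.1.integral_eq_one]
  have hf₀L : L f₀ = f₀ := by
    refine (hL.map_eq_iff f₀).2 fun φ hφ A hA => ?_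
    have := (isInvariantDensity_iff hT hh₀.1).1 hh₀ φ hφ A hA
    rw [integral_congr_ae (hf₀h.mono fun x hx => show f₀ x * φ (T x) = h₀ x * φ (T x) by rw [hx]),
      integral_congr_ae (hf₀h.mono fun x hx => show f₀ x * φ x = h₀ x * φ x by rw [hx]), this]
  have hf₀v : VarLE W f₀ (B / (1 - α)) := by
    have : u - f₀ = 0 := huniq' _ (by rw [map_sub, huL, hf₀L]) (by
      rw [integral_L1_sub, hu1, hf₀1, sub_self])
    rwa [sub_eq_zero.1 this] at huv
  set K₁ : ℝ := B / (1 - α) with hK₁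
  have hK₁0 : 0 ≤ K₁ := div_nonneg hB h1α.le
  have hK₁' : α * K₁ + B = K₁ := by rw [hK₁]; field_simp; ring
  set ℓ : ℝ := |Real.log δbar| with hℓ
  have hℓ0 : 0 < ℓ := abs_pos.2 (Real.log_neg hδbar.1 hδbar.2).ne
  set K : ℝ := 2 * K₁ + 2 with hK
  refine ⟨(K + A * K₁) / ℓ + A * K₁ / Real.log 2 + 2 / (ε * ℓ), by positivity,
    fun δ hδ h hh => ?_⟩
  rcases hδ.1.eq_or_lt with rfl | hδ0
  · have := huniq h (isStationaryDensity_zero_iff.1 hh)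
    rw [integral_congr_ae (this.mono fun x hx => show |h₀ x - h x| = 0 by rw [hx, sub_self, abs_zero])]
    simp
  have hδ1 : δ < 1 := hδ.2.trans hδbar.2
  have hlog : ℓ ≤ |Real.log δ| := by
    rw [hℓ, abs_of_neg (Real.log_neg hδbar.1 hδbar.2), abs_of_neg (Real.log_neg hδ0 hδ1)]
    exact neg_le_neg (Real.log_le_log hδ0 hδ.2.le)
  set l : ℝ := |Real.log δ| with hl
  set f : UnitAddCircle →₁[volume] ℝ := hh.1.integrable.toL1 with hf
  have hfh : f =ᵐ[volume] h := hh.1.integrable.coeFn_toL1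
  have hf1 : ∫ x, f x = 1 := by rw [integral_congr_ae hfh, hh.1.integral_eq_one]
  have hnorm : ∫ x, |h₀ x - h x| = ‖f - f₀‖ := by
    rw [L1_norm_eq]
    refine integral_congr_ae ?_
    filter_upwards [Lp.coeFn_sub f f₀, hfh, hf₀h] with x h1 h2 h3
    rw [h1, Pi.sub_apply, h2, h3, abs_sub_comm]
  have hfn : ‖f‖ = 1 := by
    rw [L1_norm_eq, integral_congr_ae (hfh.mono fun x hx => show |f x| = |h x| by rw [hx]),
      hh.1.integral_abs_eq_one]
  have hf₀n : ‖f₀‖ = 1 := by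
    rw [L1_norm_eq, integral_congr_ae (hf₀h.mono fun x hx => show |f₀ x| = |h₀ x| by rw [hx]),
      hh₀.1.integral_abs_eq_one]
  have hn2 : ‖f - f₀‖ ≤ 2 := (norm_sub_le _ _).trans (by rw [hfn, hf₀n]; norm_num)
  rw [hnorm, add_mul, add_mul]
  have hl0 : 0 < l := hℓ0.trans_le hlog
  have t1 : 0 ≤ (K + A * K₁) / ℓ * (δ * l) := by positivity
  have t2 : 0 ≤ A * K₁ / Real.log 2 * (δ * l) := by positivity
  have t3 : 0 ≤ 2 / (ε * ℓ) * (δ * l) := by positivity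
  rcases le_or_gt δ ε with hδε | hδε
  · obtain ⟨V, hr⟩ := hρ.isScaledKernel hδ0
    have hv : VarLE W f K₁ :=
      (hh.varLE hT hC hδ0 hδ1.le hδε hr hα0 hα1 hWR hLY).congr_ae hfh.symm
    have hLv : VarLE W (L f) K₁ := by
      have := hLY' f K₁ hv
      rwa [hfn, mul_one, hK₁'] at this
    have hd := hL.norm_sub_map_le hT hδ0 hr hh hW hfh hLv
    have hd' : ‖(f - f₀) - L (f - f₀)‖ ≤ δ * K₁ := by
      rw [map_sub, hf₀L, sub_sub_sub_cancel_right]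
      exact hd
    have hwv : VarLE W (f - f₀ : UnitAddCircle →₁[volume] ℝ) K := by
      have h1 := hv.add_L1 (hf₀v.smul_L1 (-1))
      rw [neg_one_smul, ← sub_eq_add_neg] at h1
      refine h1.mono ?_
      rw [abs_neg, abs_one, one_mul, hK]
      linarith
    obtain ⟨m, hm1, hm2⟩ := exists_pow_two_ge hδ0
    have hfin := hA (f - f₀) K (by rw [integral_L1_sub, hf1, hf₀1, sub_self])
      (hn2.trans (by rw [hK]; linarith)) hwv m
    have s1 : K / 2 ^ m ≤ K * δ := by
      rw [div_eq_mul_one_div]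
      exact mul_le_mul_of_nonneg_left hm1 (by positivity)
    have s2 : m * A * ‖(f - f₀) - L (f - f₀)‖ ≤ (l / Real.log 2 + 1) * A * (δ * K₁) := by
      gcongr
    have s3 : (K + A * K₁) * δ ≤ (K + A * K₁) / ℓ * (δ * l) := by
      rw [div_mul_eq_mul_div, le_div_iff₀ hℓ0]
      calc (K + A * K₁) * δ * ℓ ≤ (K + A * K₁) * δ * l :=
            mul_le_mul_of_nonneg_left hlog (by positivity)
        _ = _ := by ring
    have s4 : (l / Real.log 2 + 1) * A * (δ * K₁) =
        A * K₁ / Real.log 2 * (δ * l) + A * K₁ * δ := by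
      field_simp
    linarith
  · have s1 : 2 ≤ 2 / (ε * ℓ) * (δ * l) := by
      rw [div_mul_eq_mul_div, le_div_iff₀ (by positivity)]
      exact mul_le_mul_of_nonneg_left (mul_le_mul hδε.le hlog hℓ0.le hδ0.le) two_pos.le
    linarith

end Stationary

/-! ### The example -/

theorem exampleMap_left {x : ℝ} (hx : x ∈ Icc (0 : ℝ) (1 / 2)) :
    exampleMap (x : UnitAddCircle) = ((x + 1 / 2 : ℝ) : UnitAddCircle) := by
  rw [exampleMap, AddCircle.liftIco_zero_coe_apply ⟨hx.1, by linarith [hx.2]⟩, if_pos hx.2]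

theorem exampleMap_right {x : ℝ} (hx : x ∈ Ioo (1 / 2 : ℝ) 1) :
    exampleMap (x : UnitAddCircle) = ((2 * (1 - x) : ℝ) : UnitAddCircle) := by
  rw [exampleMap, AddCircle.liftIco_zero_coe_apply ⟨by linarith [hx.1], hx.2⟩, if_neg (not_le.2 hx.1)]

theorem exampleDensity_left {x : ℝ} (hx : x ∈ Icc (0 : ℝ) (1 / 2)) :
    exampleDensity (x : UnitAddCircle) = 2 / 3 := by
  rw [exampleDensity, AddCircle.liftIco_zero_coe_apply ⟨hx.1, by linarith [hx.2]⟩, if_pos hx.2]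

theorem exampleDensity_right {x : ℝ} (hx : x ∈ Ioo (1 / 2 : ℝ) 1) :
    exampleDensity (x : UnitAddCircle) = 4 / 3 := by
  rw [exampleDensity, AddCircle.liftIco_zero_coe_apply ⟨by linarith [hx.1], hx.2⟩,
    if_neg (not_le.2 hx.1)]

theorem isPiecewiseC2With_of_affine {T : UnitAddCircle → UnitAddCircle} {Λ : ℝ} {n : ℕ} {d : ℕ → ℝ}
    (h0 : d 0 = 0) (hn : d n = 1) (hd : ∀ i < n, d i < d (i + 1)) (a b : ℕ → ℝ)
    (hΛ : ∀ i, Λ ≤ |a i|) (hT : ∀ i < n, ∀ x ∈ Ioo (d i) (d (i + 1)),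
      T (x : UnitAddCircle) = ((a i * x + b i : ℝ) : UnitAddCircle)) : IsPiecewiseC2With T Λ := by
  refine ⟨n, d, h0, hn, hd, fun i hi => ⟨fun x => a i * x + b i, ?_, hT i hi, fun x hx => ?_⟩⟩
  · fun_prop
  · have h1 : HasDerivAt (fun x => a i * x + b i) (a i) x := by
      simpa using ((hasDerivAt_id x).const_mul (a i)).add_const (b i)
    rw [h1.hasDerivWithinAt.derivWithin (uniqueDiffOn_Icc (hd i hi) x hx)]
    exact hΛ i

theorem isPiecewiseExpanding_exampleMap : IsPiecewiseExpanding exampleMap := by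
  constructor
  · refine isPiecewiseC2With_of_affine (n := 2) (d := fun i => i / 2) (by simp) (by simp)
      (fun i _ => by push_cast; linarith) (fun i => if i = 0 then 1 else -2)
      (fun i => if i = 0 then 1 / 2 else 2) (fun i => abs_nonneg _) fun i hi x hx => ?_
    interval_cases i
    · norm_num at hx
      rw [exampleMap_left ⟨hx.1.le, hx.2.le⟩]
      norm_num
    · norm_num at hx
      rw [exampleMap_right ⟨hx.1, hx.2⟩]
      congr 1
      norm_num
      ring
  · refine ⟨2, two_pos, 2, one_lt_two, ?_⟩
    refine isPiecewiseC2With_of_affine (n := 3)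
      (d := fun i => if i = 0 then 0 else ((i : ℝ) + 1) / 4) (by simp) (by norm_num)
      (fun i hi => by interval_cases i <;> norm_num) (fun i => if i = 1 then 4 else -2)
      (fun i => if i = 0 then 1 else if i = 1 then -2 else 5 / 2)
      (fun i => by split_ifs <;> norm_num) fun i hi x hx => ?_
    rw [Function.iterate_succ_apply, Function.iterate_one]
    interval_cases i
    · norm_num at hx
      rw [exampleMap_left ⟨hx.1.le, hx.2.le⟩,
        exampleMap_right ⟨by linarith [hx.1], by linarith [hx.2]⟩]
      congr 1
      norm_num
      ring
    · norm_num at hx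
      rw [exampleMap_right ⟨hx.1, by linarith [hx.2]⟩,
        exampleMap_right ⟨by linarith [hx.2], by linarith [hx.1]⟩]
      congr 1
      norm_num
      ring
    · norm_num at hx
      rw [exampleMap_right ⟨by linarith [hx.1], hx.2⟩,
        exampleMap_left ⟨by linarith [hx.2], by linarith [hx.1]⟩]
      congr 1
      norm_num
      ring

theorem isTurningPoint_exampleMap {z z' : ℝ} (hz : z ∈ Icc (0 : ℝ) (1 / 2))
    (hz' : z' ∈ Icc (1 / 2 : ℝ) 1) (h : (z : UnitAddCircle) = z') :
    IsTurningPoint exampleMap (z : UnitAddCircle) := by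
  rw [IsTurningPoint, circleDifferentiableAt_iff]
  rintro ⟨D, hD⟩
  have h1 : HasDerivAt (fun x : ℝ => x + 1 / 2) 1 z := (hasDerivAt_id z).add_const _
  have h2 : HasDerivAt (fun x : ℝ => 2 * (1 - x)) (-2) z' := by
    simpa using ((hasDerivAt_id z').const_sub 1).const_mul 2
  have e1 := (hD.eq_of_branch (by norm_num) h1.hasDerivWithinAt hz rfl
    fun s hs => exampleMap_left ⟨hs.1.le, hs.2.le⟩).2
  have e2 := (hD.eq_of_branch (by norm_num) h2.hasDerivWithinAt hz' h.symm
    fun s hs => exampleMap_right hs).2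
  linarith

theorem isLimitValue_exampleMap_left {z : ℝ} (hz : z ∈ Icc (0 : ℝ) (1 / 2)) :
    IsLimitValue exampleMap (z : UnitAddCircle) ((z + 1 / 2 : ℝ) : UnitAddCircle) :=
  isLimitValue_of_branch (G := fun x => x + 1 / 2) (by norm_num) hz
    (by fun_prop) fun s hs => exampleMap_left ⟨hs.1.le, hs.2.le⟩

theorem isLimitValue_exampleMap_right {z : ℝ} (hz : z ∈ Icc (1 / 2 : ℝ) 1) :
    IsLimitValue exampleMap (z : UnitAddCircle) ((2 * (1 - z) : ℝ) : UnitAddCircle) :=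
  isLimitValue_of_branch (G := fun x => 2 * (1 - x)) (by norm_num) hz
    (by fun_prop) fun s hs => exampleMap_right hs

theorem coe_one_circle : ((1 : ℝ) : UnitAddCircle) = ((0 : ℝ) : UnitAddCircle) :=
  coe_eq_coe_iff.2 ⟨-1, by norm_num⟩

theorem isPeriodicTurningPoint_exampleMap_zero :
    IsPeriodicTurningPoint exampleMap ((0 : ℝ) : UnitAddCircle) := by
  refine ⟨isTurningPoint_exampleMap (z' := 1) (by norm_num) (by norm_num) coe_one_circle.symm,
    Relation.TransGen.single ?_⟩
  have h := isLimitValue_exampleMap_right (z := 1) (by norm_num)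
  rwa [sub_self, mul_zero, coe_one_circle] at h

theorem isPeriodicTurningPoint_exampleMap_half :
    IsPeriodicTurningPoint exampleMap ((1 / 2 : ℝ) : UnitAddCircle) := by
  refine ⟨isTurningPoint_exampleMap (z' := 1 / 2) (by norm_num) (by norm_num) rfl,
    Relation.TransGen.tail (b := ((0 : ℝ) : UnitAddCircle)) (Relation.TransGen.single ?_) ?_⟩
  · have h := isLimitValue_exampleMap_left (z := 1 / 2) (by norm_num)
    rwa [add_halves, coe_one_circle] at h
  · have h := isLimitValue_exampleMap_left (z := 0) (by norm_num)
    rwa [zero_add] at h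

theorem measurable_exampleMap : Measurable exampleMap := by
  obtain ⟨_, _, _, _, _, _, _, _, _, h⟩ := exists_expandingBranches isPiecewiseExpanding_exampleMap
  exact h.measurable

theorem measurable_exampleDensity : Measurable exampleDensity := by
  have h : Measurable fun x : ℝ => if x ≤ 1 / 2 then (2 / 3 : ℝ) else 4 / 3 :=
    Measurable.ite measurableSet_Iic measurable_const measurable_const
  exact h.comp (measurable_subtype_coe.comp (AddCircle.measurableEquivIco (1 : ℝ) 0).measurable)

theorem exampleDensity_eq (x : UnitAddCircle) : exampleDensity x = 2 / 3 ∨ exampleDensity x = 4 / 3 := by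
  rw [exampleDensity, AddCircle.liftIco, Function.comp_apply, Set.domRestrict_apply]
  split_ifs
  · exact Or.inl rfl
  · exact Or.inr rfl

theorem abs_exampleDensity_le (x : UnitAddCircle) : |exampleDensity x| ≤ 4 / 3 := by
  rcases exampleDensity_eq x with h | h <;> rw [h] <;> norm_num

theorem integrable_exampleDensity : Integrable exampleDensity :=
  integrable_of_abs_le measurable_exampleDensity abs_exampleDensity_le

theorem integral_circle_eq_add {u : UnitAddCircle → ℝ} (hu : Integrable u) :
    ∫ x, u x = (∫ x in (0 : ℝ)..(1 / 2), u x) + ∫ x in (1 / 2 : ℝ)..1, u x := by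
  rw [intervalIntegral.integral_add_adjacent_intervals
    (intervalIntegrable_coe hu le_rfl (by norm_num) (by norm_num))
    (intervalIntegrable_coe hu (by norm_num) (by norm_num) le_rfl),
    ← UnitAddCircle.intervalIntegral_preimage 0, zero_add]

theorem intervalIntegral_congr_Ioo {f g : ℝ → ℝ} {a b : ℝ} (hab : a ≤ b)
    (h : ∀ x ∈ Ioo a b, f x = g x) : ∫ x in a..b, f x = ∫ x in a..b, g x := by
  rw [intervalIntegral.integral_of_le hab, intervalIntegral.integral_of_le hab,
    integral_Ioc_eq_integral_Ioo, integral_Ioc_eq_integral_Ioo]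
  exact setIntegral_congr_fun measurableSet_Ioo h

theorem integral_exampleDensity_mul {φ : UnitAddCircle → ℝ} (hφ : Measurable φ) {C : ℝ}
    (hC : ∀ x, |φ x| ≤ C) : ∫ x, exampleDensity x * φ x =
      2 / 3 * (∫ x in (0 : ℝ)..(1 / 2), φ x) + 4 / 3 * ∫ x in (1 / 2 : ℝ)..1, φ x := by
  rw [integral_circle_eq_add (integrable_mul_of_abs_le integrable_exampleDensity hφ hC)]
  congr 1
  · rw [← intervalIntegral.integral_const_mul]
    exact intervalIntegral_congr_Ioo (by norm_num) fun x hx => by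
      rw [exampleDensity_left ⟨hx.1.le, hx.2.le⟩]
  · rw [← intervalIntegral.integral_const_mul]
    exact intervalIntegral_congr_Ioo (by norm_num) fun x hx => by rw [exampleDensity_right hx]

theorem isInvariantDensity_exampleDensity : IsInvariantDensity exampleMap exampleDensity := by
  have hprob : IsProbabilityDensity exampleDensity := by
    refine ⟨integrable_exampleDensity, Eventually.of_forall fun x => ?_, ?_⟩
    · rcases exampleDensity_eq x with h | h <;> rw [h] <;> norm_num
    · have := integral_exampleDensity_mul (φ := fun _ => 1) measurable_const (C := 1) (by simp)
      simp only [mul_one] at this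
      rw [this]
      simp
      norm_num
  refine (isInvariantDensity_iff measurable_exampleMap hprob).2 fun φ hφ C hC => ?_
  have hφi := integrable_of_abs_le hφ hC
  change ∫ x, exampleDensity x * (φ ∘ exampleMap) x = _
  rw [integral_exampleDensity_mul (hφ.comp measurable_exampleMap) fun x => hC _,
    integral_exampleDensity_mul hφ hC]
  have e1 : ∫ x in (0 : ℝ)..(1 / 2), (φ ∘ exampleMap) (x : UnitAddCircle) =
      ∫ x in (1 / 2 : ℝ)..1, φ (x : UnitAddCircle) := by
    rw [intervalIntegral_congr_Ioo (g := fun x : ℝ => φ ((x + 1 / 2 : ℝ) : UnitAddCircle))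
      (by norm_num) fun x hx => by rw [Function.comp_apply, exampleMap_left ⟨hx.1.le, hx.2.le⟩],
      intervalIntegral.integral_comp_add_right (fun x : ℝ => φ (x : UnitAddCircle))]
    norm_num
  have e2 : ∫ x in (1 / 2 : ℝ)..1, (φ ∘ exampleMap) (x : UnitAddCircle) =
      1 / 2 * ((∫ x in (0 : ℝ)..(1 / 2), φ x) + ∫ x in (1 / 2 : ℝ)..1, φ x) := by
    rw [intervalIntegral_congr_Ioo (g := fun x : ℝ => φ ((2 - 2 * x : ℝ) : UnitAddCircle))
      (by norm_num) fun x hx => by rw [Function.comp_apply, exampleMap_right hx, mul_sub, mul_one],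
      intervalIntegral.integral_comp_sub_mul (fun x : ℝ => φ (x : UnitAddCircle)) two_ne_zero,
      intervalIntegral.integral_add_adjacent_intervals
        (intervalIntegrable_coe hφi le_rfl (by norm_num) (by norm_num))
        (intervalIntegrable_coe hφi (by norm_num) (by norm_num) le_rfl)]
    norm_num
  rw [e1, e2]
  ring

theorem exampleDensity_not_ae_continuous :
    ¬ ∃ g : UnitAddCircle → ℝ, Continuous g ∧ g =ᵐ[volume] exampleDensity := by
  rintro ⟨g, hg, hge⟩
  have hgc : Continuous fun x : ℝ => g x := hg.comp (AddCircle.continuous_mk' (1 : ℝ))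
  have hae : ∀ᵐ (x : ℝ) ∂(volume.restrict (Ioc (0 : ℝ) 1)), g (x : UnitAddCircle) = exampleDensity x := by
    have h := (UnitAddCircle.measurePreserving_mk 0).quasiMeasurePreserving.ae hge
    rwa [zero_add] at h
  have key : ∀ p q c : ℝ, p < q → 0 ≤ p → q ≤ 1 →
      (∀ x ∈ Ioo p q, exampleDensity (x : UnitAddCircle) = c) → ∀ x ∈ Icc p q, g x = c := by
    intro p q c hpq hp hq hc
    have h1 : (fun x : ℝ => g x) =ᵐ[volume.restrict (Icc p q)] fun _ => c := by
      rw [← restrict_Ioo_eq_restrict_Icc]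
      have h2 := ae_restrict_of_ae_restrict_of_subset (μ := (volume : Measure ℝ))
        (show Ioo p q ⊆ Ioc 0 1 from fun x hx => ⟨hp.trans_lt hx.1, hx.2.le.trans hq⟩) hae
      filter_upwards [h2, ae_restrict_mem measurableSet_Ioo] with x h3 h4
      rw [h3, hc x h4]
    refine Measure.eqOn_of_ae_eq h1 hgc.continuousOn continuousOn_const ?_
    rw [interior_Icc, closure_Ioo hpq.ne]
  have h1 := key 0 (1 / 2) (2 / 3) (by norm_num) le_rfl (by norm_num)
    (fun x hx => exampleDensity_left ⟨hx.1.le, hx.2.le⟩) (1 / 2) (by norm_num)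
  have h2 := key (1 / 2) 1 (4 / 3) (by norm_num) (by norm_num) le_rfl
    (fun x hx => exampleDensity_right hx) (1 / 2) (by norm_num)
  rw [h1] at h2
  norm_num at h2

/-! ### The lower bound for the example -/

/-- The square wave equal to `1` on `[0,1/2]` and to `-1` on `(1/2,1)`. -/
def squareWave (x : UnitAddCircle) : ℝ := 3 - 3 * exampleDensity x

theorem measurable_squareWave : Measurable squareWave :=
  (measurable_exampleDensity.const_mul 3).const_sub 3

theorem squareWave_left {x : ℝ} (hx : x ∈ Icc (0 : ℝ) (1 / 2)) : squareWave (x : UnitAddCircle) = 1 := by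
  rw [squareWave, exampleDensity_left hx]
  norm_num

theorem squareWave_right {x : ℝ} (hx : x ∈ Ioo (1 / 2 : ℝ) 1) :
    squareWave (x : UnitAddCircle) = -1 := by
  rw [squareWave, exampleDensity_right hx]
  norm_num

theorem squareWave_eq (x : UnitAddCircle) : squareWave x = 1 ∨ squareWave x = -1 := by
  rw [squareWave]
  rcases exampleDensity_eq x with h | h <;> rw [h] <;> norm_num

theorem abs_squareWave (x : UnitAddCircle) : |squareWave x| ≤ 1 := by
  rcases squareWave_eq x with h | h <;> rw [h] <;> norm_num

theorem integrable_squareWave_shift_mul (y : UnitAddCircle) :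
    Integrable fun x => 1 - squareWave x * squareWave (x + y) := by
  refine (integrable_const 1).sub (integrable_of_abs_le
    (measurable_squareWave.mul (measurable_squareWave.comp (measurable_add_const y))) (C := 1)
    fun x => ?_)
  rw [abs_mul]
  exact mul_le_one₀ (abs_squareWave _) (abs_nonneg _) (abs_squareWave _)

theorem le_integral_squareWave_shift_mul {t : ℝ} (ht : |t| ≤ 1) :
    2 * (|t| * (1 - |t|)) ≤ ∫ x, (1 - squareWave x * squareWave (x + t)) := by
  have key : ∀ t ∈ Icc (0 : ℝ) 1,
      2 * (t * (1 - t)) ≤ ∫ x, (1 - squareWave x * squareWave (x + t)) := by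
    intro t ht
    have hnn : ∀ x y : UnitAddCircle, 0 ≤ 1 - squareWave x * squareWave y := fun x y => by
      rcases squareWave_eq x with h | h <;> rcases squareWave_eq y with h' | h' <;>
        rw [h, h'] <;> norm_num
    set p : ℝ := max (1 / 2 - t) 0 with hp
    set q : ℝ := min (1 / 2) (1 - t) with hq
    have hp0 : 0 ≤ p := le_max_right _ _
    have hq1 : q ≤ 1 := (min_le_left _ _).trans (by norm_num)
    have hlen : t * (1 - t) ≤ q - p := by
      have h0 := mul_nonneg ht.1 (sub_nonneg.2 ht.2)
      rcases max_choice (1 / 2 - t) 0 with h1 | h1 <;> rcases min_choice (1 / 2) (1 - t) with h2 | h2 <;>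
        rw [hp, hq, h1, h2] <;> nlinarith [ht.1, ht.2, sq_nonneg (t - 1 / 2)]
    have hpq : p ≤ q := by nlinarith [mul_nonneg ht.1 (sub_nonneg.2 ht.2)]
    have hi := integrable_squareWave_shift_mul t
    calc 2 * (t * (1 - t)) ≤ 2 * (q - p) := by linarith
      _ = ∫ x in p..q, (2 : ℝ) := by
        rw [intervalIntegral.integral_const, smul_eq_mul, mul_comm]
      _ = ∫ x in p..q, (1 - squareWave x * squareWave (x + t)) := by
        refine intervalIntegral_congr_Ioo hpq fun x hx => ?_
        have hx1 : 1 / 2 - t < x := (le_max_left _ _).trans_lt hx.1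
        have hx2 : x < 1 / 2 := hx.2.trans_le (min_le_left _ _)
        have hx3 : x < 1 - t := hx.2.trans_le (min_le_right _ _)
        rw [squareWave_left ⟨hp0.trans hx.1.le, hx2.le⟩, ← AddCircle.coe_add,
          squareWave_right ⟨by linarith, by linarith⟩]
        norm_num
      _ ≤ ∫ x in (0 : ℝ)..1, (1 - squareWave x * squareWave (x + t)) :=
        intervalIntegral.integral_mono_interval hp0 hpq hq1 (Eventually.of_forall fun x => hnn _ _)
          (intervalIntegrable_coe hi le_rfl zero_le_one le_rfl)
      _ = _ := by
        rw [← UnitAddCircle.intervalIntegral_preimage 0, zero_add]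
  rw [abs_le] at ht
  rcases le_total 0 t with h | h
  · rw [abs_of_nonneg h]
    exact key t ⟨h, ht.2⟩
  · rw [abs_of_nonpos h]
    have h1 := key (t + (1 : ℤ)) ⟨by push_cast; linarith [ht.1], by push_cast; linarith⟩
    rw [coe_add_int] at h1
    push_cast at h1
    linarith

theorem le_integral_exampleDensity_shift {t : ℝ} (ht : |t| ≤ 1) :
    (∫ x, exampleDensity x * squareWave x) + 2 / 3 * (|t| * (1 - |t|)) ≤
      ∫ x, exampleDensity x * squareWave (x + t) := by
  have hs : Measurable fun x : UnitAddCircle => squareWave (x + t) :=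
    measurable_squareWave.comp (measurable_add_const _)
  have hi1 := integrable_of_abs_le measurable_squareWave abs_squareWave
  have hi2 : Integrable fun x : UnitAddCircle => squareWave (x + t) :=
    integrable_of_abs_le hs fun x => abs_squareWave _
  have h1 := le_integral_squareWave_shift_mul ht
  have h2 : ∫ x : UnitAddCircle, squareWave (x + t) = ∫ x, squareWave x :=
    integral_add_right_eq_self squareWave (t : UnitAddCircle)
  have h3 : (∫ x, exampleDensity x * squareWave (x + t)) - ∫ x, exampleDensity x * squareWave x =
      (∫ x : UnitAddCircle, squareWave (x + t)) - (∫ x, squareWave x) +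
        1 / 3 * ∫ x, (1 - squareWave x * squareWave (x + t)) := by
    rw [← integral_const_mul, ← integral_sub hi2 hi1, ← integral_sub
      (integrable_mul_of_abs_le integrable_exampleDensity hs fun x => abs_squareWave _)
      (integrable_mul_of_abs_le integrable_exampleDensity measurable_squareWave abs_squareWave)]
    have hc := (integrable_squareWave_shift_mul (t : UnitAddCircle)).const_mul (1 / 3)
    have hd : Integrable fun x : UnitAddCircle => squareWave (x + t) - squareWave x := hi2.sub hi1
    rw [← integral_add hd hc]
    refine integral_congr_ae (Eventually.of_forall fun x => ?_)
    have e1 : exampleDensity x = 1 - squareWave x / 3 := by rw [squareWave]; ring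
    simp only
    rw [e1]
    rcases squareWave_eq x with h | h <;> rw [h] <;> ring
  linarith

theorem IsNoiseKernel.integrable {ρ : ℝ → ℝ} (hρ : IsNoiseKernel ρ) : Integrable ρ := by
  by_contra hi
  have := hρ.integral_eq_one
  rw [integral_undef hi] at this
  norm_num at this

theorem integrable_mul_abs_mul {r : ℝ → ℝ} (hr : Integrable r) (h0 : ∀ z, 1 < |z| → r z = 0) {a : ℝ}
    (ha : a ∈ Icc (0 : ℝ) 1) : Integrable fun z => r z * (|z| * (1 - a * |z|)) := by
  refine hr.mono (hr.aestronglyMeasurable.mul (by fun_prop)) (Eventually.of_forall fun z => ?_)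
  rw [Real.norm_eq_abs, Real.norm_eq_abs, abs_mul]
  rcases le_or_gt |z| 1 with hz | hz
  · have h1 : 0 ≤ a * |z| := mul_nonneg ha.1 (abs_nonneg z)
    have h2 : a * |z| ≤ 1 := mul_le_one₀ ha.2 (abs_nonneg z) hz
    rw [abs_of_nonneg (mul_nonneg (abs_nonneg z) (sub_nonneg.2 h2))]
    exact mul_le_of_le_one_right (abs_nonneg _)
      (mul_le_one₀ hz (sub_nonneg.2 h2) (by linarith))
  · rw [h0 z hz]
    simp

theorem IsNoiseKernel.eq_zero {ρ : ℝ → ℝ} (hρ : IsNoiseKernel ρ) (z : ℝ) (hz : 1 < |z|) : ρ z = 0 :=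
  hρ.support z fun h => not_le.2 hz (abs_le.2 h)

theorem IsNoiseKernel.integral_pos {ρ : ℝ → ℝ} (hρ : IsNoiseKernel ρ) :
    0 < ∫ z, ρ z * (|z| * (1 - |z|)) := by
  have hi : Integrable fun z => ρ z * (|z| * (1 - |z|)) := by
    simpa using integrable_mul_abs_mul hρ.integrable hρ.eq_zero (a := 1) (by norm_num)
  have hnn : ∀ z, 0 ≤ ρ z * (|z| * (1 - |z|)) := fun z => by
    rcases le_or_gt |z| 1 with hz | hz
    · exact mul_nonneg (hρ.nonneg z) (mul_nonneg (abs_nonneg z) (by linarith))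
    · rw [hρ.eq_zero z hz, zero_mul]
  have hI : 0 ≤ ∫ z, ρ z * (|z| * (1 - |z|)) := integral_nonneg hnn
  refine hI.lt_of_ne fun h0 => ?_
  have h1 := (integral_eq_zero_iff_of_nonneg hnn hi).1 h0.symm
  have hfin : ({0, 1, -1} : Set ℝ).Finite := by simp
  have h2 : ρ =ᵐ[volume] fun _ => 0 := by
    filter_upwards [h1, compl_mem_ae_iff.2 (hfin.measure_zero volume)] with z h3 h4
    simp only [mem_compl_iff, mem_insert_iff, mem_singleton_iff, not_or] at h4
    have h5 : |z| ≠ 0 := abs_ne_zero.2 h4.1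
    have h6 : 1 - |z| ≠ 0 := fun h6 => by
      rcases eq_or_eq_neg_of_abs_eq (show |z| = 1 by linarith) with h7 | h7
      · exact h4.2.1 h7
      · exact h4.2.2 h7
    exact (mul_eq_zero.1 h3).resolve_right (mul_ne_zero h5 h6)
  have := hρ.integral_eq_one
  rw [integral_congr_ae h2, integral_zero] at this
  norm_num at this

theorem IsNoiseKernel.le_integral_rescaledKernel {ρ : ℝ → ℝ} (hρ : IsNoiseKernel ρ) {δ : ℝ}
    (hδ : 0 < δ) (hδ1 : δ ≤ 1) :
    δ * ∫ z, ρ z * (|z| * (1 - |z|)) ≤ ∫ t, rescaledKernel ρ δ t * (|t| * (1 - |t|)) := by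
  have h1 : ∫ t, rescaledKernel ρ δ t * (|t| * (1 - |t|)) =
      δ * ∫ z, ρ z * (|z| * (1 - δ * |z|)) := by
    have h2 : ∀ t, rescaledKernel ρ δ t * (|t| * (1 - |t|)) =
        (fun z => ρ z * (|z| * (1 - δ * |z|))) (t / δ) := fun t => by
      simp only [rescaledKernel, abs_div, abs_of_pos hδ]
      field_simp
    rw [integral_congr_ae (Eventually.of_forall h2),
      Measure.integral_comp_div (fun z => ρ z * (|z| * (1 - δ * |z|))), abs_of_pos hδ, smul_eq_mul]
  rw [h1]
  refine mul_le_mul_of_nonneg_left (integral_mono ?_ ?_ fun z => ?_) hδ.le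
  · simpa using integrable_mul_abs_mul hρ.integrable hρ.eq_zero (a := 1) (by norm_num)
  · exact integrable_mul_abs_mul hρ.integrable hρ.eq_zero ⟨hδ.le, hδ1⟩
  · refine mul_le_mul_of_nonneg_left (mul_le_mul_of_nonneg_left ?_ (abs_nonneg z)) (hρ.nonneg z)
    nlinarith [abs_nonneg z]

theorem abs_integral_mul_sub_integral_mul_le {f h φ : UnitAddCircle → ℝ} (hf : Integrable f)
    (hh : Integrable h) (hφ : Measurable φ) (hφ1 : ∀ x, |φ x| ≤ 1) :
    |(∫ x, f x * φ x) - ∫ x, h x * φ x| ≤ ∫ x, |f x - h x| := by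
  rw [← integral_sub (integrable_mul_of_abs_le hf hφ hφ1) (integrable_mul_of_abs_le hh hφ hφ1)]
  refine abs_integral_le_integral_abs.trans (integral_mono
    ((integrable_mul_of_abs_le hf hφ hφ1).sub (integrable_mul_of_abs_le hh hφ hφ1)).abs
    (hf.sub hh).abs fun x => ?_)
  simp only
  rw [← sub_mul, abs_mul]
  exact mul_le_of_le_one_right (abs_nonneg _) (hφ1 x)

theorem le_integral_abs_exampleDensity_sub {ρ : ℝ → ℝ} (hρ : IsNoiseKernel ρ) {δ : ℝ} (hδ : 0 < δ)
    (hδ1 : δ ≤ 1) {h : UnitAddCircle → ℝ} (hh : IsStationaryDensity exampleMap ρ δ h) :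
    (∫ z, ρ z * (|z| * (1 - |z|))) / 3 * δ ≤ ∫ x, |exampleDensity x - h x| := by
  obtain ⟨V, hr⟩ := hρ.isScaledKernel hδ
  set e : ℝ := ∫ x, |exampleDensity x - h x| with he
  set I : ℝ := ∫ x, exampleDensity x * squareWave x with hI
  obtain ⟨hFm, hFb, hF⟩ :=
    hh.integral_mul_eq measurable_exampleMap hδ hr measurable_squareWave abs_squareWave
  rw [integral_noiseLaw hδ hr hFm] at hF
  have hFle : ∀ t : ℝ, |t| ≤ 1 →
      I - e + 2 / 3 * (|t| * (1 - |t|)) ≤ ∫ x, h x * squareWave (exampleMap x + t) := by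
    intro t ht
    have hs : Measurable fun x : UnitAddCircle => squareWave (x + t) :=
      measurable_squareWave.comp (measurable_add_const _)
    have h1 := abs_integral_mul_sub_integral_mul_le integrable_exampleDensity hh.1.integrable
      (hs.comp measurable_exampleMap) fun x => abs_squareWave _
    have h2 := (isInvariantDensity_iff measurable_exampleMap
      isInvariantDensity_exampleDensity.1).1 isInvariantDensity_exampleDensity _ hs 1
        fun x => abs_squareWave _
    have h3 := le_integral_exampleDensity_shift ht
    simp only [Function.comp_apply] at h1
    rw [h2] at h1
    linarith [(abs_le.1 h1).2]
  have hrz : ∀ t, 1 < |t| → rescaledKernel ρ δ t = 0 := fun t ht =>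
    hr.support t (hδ1.trans_lt ht)
  have hri := integrable_mul_abs_mul hr.integrable hrz (a := 1) (by norm_num)
  simp only [one_mul] at hri
  have hlow : (I - e) + 2 / 3 * ∫ t, rescaledKernel ρ δ t * (|t| * (1 - |t|)) ≤
      ∫ x, h x * squareWave x := by
    rw [hF]
    have e1 : (I - e) + 2 / 3 * ∫ t, rescaledKernel ρ δ t * (|t| * (1 - |t|)) =
        ∫ t, (rescaledKernel ρ δ t * (I - e) +
          2 / 3 * (rescaledKernel ρ δ t * (|t| * (1 - |t|)))) := by
      rw [integral_add (hr.integrable.mul_const _) (hri.const_mul _), integral_mul_const,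
        hr.integral_eq_one, one_mul, integral_const_mul]
    rw [e1]
    refine integral_mono ((hr.integrable.mul_const _).add (hri.const_mul _))
      (hr.integrable.mul_bdd (c := 1) (hFm.comp measurable_coe_circle).aestronglyMeasurable
        (Eventually.of_forall fun t => hFb _)) fun t => ?_
    rcases le_or_gt |t| 1 with ht | ht
    · have := mul_le_mul_of_nonneg_left (hFle t ht) (hr.nonneg t)
      simp only
      linarith
    · simp only [hrz t ht, zero_mul, mul_zero, add_zero, le_refl]
  have hup := abs_integral_mul_sub_integral_mul_le integrable_exampleDensity hh.1.integrable
    measurable_squareWave abs_squareWave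
  have hk := hρ.le_integral_rescaledKernel hδ hδ1
  linarith [(abs_le.1 hup).1]

end

end PiecewiseNoise

theorem proposition2 :
    -- maps without periodic turning points
    (∀ T : UnitAddCircle → UnitAddCircle, IsPiecewiseExpanding T →
      (∀ c : UnitAddCircle, ¬ IsPeriodicTurningPoint T c) →
      ∀ ρ : ℝ → ℝ, IsNoiseKernel ρ →
        -- stationary measures have Lipschitz densities
        (∀ δ ∈ Ioc (0 : ℝ) 1, ∀ μ : Measure UnitAddCircle, IsProbabilityMeasure μ →
          annealedTransfer T ρ δ μ = μ →
          ∃ h : UnitAddCircle → ℝ, (∃ K : NNReal, LipschitzWith K h) ∧ (∀ x, 0 ≤ h x) ∧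
            μ = densityMeasure h) ∧
        -- upper bound for the speed of convergence to the unique invariant density
        (∀ h₀ : UnitAddCircle → ℝ, IsInvariantDensity T h₀ →
          (∀ h : UnitAddCircle → ℝ, IsInvariantDensity T h → h =ᵐ[volume] h₀) →
          ∀ δbar ∈ Ioo (0 : ℝ) 1, ∃ C : ℝ, 0 ≤ C ∧
            ∀ δ ∈ Ico (0 : ℝ) δbar, ∀ h : UnitAddCircle → ℝ, IsStationaryDensity T ρ δ h →
              ∫ x, |h₀ x - h x| ≤ C * (δ * |Real.log δ|))) ∧
    -- the example with periodic turning points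
    (IsPiecewiseExpanding exampleMap ∧
      IsPeriodicTurningPoint exampleMap ((0 : ℝ) : UnitAddCircle) ∧
      IsPeriodicTurningPoint exampleMap ((1 / 2 : ℝ) : UnitAddCircle) ∧
      IsInvariantDensity exampleMap exampleDensity ∧
      (¬ ∃ g : UnitAddCircle → ℝ, Continuous g ∧ g =ᵐ[volume] exampleDensity) ∧
      ∀ ρ : ℝ → ℝ, IsNoiseKernel ρ → ∃ C' : ℝ, 0 < C' ∧
        ∀ δ ∈ Icc (0 : ℝ) 1, ∀ h : UnitAddCircle → ℝ, IsStationaryDensity exampleMap ρ δ h →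
          C' * δ ≤ ∫ x, |exampleDensity x - h x|) := by
  refine ⟨fun T hT hper ρ hρ => ?_, isPiecewiseExpanding_exampleMap,
    isPeriodicTurningPoint_exampleMap_zero, isPeriodicTurningPoint_exampleMap_half,
    isInvariantDensity_exampleDensity, exampleDensity_not_ae_continuous, fun ρ hρ =>
      ⟨(∫ z, ρ z * (|z| * (1 - |z|))) / 3, div_pos hρ.integral_pos three_pos, fun δ hδ h hh => ?_⟩⟩
  · obtain ⟨_, _, _, _, _, _, _, _, _, hb⟩ := exists_expandingBranches hT
    obtain ⟨C, hC⟩ := hb.volume_preimage_le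
    obtain ⟨W, α, B, ε, R, hα0, hα1, hB, hε, hW, hWR, hLY⟩ := hb.lasotaYorke hper
    refine ⟨fun δ hδ μ hμ hst => ?_, fun h₀ hh₀ huniq δbar hδbar =>
      exists_integral_abs_sub_le hb.measurable hC hα0 hα1 hB hε hW hWR hLY hρ hh₀ huniq hδbar⟩
    obtain ⟨V, hr⟩ := hρ.isScaledKernel hδ.1
    exact exists_lipschitz_density hb.measurable hC hδ.1 hδ.2 hr hst
  · rcases hδ.1.eq_or_lt with rfl | hδ0
    · rw [mul_zero]
      exact integral_nonneg fun x => abs_nonneg _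
    · exact le_integral_abs_exampleDensity_sub hρ hδ0 hδ.2 hh
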